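/- **Theorem.** A finite automaton is $A=(\Sigma,Q,E,I,F)$ with $\Sigma,Q$ finite, $I,F\subseteq Q$ and $E\subseteq Q\times(\Sigma\cup\{\epsilon\})\times Q$; $|A|_E=|E|$. A path is successful if it leads from $I$ to $F$; $A$ is trim if every state lies on a successful path, and $\epsilon$-cycle free if no nonempty cycle is labelled by the empty string. For $x\in\Sigma^*$ let $\mathrm{da}(A,x)$ be the number of successful paths labelled $x$. $A$ is exponentially ambiguous if $\sup_x \mathrm{da}(A,x)=\infty$ and there is no polynomial $h\in\mathbb N[X]$ with $\mathrm{da}(A,x)\le h(|x|)$ for all $x$. (1) It is decidable in time $O(|A|_E^2)$ whether a trim $\epsilon$-cycle-free finite automaton $A$ is exponentially ambiguous. Precisely: there are a program of a unit-cost RAM (zero-initialised memory; constants, copying, addition, truncated subtraction, indirect load and store, comparison tests, while loops; no multiplication) and a constant $C$ such that, for all $k,n\in\mathbb N$ and every trim $\epsilon$-cycle-free automaton $A$ with alphabet $\{0,\dots,k-1\}$ and states $\{0,\dots,n-1\}$, started on an input consisting of $k,n,|E|,|I|,|F|$ and listings, in any order, of $E$, $I$ and $F$, the program halts after at most $C(|A|_E^2+1)$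 steps with output $1$ if $A$ is exponentially ambiguous and $0$ otherwise, all stored numbers being at most $C(k+n+|A|_E+1)^2$. (2) Let $A\cap A$ be the intersection of $A$ with itself with $\epsilon$-filtering: its states are triples $(p,q,f)$ with $f$ a state of the filter; both components follow transitions with a common letter, or make an $\epsilon$-move in which both components follow an $\epsilon$-transition, or only the first does, or only the second does; the filter forbids exactly the consecutive $\epsilon$-moves (first, second), (second, first), (first, both), (second, both), and is reset by a letter. A state is initial if both components are initial and the filter is in its initial state, and final if both components are final. Then a trim $\epsilon$-cycle-free automaton $A$ is exponentially ambiguous if and only if, after $A\cap A$ is trimmed, some strongly connected component of it contains two states of the form $(p,p,f)$ and $(q,q',f')$ with $q\ne q'$. -/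

import Mathlib

namespace Ambiguity

/-! ## Finite automata with ε-transitions: paths, trimness, ambiguity

Automata are Mathlib's `εNFA α σ` (alphabet `α`, states `σ`, ε-transitions labelled `none`). -/

section Automata

universe u v

variable {α : Type u} {σ : Type v}

/-- The transition set `E ⊆ Q × (Σ ∪ {ε}) × Q`. -/
def transitions (A : εNFA α σ) : Set (σ × Option α × σ) :=
  {t | t.2.2 ∈ A.step t.1 t.2.1}

/-- `|A|_E`, the number of transitions. -/
noncomputable def numTransitions (A : εNFA α σ) : ℕ := (transitions A).ncard

/-- `IsPath A p π q`: the sequence of transitions `π` is a path from `p` to `q`. -/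
def IsPath (A : εNFA α σ) : σ → List (σ × Option α × σ) → σ → Prop
  | p, [], q => p = q
  | p, t :: π, q => t ∈ transitions A ∧ t.1 = p ∧ IsPath A t.2.2 π q

/-- The label in `Σ*` of a sequence of transitions: the concatenation of their labels. -/
def label (π : List (σ × Option α × σ)) : List α :=
  (π.map fun t => t.2.1).reduceOption

/-- The successful paths labelled `x`. A path is recorded as its origin state together with its
sequence of transitions, so that empty paths at different states are different paths. -/
def successfulPaths (A : εNFA α σ) (x : List α) : Set (σ × List (σ × Option α × σ)) :=
  {π | π.1 ∈ A.start ∧ (∃ q ∈ A.accept, IsPath A π.1 π.2 q) ∧ label π.2 = x}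

/-- The state `q` lies on a successful path. -/
def OnSuccessfulPath (A : εNFA α σ) (q : σ) : Prop :=
  ∃ i ∈ A.start, ∃ f ∈ A.accept, ∃ π₁ π₂, IsPath A i π₁ q ∧ IsPath A q π₂ f

/-- Every state lies on a successful path. -/
def IsTrim (A : εNFA α σ) : Prop := ∀ q, OnSuccessfulPath A q

/-- No nonempty cycle is labelled by the empty string. -/
def EpsCycleFree (A : εNFA α σ) : Prop :=
  ∀ q π, IsPath A q π q → label π = [] → π = []

/-- The degree of ambiguity of the string `x` in `A`. -/
noncomputable def da (A : εNFA α σ) (x : List α) : ℕ∞ := (successfulPaths A x).encard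

/-- The degree of ambiguity of `A`. -/
noncomputable def degreeOfAmbiguity (A : εNFA α σ) : ℕ∞ := ⨆ x : List α, da A x

def InfinitelyAmbiguous (A : εNFA α σ) : Prop := degreeOfAmbiguity A = ⊤

def PolynomiallyAmbiguous (A : εNFA α σ) : Prop :=
  ∃ h : Polynomial ℕ, ∀ x : List α, da A x ≤ ((h.eval x.length : ℕ) : ℕ∞)

def ExponentiallyAmbiguous (A : εNFA α σ) : Prop :=
  InfinitelyAmbiguous A ∧ ¬ PolynomiallyAmbiguous A

/-! ## Trimming, strongly connected components, ε-filtered intersection -/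

/-- The automaton obtained by deleting all states that lie on no successful path. -/
def trimmed (A : εNFA α σ) : εNFA α {q : σ // OnSuccessfulPath A q} where
  step p a := {q | q.1 ∈ A.step p.1 a}
  start := {q | q.1 ∈ A.start}
  accept := {q | q.1 ∈ A.accept}

/-- `p` and `q` lie in the same strongly connected component. -/
def SameSCC (A : εNFA α σ) (p q : σ) : Prop :=
  (∃ π, IsPath A p π q) ∧ (∃ π, IsPath A q π p)

/-- The states of the ε-filter. -/
inductive FilterState
  /-- initial, after a letter, or after a matched pair of ε-transitions -/
  | free
  /-- after an ε-transition of the first automaton alone -/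
  | left
  /-- after an ε-transition of the second automaton alone -/
  | right

/-- The intersection of two automata with ε-transitions. Common letters are matched. An ε-move
advances both automata by an ε-transition, or only the first, or only the second; the filter
forbids exactly the sequences (first, second), (second, first), (first, both), (second, both) of
consecutive ε-moves. -/
def inter {τ : Type*} (A : εNFA α σ) (B : εNFA α τ) : εNFA α (σ × τ × FilterState) where
  step s a := match a with
    | some x => {s' | s'.1 ∈ A.step s.1 (some x) ∧ s'.2.1 ∈ B.step s.2.1 (some x) ∧
        s'.2.2 = .free}
    | none => {s' |
        (s.2.2 = .free ∧ s'.1 ∈ A.step s.1 none ∧ s'.2.1 ∈ B.step s.2.1 none ∧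
          s'.2.2 = .free) ∨
        (s.2.2 ≠ .right ∧ s'.1 ∈ A.step s.1 none ∧ s'.2.1 = s.2.1 ∧ s'.2.2 = .left) ∨
        (s.2.2 ≠ .left ∧ s'.1 = s.1 ∧ s'.2.1 ∈ B.step s.2.1 none ∧ s'.2.2 = .right)}
  start := {s | s.1 ∈ A.start ∧ s.2.1 ∈ B.start ∧ s.2.2 = .free}
  accept := {s | s.1 ∈ A.accept ∧ s.2.1 ∈ B.accept}

end Automata

/-! ## A unit-cost word RAM

Registers and memory cells are indexed by natural numbers and hold natural numbers that never
exceed the word bound `W`: a program whose result would exceed `W` is stuck. There is no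
multiplication. Every elementary instruction and every evaluation of a test takes one step. -/

structure RAMState where
  reg : ℕ → ℕ
  mem : ℕ → ℕ

/-- Elementary instructions on registers `x`, `y`, `z`. -/
inductive Instr
  /-- `x := c` -/
  | const (x c : ℕ)
  /-- `x := y` -/
  | copy (x y : ℕ)
  /-- `x := y + z` -/
  | add (x y z : ℕ)
  /-- `x := max (y - z) 0` -/
  | sub (x y z : ℕ)
  /-- `x := mem[y]` -/
  | load (x y : ℕ)
  /-- `mem[x] := y` -/
  | store (x y : ℕ)

/-- Comparisons of two registers. -/
inductive Test
  | eq (x y : ℕ)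
  | lt (x y : ℕ)

def RAMState.setReg (s : RAMState) (x v : ℕ) : RAMState :=
  { s with reg := Function.update s.reg x v }

/-- Effect of an elementary instruction with word bound `W`; `none` on overflow. -/
def Instr.run (W : ℕ) (s : RAMState) : Instr → Option RAMState
  | .const x c => if c ≤ W then some (s.setReg x c) else none
  | .copy x y => some (s.setReg x (s.reg y))
  | .add x y z => if s.reg y + s.reg z ≤ W then some (s.setReg x (s.reg y + s.reg z)) else none
  | .sub x y z => some (s.setReg x (s.reg y - s.reg z))
  | .load x y => some (s.setReg x (s.mem (s.reg y)))
  | .store x y => some { s with mem := Function.update s.mem (s.reg x) (s.reg y) }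

def Test.Holds (s : RAMState) : Test → Prop
  | .eq x y => s.reg x = s.reg y
  | .lt x y => s.reg x < s.reg y

/-- RAM programs. -/
inductive Program
  | skip
  | instr (i : Instr)
  | seq (P Q : Program)
  | ite (b : Test) (P Q : Program)
  | while (b : Test) (P : Program)

/-- `Exec W P s t s'`: with word bound `W`, the program `P` started in `s` halts after exactly `t`
steps in `s'`. -/
inductive Exec (W : ℕ) : Program → RAMState → ℕ → RAMState → Prop
  | skip (s) : Exec W .skip s 1 s
  | instr {i s s'} (h : i.run W s = some s') : Exec W (.instr i) s 1 s'
  | seq {P Q s s₁ s₂ t₁ t₂} (h₁ : Exec W P s t₁ s₁) (h₂ : Exec W Q s₁ t₂ s₂) :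
      Exec W (.seq P Q) s (t₁ + t₂) s₂
  | iteTrue {b P Q s s' t} (hb : b.Holds s) (h : Exec W P s t s') :
      Exec W (.ite b P Q) s (t + 1) s'
  | iteFalse {b P Q s s' t} (hb : ¬ b.Holds s) (h : Exec W Q s t s') :
      Exec W (.ite b P Q) s (t + 1) s'
  | whileTrue {b P s s₁ s₂ t₁ t₂} (hb : b.Holds s) (h₁ : Exec W P s t₁ s₁)
      (h₂ : Exec W (.while b P) s₁ t₂ s₂) : Exec W (.while b P) s (t₁ + t₂ + 1) s₂
  | whileFalse {b P s} (hb : ¬ b.Holds s) : Exec W (.while b P) s 1 s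

/-- Execution is deterministic: final state and step count are functions of the initial state. -/
theorem Exec.deterministic {W : ℕ} {P : Program} {s : RAMState} {t : ℕ} {s' : RAMState}
    (h : Exec W P s t s') : ∀ {t₁ : ℕ} {s₁ : RAMState}, Exec W P s t₁ s₁ → t = t₁ ∧ s' = s₁ := by
  induction h with
  | skip s => intro _ _ h; cases h; exact ⟨rfl, rfl⟩
  | instr hi =>
    intro _ _ h
    cases h with
    | instr hj => rw [hi] at hj; exact ⟨rfl, Option.some.inj hj⟩
  | seq _ _ ih₁ ih₂ =>
    intro _ _ h
    cases h with
    | seq h₁ h₂ =>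
      obtain ⟨rfl, rfl⟩ := ih₁ h₁
      obtain ⟨rfl, rfl⟩ := ih₂ h₂
      exact ⟨rfl, rfl⟩
  | iteTrue hb _ ih =>
    intro _ _ h
    cases h with
    | iteTrue _ h => obtain ⟨rfl, rfl⟩ := ih h; exact ⟨rfl, rfl⟩
    | iteFalse hb' _ => exact absurd hb hb'
  | iteFalse hb _ ih =>
    intro _ _ h
    cases h with
    | iteTrue hb' _ => exact absurd hb' hb
    | iteFalse _ h => obtain ⟨rfl, rfl⟩ := ih h; exact ⟨rfl, rfl⟩
  | whileTrue hb _ _ ih₁ ih₂ =>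
    intro _ _ h
    cases h with
    | whileTrue _ h₁ h₂ =>
      obtain ⟨rfl, rfl⟩ := ih₁ h₁
      obtain ⟨rfl, rfl⟩ := ih₂ h₂
      exact ⟨rfl, rfl⟩
    | whileFalse hb' => exact absurd hb hb'
  | whileFalse hb =>
    intro _ _ h
    cases h with
    | whileTrue hb' _ _ => exact absurd hb' hb
    | whileFalse _ => exact ⟨rfl, rfl⟩

/-! ## Input format -/

/-- The list `l` enumerates the set `S` without repetition, in any order. -/
def Enumerates {β : Type*} (l : List β) (S : Set β) : Prop :=
  l.Nodup ∧ ∀ b, b ∈ l ↔ b ∈ S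

/-- The code of a label: `0` for ε and `a + 1` for the letter `a`. -/
def labelCode {k : ℕ} : Option (Fin k) → ℕ
  | none => 0
  | some a => a + 1

/-- The input words: `k`, `n`, `|E|`, `|I|`, `|F|`, then the transitions (three words each), the
initial states and the final states. -/
def encode {k n : ℕ} (E : List (Fin n × Option (Fin k) × Fin n)) (I F : List (Fin n)) : List ℕ :=
  [k, n, E.length, I.length, F.length] ++
    E.flatMap (fun t => [(t.1 : ℕ), labelCode t.2.1, (t.2.2 : ℕ)]) ++
    I.map (fun q => (q : ℕ)) ++ F.map (fun q => (q : ℕ))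

/-- All registers are `0`; the memory holds the input from address `0` on, and `0` elsewhere. -/
def initialState (input : List ℕ) : RAMState where
  reg := fun _ => 0
  mem := fun i => input.getD i 0

end Ambiguity

/-! Everything rests on one criterion, `HasTwinCycles`: some state has two distinct cycles with the
same label. If π₁ and π₂ are such cycles, neither is a prefix of the other, since the remainder
would be a nonempty ε-cycle. Hence the 2^m products of m factors π₁ or π₂ are distinct paths with
one label of length linear in m, and trimness extends them to successful paths; this outgrows every
polynomial. Without twin cycles, a path inside a strongly connected component is determined by its
endpoints and its label. A path leaves components fewer than |Q| times, and recording each exit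
transition and the number of letters read there bounds the ambiguity polynomially
(`exponentiallyAmbiguous_iff_hasTwinCycles`).

For the criterion in A ∩ A, walks of the intersection are pairs of equally labelled paths. The
filter makes the correspondence rigid enough that a walk starting on the diagonal with equal
projections stays there, while one with distinct projections leaves it. Twin cycles are first
rotated so that they end with a common letter: the filter is then reset, and the walk closes at (r,
r, free) (`hasTwinCycles_iff_scc`).

The algorithm avoids strongly connected components of the product. It keeps only transitions lying
on cycles of A and asks which pairs are reached by two paths of such transitions from a common state
that begin with distinct transitions (`Diverged`). Twin cycles exist exactly when a diagonal pair is
reached (`hasTwinCycles_iff_exists_diverged`): from there one return path closes both paths, and the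
distinct first transitions keep the cycles distinct. So two reachability searches suffice. The first
finds, for every source p of a transition, the states that reach p, which tells which transitions
lie on cycles; the second explores the diverged pairs.

Both graphs take their edges from pairs of transitions, at most eight for each pair, so building and
searching them costs O(|E|²). Pairs (p, q) are addressed by i * n + q, where transition i has source
p; the multiples of n come from repeated addition. Zero-initialised memory spares any
initialisation, so the time depends neither on n nor on k. Correctness of the RAM code is derived
from a weakest-precondition calculus for loop-free commands (`Halts.of_wp`) and one rule for loops
(`Halts.while`). -/

namespace Ambiguity

/-! ### Exponential ambiguity is equivalent to the existence of twin cycles. -/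

section ExponentialAmbiguity

variable {α σ : Type*} {A : εNFA α σ}

/-! ### Paths and labels -/

theorem isPath_append {p q : σ} {π₁ π₂ : List (σ × Option α × σ)} :
    IsPath A p (π₁ ++ π₂) q ↔ ∃ r, IsPath A p π₁ r ∧ IsPath A r π₂ q := by
  induction π₁ generalizing p with
  | nil => simp [IsPath]
  | cons t π₁ ih => simp [IsPath, ih, and_assoc]

theorem IsPath.append {p q r : σ} {π₁ π₂ : List (σ × Option α × σ)} (h₁ : IsPath A p π₁ q)
    (h₂ : IsPath A q π₂ r) : IsPath A p (π₁ ++ π₂) r :=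
  isPath_append.2 ⟨q, h₁, h₂⟩

theorem IsPath.target_unique {p q q' : σ} {π : List (σ × Option α × σ)} (h : IsPath A p π q)
    (h' : IsPath A p π q') : q = q' := by
  induction π generalizing p with
  | nil => exact h.symm.trans h'
  | cons t π ih => exact ih h.2.2 h'.2.2

theorem isPath_singleton {t : σ × Option α × σ} (ht : t ∈ transitions A) :
    IsPath A t.1 [t] t.2.2 := ⟨ht, rfl, rfl⟩

@[simp] theorem label_nil : label ([] : List (σ × Option α × σ)) = [] := rfl

@[simp] theorem label_append (π₁ π₂ : List (σ × Option α × σ)) :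
    label (π₁ ++ π₂) = label π₁ ++ label π₂ := by
  simp [label, List.reduceOption_append]

theorem label_cons (t : σ × Option α × σ) (π : List (σ × Option α × σ)) :
    label (t :: π) = t.2.1.toList ++ label π := by
  rcases t with ⟨p, _ | a, q⟩
  · simp [label, List.reduceOption_cons_of_none]
  · simp [label, List.reduceOption_cons_of_some]

/-- The state `q` can be reached from `p`. -/
def Reach (A : εNFA α σ) (p q : σ) : Prop := ∃ π, IsPath A p π q

theorem Reach.refl (p : σ) : Reach A p p := ⟨[], rfl⟩

theorem Reach.trans {p q r : σ} : Reach A p q → Reach A q r → Reach A p r :=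
  fun ⟨π, h⟩ ⟨π', h'⟩ => ⟨π ++ π', h.append h'⟩

theorem reach_of_mem {t : σ × Option α × σ} (ht : t ∈ transitions A) : Reach A t.1 t.2.2 :=
  ⟨[t], isPath_singleton ht⟩

/-- Some state has two distinct cycles with the same label. -/
def HasTwinCycles (A : εNFA α σ) : Prop :=
  ∃ p π₁ π₂, IsPath A p π₁ p ∧ IsPath A p π₂ p ∧ label π₁ = label π₂ ∧ π₁ ≠ π₂

/-! ### Twin cycles give exponential ambiguity -/

/-- What the longer cycle adds to the shorter one is itself a cycle at `p` with empty label, hence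
empty. -/
theorem EpsCycleFree.not_prefix (hA : EpsCycleFree A) {p : σ} {π₁ π₂ : List (σ × Option α × σ)}
    (h₁ : IsPath A p π₁ p) (h₂ : IsPath A p π₂ p) (hl : label π₁ = label π₂) (hne : π₁ ≠ π₂) :
    ¬ π₁ <+: π₂ := by
  rintro ⟨ρ, rfl⟩
  obtain ⟨r, h, h'⟩ := isPath_append.1 h₂
  obtain rfl := h.target_unique h₁
  have : ρ = [] := hA _ _ h' (by simpa using hl)
  exact hne (by simp [this])

/-- The concatenation of a sequence of copies of `π₁` and `π₂`. -/
def interleave (π₁ π₂ : List (σ × Option α × σ)) (b : List Bool) : List (σ × Option α × σ) :=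
  b.flatMap fun c => if c then π₁ else π₂

theorem isPath_interleave {p : σ} {π₁ π₂ : List (σ × Option α × σ)} (h₁ : IsPath A p π₁ p)
    (h₂ : IsPath A p π₂ p) (b : List Bool) : IsPath A p (interleave π₁ π₂ b) p := by
  induction b with
  | nil => exact rfl
  | cons c b ih =>
    rw [interleave, List.flatMap_cons]
    refine IsPath.append ?_ ih
    cases c
    · exact h₂
    · exact h₁

theorem label_interleave {π₁ π₂ : List (σ × Option α × σ)} (hl : label π₁ = label π₂)
    (b : List Bool) :
    label (interleave π₁ π₂ b) = (List.replicate b.length (label π₁)).flatten := by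
  induction b with
  | nil => rfl
  | cons c b ih =>
    rw [interleave, List.flatMap_cons, label_append, ← interleave, ih]
    cases c <;> simp [List.replicate_succ, hl]

theorem interleave_injective (hA : EpsCycleFree A) {p : σ} {π₁ π₂ : List (σ × Option α × σ)}
    (h₁ : IsPath A p π₁ p) (h₂ : IsPath A p π₂ p) (hl : label π₁ = label π₂) (hne : π₁ ≠ π₂)
    {b b' : List Bool} (hb : b.length = b'.length)
    (h : interleave π₁ π₂ b = interleave π₁ π₂ b') : b = b' := by
  -- The two cycles form a prefix code, so a product can be decoded from the left.
  have key : ∀ X Y, π₁ ++ X ≠ π₂ ++ Y := by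
    intro X Y h
    rcases List.prefix_or_prefix_of_prefix (List.prefix_append π₁ X)
      (h ▸ List.prefix_append π₂ Y) with h | h
    · exact hA.not_prefix h₁ h₂ hl hne h
    · exact hA.not_prefix h₂ h₁ hl.symm hne.symm h
  induction b generalizing b' with
  | nil => exact (List.length_eq_zero_iff.1 hb.symm).symm
  | cons c b ih =>
    rcases b' with _ | ⟨c', b'⟩
    · simp at hb
    simp only [interleave, List.flatMap_cons] at h
    cases c <;> cases c' <;> simp only [Bool.false_eq_true, if_true, if_false] at h
    · rw [ih (by simpa using hb) (List.append_cancel_left h)]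
    · exact absurd h.symm (key _ _)
    · exact absurd h (key _ _)
    · rw [ih (by simpa using hb) (List.append_cancel_left h)]

theorem exists_two_pow_le_da (hT : IsTrim A) (hA : EpsCycleFree A) (h : HasTwinCycles A) :
    ∃ a b : ℕ, ∀ m : ℕ, ∃ x : List α, x.length = a + b * m ∧ ((2 ^ m : ℕ) : ℕ∞) ≤ da A x := by
  obtain ⟨p, π₁, π₂, h₁, h₂, hl, hne⟩ := h
  obtain ⟨i, hi, f, hf, ρ, τ, hρ, hτ⟩ := hT p
  refine ⟨(label ρ).length + (label τ).length, (label π₁).length, fun m =>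
    ⟨label ρ ++ ((List.replicate m (label π₁)).flatten ++ label τ), ?_, ?_⟩⟩
  · simp [List.length_flatten, mul_comm]
    omega
  · let F : (Fin m → Bool) → σ × List (σ × Option α × σ) := fun b =>
      (i, ρ ++ (interleave π₁ π₂ (List.ofFn b) ++ τ))
    have hF : Function.Injective F := by
      intro b b' hbb
      have := List.append_cancel_right (List.append_cancel_left (Prod.ext_iff.1 hbb).2)
      exact List.ofFn_injective (interleave_injective hA h₁ h₂ hl hne (by simp) this)
    have hsub : Set.range F ⊆ successfulPaths A
        (label ρ ++ ((List.replicate m (label π₁)).flatten ++ label τ)) := by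
      rintro _ ⟨b, rfl⟩
      refine ⟨hi, ⟨f, hf, hρ.append ((isPath_interleave h₁ h₂ _).append hτ)⟩, ?_⟩
      simp [F, label_interleave hl]
    refine le_trans ?_ (Set.encard_le_encard hsub)
    rw [← Set.image_univ, hF.encard_image, Set.encard_univ]
    simp [ENat.card_eq_coe_fintype_card]

theorem exists_eval_lt_two_pow (h : Polynomial ℕ) (a b : ℕ) :
    ∃ m : ℕ, h.eval (a + b * m) < 2 ^ m := by
  have hlog : (0 : ℝ) < Real.log 2 := Real.log_pos (by norm_num)
  -- `P` is chosen so that `P (m * log 2) = h (a + b * m)`, while `exp (m * log 2) = 2 ^ m`; the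
  -- claim becomes the growth of `exp` against a polynomial.
  let P : Polynomial ℝ := (h.map (Nat.castRingHom ℝ)).comp
    (Polynomial.C (a : ℝ) + Polynomial.C (b / Real.log 2 : ℝ) * Polynomial.X)
  have ht := (Polynomial.tendsto_div_exp_atTop P).comp
    ((tendsto_natCast_atTop_atTop (R := ℝ)).atTop_mul_const hlog)
  obtain ⟨m, hm⟩ := (ht.eventually (gt_mem_nhds (zero_lt_one' ℝ))).exists
  refine ⟨m, ?_⟩
  have he : Real.exp (m * Real.log 2) = 2 ^ m := by
    rw [mul_comm, Real.exp_mul, Real.exp_log (by norm_num), Real.rpow_natCast]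
  have hP : P.eval (m * Real.log 2) = ((h.eval (a + b * m) : ℕ) : ℝ) := by
    have : (a : ℝ) + b / Real.log 2 * (m * Real.log 2) = ((a + b * m : ℕ) : ℝ) := by
      push_cast; field_simp
    simp only [P, Polynomial.eval_comp, Polynomial.eval_add, Polynomial.eval_mul,
      Polynomial.eval_C, Polynomial.eval_X, this]
    rw [Polynomial.eval_natCast_map]
    simp
  simp only [Function.comp_apply, he, hP] at hm
  rw [div_lt_one (by positivity)] at hm
  exact_mod_cast hm

theorem HasTwinCycles.exponentiallyAmbiguous (hT : IsTrim A) (hA : EpsCycleFree A)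
    (h : HasTwinCycles A) : ExponentiallyAmbiguous A := by
  obtain ⟨a, b, hab⟩ := exists_two_pow_le_da hT hA h
  constructor
  · refine ENat.eq_top_iff_forall_ge.2 fun m => ?_
    obtain ⟨x, -, hx⟩ := hab m
    calc (m : ℕ∞) ≤ ((2 ^ m : ℕ) : ℕ∞) := by exact_mod_cast (Nat.lt_two_pow_self).le
      _ ≤ da A x := hx
      _ ≤ _ := le_iSup (da A) x
  · rintro ⟨h, hh⟩
    obtain ⟨m, hm⟩ := exists_eval_lt_two_pow h a b
    obtain ⟨x, hxl, hx⟩ := hab m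
    have := hx.trans (hh x)
    rw [hxl] at this
    exact absurd (by exact_mod_cast this) hm.not_ge

/-! ### Without twin cycles the ambiguity is polynomial -/

/-- A return path from `q` closes both paths to cycles at `p` with a common label. -/
theorem path_unique_of_not_hasTwinCycles (h : ¬ HasTwinCycles A) {p q : σ}
    {π π' : List (σ × Option α × σ)} (hr : Reach A q p) (hp : IsPath A p π q)
    (hp' : IsPath A p π' q) (hl : label π = label π') : π = π' := by
  by_contra hne
  obtain ⟨τ, hτ⟩ := hr
  exact h ⟨p, π ++ τ, π' ++ τ, hp.append hτ, hp'.append hτ, by simp [hl],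
    fun h => hne (List.append_cancel_right h)⟩

/-- The transition `t` is where `π` leaves the set of states that reach `p`. A path that has left
this set cannot come back to it. -/
theorem exists_bridge {p r q : σ} {π : List (σ × Option α × σ)} (hr : Reach A r p)
    (hπ : IsPath A r π q) : Reach A q p ∨ ∃ π₀ t ρ, π = π₀ ++ t :: ρ ∧ IsPath A r π₀ t.1 ∧
      Reach A t.1 p ∧ t ∈ transitions A ∧ ¬ Reach A t.2.2 p ∧ IsPath A t.2.2 ρ q := by
  induction π generalizing r with
  | nil => left; obtain rfl : r = q := hπ; exact hr
  | cons t π ih =>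
    obtain ⟨ht, rfl, hπ⟩ := hπ
    by_cases h : Reach A t.2.2 p
    · rcases ih h hπ with h' | ⟨π₀, u, ρ, rfl, h₁, h₂⟩
      · exact Or.inl h'
      · exact Or.inr ⟨t :: π₀, u, ρ, rfl, ⟨ht, rfl, h₁⟩, h₂⟩
    · exact Or.inr ⟨[], t, π, rfl, rfl, hr, ht, h, hπ⟩

/-- The paths from `p` with label `x`. -/
def pathsFrom (A : εNFA α σ) (p : σ) (x : List α) : Set (List (σ × Option α × σ)) :=
  {π | ∃ q, IsPath A p π q ∧ label π = x}

theorem encard_iUnion_le_card_mul {ι β : Type*} [Fintype ι] (s : ι → Set β) (c : ℕ∞)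
    (h : ∀ i, (s i).encard ≤ c) : (⋃ i, s i).encard ≤ Fintype.card ι * c := by
  have := Finset.univ.set_encard_biUnion_le s
  simp only [Finset.mem_univ, Set.iUnion_true] at this
  refine this.trans ((Finset.sum_le_sum fun i _ => h i).trans ?_)
  simp

/-- Induction on the number of states reachable from `p`. At most one path ends at each state that
reaches `p` back. Any other path is sorted by its exit transition and the number of letters read up
to and including it; its part before the exit is then forced, and its part after the exit starts at
a state that reaches fewer states. -/
theorem encard_pathsFrom_le [Fintype σ] [Fintype α] (h : ¬ HasTwinCycles A) (m : ℕ) (d : ℕ) :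
    ∀ (p : σ) (x : List α), x.length ≤ m → {q | Reach A p q}.ncard ≤ d →
      (pathsFrom A p x).encard ≤
        (((Fintype.card σ + Fintype.card (σ × Option α × σ) * (m + 1)) ^ d : ℕ) : ℕ∞) := by
  induction d with
  | zero =>
    intro p x _ hd
    have := (Set.ncard_eq_zero (Set.toFinite _)).1 (Nat.le_zero.1 hd)
    exact absurd (this ▸ Reach.refl p : p ∈ (∅ : Set σ)) (Set.notMem_empty p)
  | succ d ih =>
    intro p x hx hd
    set N := Fintype.card σ
    set M := Fintype.card (σ × Option α × σ)
    set B := (N + M * (m + 1)) ^ d with hB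
    let U : σ → Set (List (σ × Option α × σ)) := fun q =>
      {π | IsPath A p π q ∧ label π = x ∧ Reach A q p}
    let V : (σ × Option α × σ) × Fin (m + 1) → Set (List (σ × Option α × σ)) := fun s =>
      {π | ∃ π₀ ρ, π = π₀ ++ s.1 :: ρ ∧ IsPath A p π₀ s.1.1 ∧ Reach A s.1.1 p ∧
        s.1 ∈ transitions A ∧ ¬ Reach A s.1.2.2 p ∧ label (π₀ ++ [s.1]) = x.take s.2 ∧
        ρ ∈ pathsFrom A s.1.2.2 (x.drop s.2)}
    have hsub : pathsFrom A p x ⊆ (⋃ q, U q) ∪ ⋃ s, V s := by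
      rintro π ⟨q, hπ, hl⟩
      rcases exists_bridge (Reach.refl p) hπ with hq | ⟨π₀, t, ρ, rfl, h₁, h₂, h₃, h₄, h₅⟩
      · exact Or.inl (Set.mem_iUnion.2 ⟨q, hπ, hl, hq⟩)
      · have e : x = label (π₀ ++ [t]) ++ label ρ := by
          rw [← hl, ← label_append]; simp
        refine Or.inr (Set.mem_iUnion.2 ⟨(t, ⟨(label (π₀ ++ [t])).length, ?_⟩), π₀, ρ, rfl, h₁, h₂,
          h₃, h₄, ?_, q, h₅, ?_⟩)
        · have := congrArg List.length e
          rw [List.length_append] at this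
          omega
        · simp only [e]; exact (List.take_left' rfl).symm
        · simp only [e]; exact (List.drop_left' rfl).symm
    have hU : ∀ q, (U q).encard ≤ 1 := fun q => Set.encard_le_one_iff.2 fun π π' hπ hπ' =>
      path_unique_of_not_hasTwinCycles h hπ.2.2 hπ.1 hπ'.1 (hπ.2.1.trans hπ'.2.1.symm)
    have hV : ∀ s, (V s).encard ≤ B := by
      rintro ⟨t, i⟩
      -- One member of the class fixes the prefix `π₀`, which all other members share by uniqueness.
      rcases (V (t, i)).eq_empty_or_nonempty with hE | ⟨_, π₀, ρ₀, -, h₁, h₂, h₃, h₄, h₅, -⟩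
      · simp [hE]
      have hsub' : V (t, i) ⊆ (fun ρ => π₀ ++ t :: ρ) '' pathsFrom A t.2.2 (x.drop i) := by
        rintro _ ⟨π₁, ρ, rfl, h₁', -, -, -, h₅', hρ⟩
        refine ⟨ρ, hρ, ?_⟩
        have hl : label π₀ = label π₁ := by
          have := h₅.trans h₅'.symm
          rw [label_append, label_append] at this
          exact List.append_cancel_right this
        simp [path_unique_of_not_hasTwinCycles h h₂ h₁ h₁' hl]
      refine (Set.encard_le_encard hsub').trans ((Set.encard_image_le _ _).trans ?_)
      refine ih _ _ (by simp; omega) (Nat.le_of_lt_succ (lt_of_lt_of_le ?_ hd))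
      -- The inclusion is strict because `p` cannot be reached after the exit.
      refine Set.ncard_lt_ncard ⟨fun q hq => ?_, fun hs => h₄ (hs (Reach.refl p))⟩ (Set.toFinite _)
      obtain ⟨π, hp⟩ : Reach A t.1 q := (reach_of_mem h₃).trans hq
      exact ⟨π₀ ++ π, h₁.append hp⟩
    have hN : 0 < N := Fintype.card_pos_iff.2 ⟨p⟩
    have hB1 : 1 ≤ B := Nat.one_le_pow _ _ (by omega)
    calc (pathsFrom A p x).encard ≤ _ := Set.encard_le_encard hsub
      _ ≤ _ := Set.encard_union_le _ _
      _ ≤ (N : ℕ∞) * 1 + (Fintype.card ((σ × Option α × σ) × Fin (m + 1)) : ℕ∞) * (B : ℕ∞) :=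
        add_le_add (encard_iUnion_le_card_mul U 1 hU) (encard_iUnion_le_card_mul V B hV)
      _ = ((N * 1 + M * (m + 1) * B : ℕ) : ℕ∞) := by
        rw [Fintype.card_prod, Fintype.card_fin]; push_cast; rfl
      _ ≤ _ := by
        norm_cast
        rw [pow_succ', ← hB, add_mul]
        exact Nat.add_le_add_right (Nat.mul_le_mul_left _ hB1) _

theorem polynomiallyAmbiguous_of_not_hasTwinCycles [Fintype σ] [Fintype α]
    (h : ¬ HasTwinCycles A) : PolynomiallyAmbiguous A := by
  set N := Fintype.card σ
  set M := Fintype.card (σ × Option α × σ)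
  refine ⟨Polynomial.C N * (Polynomial.C N + Polynomial.C M * (Polynomial.X + 1)) ^ N,
    fun x => ?_⟩
  have hsub : successfulPaths A x ⊆ ⋃ p, Prod.mk p '' pathsFrom A p x := by
    rintro ⟨p, π⟩ ⟨-, ⟨q, -, hq⟩, hl⟩
    exact Set.mem_iUnion.2 ⟨p, π, ⟨q, hq, hl⟩, rfl⟩
  refine (Set.encard_le_encard hsub).trans ((encard_iUnion_le_card_mul _ _ fun p =>
    (Set.encard_image_le _ _).trans (encard_pathsFrom_le h x.length N p x le_rfl ?_)).trans ?_)
  · have := Set.ncard_le_ncard (Set.subset_univ {q | Reach A p q}) (Set.toFinite _)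
    rwa [Set.ncard_univ, Nat.card_eq_fintype_card] at this
  · simp [N, M]

theorem exponentiallyAmbiguous_iff_hasTwinCycles [Fintype σ] [Fintype α] (hT : IsTrim A)
    (hA : EpsCycleFree A) : ExponentiallyAmbiguous A ↔ HasTwinCycles A := by
  refine ⟨fun h => ?_, fun h => h.exponentiallyAmbiguous hT hA⟩
  by_contra hn
  exact h.2 (polynomiallyAmbiguous_of_not_hasTwinCycles hn)

end ExponentialAmbiguity

/-! ### Twin cycles and strongly connected components of the filtered intersection. -/

section Intersection

variable {α σ : Type*} {A : εNFA α σ}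

/-! ### The ε-filtered intersection of an automaton with itself -/

/-- `PairWalk A s π₁ π₂ s'`: there is a path from `s` to `s'` in `inter A A` whose projections
are `π₁` and `π₂`. -/
inductive PairWalk (A : εNFA α σ) : σ × σ × FilterState → List (σ × Option α × σ) →
    List (σ × Option α × σ) → σ × σ × FilterState → Prop
  | nil (s) : PairWalk A s [] [] s
  | letter {a p q p' q' f π₁ π₂ s} (h₁ : (p, some a, p') ∈ transitions A)
      (h₂ : (q, some a, q') ∈ transitions A) (h : PairWalk A (p', q', .free) π₁ π₂ s) :
      PairWalk A (p, q, f) ((p, some a, p') :: π₁) ((q, some a, q') :: π₂) s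
  | both {p q p' q' π₁ π₂ s} (h₁ : (p, none, p') ∈ transitions A)
      (h₂ : (q, none, q') ∈ transitions A) (h : PairWalk A (p', q', .free) π₁ π₂ s) :
      PairWalk A (p, q, .free) ((p, none, p') :: π₁) ((q, none, q') :: π₂) s
  | first {p q p' f π₁ π₂ s} (hf : f ≠ .right) (h₁ : (p, none, p') ∈ transitions A)
      (h : PairWalk A (p', q, .left) π₁ π₂ s) :
      PairWalk A (p, q, f) ((p, none, p') :: π₁) π₂ s
  | second {p q q' f π₁ π₂ s} (hf : f ≠ .left) (h₂ : (q, none, q') ∈ transitions A)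
      (h : PairWalk A (p, q', .right) π₁ π₂ s) :
      PairWalk A (p, q, f) π₁ ((q, none, q') :: π₂) s

theorem PairWalk.trans {s s' s'' : σ × σ × FilterState} {π₁ π₂ ρ₁ ρ₂ : List (σ × Option α × σ)}
    (h : PairWalk A s π₁ π₂ s') (h' : PairWalk A s' ρ₁ ρ₂ s'') :
    PairWalk A s (π₁ ++ ρ₁) (π₂ ++ ρ₂) s'' := by
  induction h with
  | nil => exact h'
  | letter h₁ h₂ _ ih => exact .letter h₁ h₂ (ih h')
  | both h₁ h₂ _ ih => exact .both h₁ h₂ (ih h')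
  | first hf h₁ _ ih => exact .first hf h₁ (ih h')
  | second hf h₂ _ ih => exact .second hf h₂ (ih h')

theorem PairWalk.project {s s' : σ × σ × FilterState} {π₁ π₂ : List (σ × Option α × σ)}
    (h : PairWalk A s π₁ π₂ s') :
    IsPath A s.1 π₁ s'.1 ∧ IsPath A s.2.1 π₂ s'.2.1 ∧ label π₁ = label π₂ := by
  induction h with
  | nil => exact ⟨rfl, rfl, rfl⟩
  | letter h₁ h₂ _ ih =>
    exact ⟨⟨h₁, rfl, ih.1⟩, ⟨h₂, rfl, ih.2.1⟩, by simp [label_cons, ih.2.2]⟩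
  | both h₁ h₂ _ ih =>
    exact ⟨⟨h₁, rfl, ih.1⟩, ⟨h₂, rfl, ih.2.1⟩, by simp [label_cons, ih.2.2]⟩
  | first hf h₁ _ ih => exact ⟨⟨h₁, rfl, ih.1⟩, ih.2.1, by simp [label_cons, ih.2.2]⟩
  | second hf h₂ _ ih => exact ⟨ih.1, ⟨h₂, rfl, ih.2.1⟩, by simp [label_cons, ih.2.2]⟩

theorem PairWalk.reach {s s' : σ × σ × FilterState} {π₁ π₂ : List (σ × Option α × σ)}
    (h : PairWalk A s π₁ π₂ s') : Reach (inter A A) s s' := by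
  have step : ∀ {x y : σ × σ × FilterState} (l : Option α), y ∈ (inter A A).step x l →
      Reach (inter A A) x y := fun {x y} l h => reach_of_mem (t := (x, l, y)) h
  induction h with
  | nil => exact Reach.refl _
  | @letter a _ _ _ _ _ _ _ _ h₁ h₂ _ ih =>
    refine Reach.trans ?_ ih
    exact step (some a) (show _ ∧ _ ∧ _ from ⟨h₁, h₂, rfl⟩)
  | both h₁ h₂ _ ih =>
    refine Reach.trans ?_ ih
    exact step none (show _ ∨ _ from Or.inl ⟨rfl, h₁, h₂, rfl⟩)
  | first hf h₁ _ ih =>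
    refine Reach.trans ?_ ih
    exact step none (show _ ∨ _ ∨ _ from Or.inr (Or.inl ⟨hf, h₁, rfl, rfl⟩))
  | second hf h₂ _ ih =>
    refine Reach.trans ?_ ih
    exact step none (show _ ∨ _ ∨ _ from Or.inr (Or.inr ⟨hf, rfl, h₂, rfl⟩))

theorem Reach.exists_pairWalk {s s' : σ × σ × FilterState} (h : Reach (inter A A) s s') :
    ∃ π₁ π₂, PairWalk A s π₁ π₂ s' := by
  obtain ⟨π, h⟩ := h
  induction π generalizing s with
  | nil => obtain rfl : s = s' := h; exact ⟨[], [], .nil s⟩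
  | cons t π ih =>
    obtain ⟨⟨p, q, f⟩, l, ⟨p', q', f'⟩⟩ := t
    obtain ⟨ht, rfl, h⟩ := h
    obtain ⟨π₁, π₂, h⟩ := ih h
    rcases l with _ | a
    · rcases ht with ⟨h₁, h₂, h₃, h₄⟩ | ⟨h₁, h₂, h₃, h₄⟩ | ⟨h₁, h₂, h₃, h₄⟩ <;>
        dsimp only at h₁ h₂ h₃ h₄
      · subst h₁ h₄; exact ⟨_, _, .both h₂ h₃ h⟩
      · subst h₃ h₄; exact ⟨_, _, .first h₁ h₂ h⟩
      · subst h₂ h₄; exact ⟨_, _, .second h₁ h₃ h⟩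
    · obtain ⟨h₁, h₂, h₃⟩ := ht
      dsimp only at h₁ h₂ h₃
      subst h₃
      exact ⟨_, _, .letter h₁ h₂ h⟩

/-- Any two paths with the same label are the projections of a path of the intersection. -/
theorem exists_pairWalk (N : ℕ) : ∀ {p q p' q' : σ} {π₁ π₂ : List (σ × Option α × σ)}
    (f : FilterState), π₁.length + π₂.length ≤ N → IsPath A p π₁ p' → IsPath A q π₂ q' →
    label π₁ = label π₂ → (f = .left → ∀ t ρ, π₂ = t :: ρ → t.2.1 ≠ none) →
    (f = .right → ∀ t ρ, π₁ = t :: ρ → t.2.1 ≠ none) →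
    ∃ f', PairWalk A (p, q, f) π₁ π₂ (p', q', f') := by
  induction N with
  | zero =>
    intro p q p' q' π₁ π₂ f hN h₁ h₂ _ _ _
    obtain rfl : π₁ = [] := List.length_eq_zero_iff.1 (by omega)
    obtain rfl : π₂ = [] := List.length_eq_zero_iff.1 (by omega)
    obtain rfl : p = p' := h₁
    obtain rfl : q = q' := h₂
    exact ⟨f, .nil _⟩
  | succ N ih =>
    intro p q p' q' π₁ π₂ f hN h₁ h₂ hl hfl hfr
    -- One path takes an ε-transition alone only if the other does not start with one. This is the
    -- condition that the filter state entered by the move imposes on the remaining paths.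
    have hfirst : ∀ r ρ, π₁ = (p, none, r) :: ρ → (∀ t τ, π₂ = t :: τ → t.2.1 ≠ none) →
        ∃ f', PairWalk A (p, q, f) π₁ π₂ (p', q', f') := by
      rintro r ρ rfl ht
      obtain ⟨f', h⟩ := ih .left (by simp at hN; omega) h₁.2.2 h₂ (by simpa [label_cons] using hl)
        (fun _ => ht) (by simp)
      exact ⟨f', .first (fun hf => hfr hf _ _ rfl rfl) h₁.1 h⟩
    have hsecond : ∀ r ρ, π₂ = (q, none, r) :: ρ → (∀ t τ, π₁ = t :: τ → t.2.1 ≠ none) →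
        ∃ f', PairWalk A (p, q, f) π₁ π₂ (p', q', f') := by
      rintro r ρ rfl ht
      obtain ⟨f', h⟩ := ih .right (by simp at hN; omega) h₁ h₂.2.2 (by simpa [label_cons] using hl)
        (by simp) (fun _ => ht)
      exact ⟨f', .second (fun hf => hfl hf _ _ rfl rfl) h₂.1 h⟩
    rcases π₁ with _ | ⟨⟨p₀, _ | a, r⟩, π₁⟩ <;> rcases π₂ with _ | ⟨⟨q₀, _ | b, s⟩, π₂⟩
    · obtain rfl : p = p' := h₁
      obtain rfl : q = q' := h₂
      exact ⟨f, .nil _⟩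
    · obtain ⟨-, rfl, -⟩ := id h₂
      exact hsecond s π₂ rfl (by simp)
    · simp [label_cons] at hl
    · obtain ⟨-, rfl, -⟩ := id h₁
      exact hfirst r π₁ rfl (by simp)
    · obtain ⟨m₁, rfl, h₁⟩ := h₁
      obtain ⟨m₂, rfl, h₂⟩ := h₂
      obtain ⟨f', h⟩ := ih .free (by simp at hN; omega) h₁ h₂ (by simpa [label_cons] using hl)
        (by simp) (by simp)
      -- Both paths start with ε; the conditions attached to `left` and `right` exclude these filter
      -- states, so the matched move is allowed.
      rcases f with _ | _ | _
      · exact ⟨f', .both m₁ m₂ h⟩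
      · exact absurd rfl (hfl rfl _ _ rfl)
      · exact absurd rfl (hfr rfl _ _ rfl)
    · obtain ⟨-, rfl, -⟩ := id h₁
      exact hfirst r π₁ rfl (by rintro t τ ⟨rfl, rfl⟩; simp)
    · simp [label_cons] at hl
    · obtain ⟨-, rfl, -⟩ := id h₂
      exact hsecond s π₂ rfl (by rintro t τ ⟨rfl, rfl⟩; simp)
    · obtain ⟨m₁, rfl, h₁⟩ := h₁
      obtain ⟨m₂, rfl, h₂⟩ := h₂
      simp only [label_cons, Option.toList_some, List.cons_append, List.nil_append,
        List.cons.injEq] at hl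
      obtain ⟨rfl, hl⟩ := hl
      obtain ⟨f', h⟩ := ih .free (by simp at hN; omega) h₁ h₂ hl (by simp) (by simp)
      exact ⟨f', .letter m₁ m₂ h⟩

theorem IsPath.pairWalk_self {p q : σ} {π : List (σ × Option α × σ)} (h : IsPath A p π q) :
    PairWalk A (p, p, .free) π π (q, q, .free) := by
  induction π generalizing p with
  | nil => obtain rfl : p = q := h; exact .nil _
  | cons t π ih =>
    obtain ⟨p₀, _ | a, r⟩ := t
    · obtain ⟨m, rfl, h⟩ := h; exact .both m m (ih h)
    · obtain ⟨m, rfl, h⟩ := h; exact .letter m m (ih h)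

/-- In filter state `left` only the first component can make ε-moves, and these preserve the state;
so the second path resumes with a letter. -/
theorem PairWalk.second_head_ne_none {s s' : σ × σ × FilterState}
    {π₁ π₂ : List (σ × Option α × σ)} (h : PairWalk A s π₁ π₂ s') (hs : s.2.2 = .left) :
    ∀ t ρ, π₂ = t :: ρ → t.2.1 ≠ none := by
  induction h with
  | nil => simp
  | letter => rintro t ρ ⟨rfl, rfl⟩; simp
  | both => simp at hs
  | first hf h₁ _ ih => exact ih rfl
  | second hf => exact absurd hs hf

theorem PairWalk.first_head_ne_none {s s' : σ × σ × FilterState}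
    {π₁ π₂ : List (σ × Option α × σ)} (h : PairWalk A s π₁ π₂ s') (hs : s.2.2 = .right) :
    ∀ t ρ, π₁ = t :: ρ → t.2.1 ≠ none := by
  induction h with
  | nil => simp
  | letter => rintro t ρ ⟨rfl, rfl⟩; simp
  | both => simp at hs
  | first hf => exact absurd hs hf
  | second hf h₁ _ ih => exact ih rfl

/-- A path of the intersection with equal projections does not leave the diagonal. -/
theorem PairWalk.diagonal {s y z : σ × σ × FilterState} {π₁ π₂ ρ₁ ρ₂ : List (σ × Option α × σ)}
    (h : PairWalk A s π₁ π₂ y) (h' : PairWalk A y ρ₁ ρ₂ z) (he : π₁ ++ ρ₁ = π₂ ++ ρ₂)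
    (hs : s.1 = s.2.1) : y.1 = y.2.1 := by
  induction h with
  | nil => exact hs
  | letter h₁ h₂ _ ih =>
    simp only [List.cons_append, List.cons.injEq, Prod.mk.injEq] at he
    exact ih h' he.2 he.1.2.2
  | both h₁ h₂ _ ih =>
    simp only [List.cons_append, List.cons.injEq, Prod.mk.injEq] at he
    exact ih h' he.2 he.1.2.2
  -- Equality of the projections would make the second one start with the ε-transition that the
  -- first component has just used alone, against the filter.
  | first hf h₁ h ih => exact absurd rfl ((h.trans h').second_head_ne_none rfl _ _ he.symm)
  | second hf h₂ h ih => exact absurd rfl ((h.trans h').first_head_ne_none rfl _ _ he)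

/-- A path of the intersection with distinct projections leaves the diagonal. -/
theorem PairWalk.exists_off_diagonal (hA : EpsCycleFree A) {s z : σ × σ × FilterState}
    {π₁ π₂ : List (σ × Option α × σ)} (h : PairWalk A s π₁ π₂ z) (hne : π₁ ≠ π₂)
    (hs : s.1 = s.2.1) : ∃ y, y.1 ≠ y.2.1 ∧ Reach (inter A A) s y ∧ Reach (inter A A) y z := by
  -- There are no ε-loops, so an ε-move of a single component leaves the diagonal at once.
  have loop : ∀ p, (p, none, p) ∉ transitions A := fun p hp => by
    simpa using hA p [(p, none, p)] (isPath_singleton hp) rfl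
  induction h with
  | nil => exact absurd rfl hne
  | @letter a p q p' q' f π₁ π₂ s h₁ h₂ h ih =>
    have r := (PairWalk.letter (f := f) h₁ h₂ (.nil _)).reach
    by_cases e : p' = q'
    · obtain rfl : p = q := hs
      subst e
      obtain ⟨y, hy, hy₁, hy₂⟩ := ih (by simpa using hne) rfl
      exact ⟨y, hy, r.trans hy₁, hy₂⟩
    · exact ⟨_, e, r, h.reach⟩
  | @both p q p' q' π₁ π₂ s h₁ h₂ h ih =>
    have r := (PairWalk.both h₁ h₂ (.nil _)).reach
    by_cases e : p' = q'
    · obtain rfl : p = q := hs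
      subst e
      obtain ⟨y, hy, hy₁, hy₂⟩ := ih (by simpa using hne) rfl
      exact ⟨y, hy, r.trans hy₁, hy₂⟩
    · exact ⟨_, e, r, h.reach⟩
  | @first p q p' f π₁ π₂ s hf h₁ h ih =>
    obtain rfl : p = q := hs
    refine ⟨(p', p, .left), ?_, (PairWalk.first hf h₁ (.nil _)).reach, h.reach⟩
    rintro (rfl : p' = p)
    exact loop _ h₁
  | @second p q q' f π₁ π₂ s hf h₂ h ih =>
    obtain rfl : p = q := hs
    refine ⟨(p, q', .right), ?_, (PairWalk.second hf h₂ (.nil _)).reach, h.reach⟩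
    rintro (rfl : p = q')
    exact loop _ h₂

theorem onSuccessfulPath_iff {β τ : Type*} {B : εNFA β τ} {q : τ} :
    OnSuccessfulPath B q ↔ (∃ i ∈ B.start, Reach B i q) ∧ ∃ f ∈ B.accept, Reach B q f :=
  ⟨fun ⟨i, hi, f, hf, π₁, π₂, h₁, h₂⟩ => ⟨⟨i, hi, π₁, h₁⟩, f, hf, π₂, h₂⟩,
    fun ⟨⟨i, hi, π₁, h₁⟩, f, hf, π₂, h₂⟩ => ⟨i, hi, f, hf, π₁, π₂, h₁, h₂⟩⟩

/-- A state between two states on successful paths is on a successful path, so trimming cuts no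
connection between survivors. -/
theorem reach_trimmed_iff {β τ : Type*} {B : εNFA β τ} {x y : {q : τ // OnSuccessfulPath B q}} :
    Reach (trimmed B) x y ↔ Reach B x.1 y.1 := by
  constructor
  · rintro ⟨π, h⟩
    induction π generalizing x with
    | nil => obtain rfl : x = y := h; exact Reach.refl _
    | cons t π ih =>
      obtain ⟨ht, rfl, h⟩ := h
      exact (reach_of_mem (A := B) (t := (t.1.1, t.2.1, t.2.2.1)) ht).trans (ih h)
  · rintro ⟨π, h⟩
    induction π generalizing x with
    | nil => rw [Subtype.ext (show x.1 = y.1 from h)]; exact Reach.refl _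
    | cons t π ih =>
      obtain ⟨p, l, r⟩ := t
      obtain ⟨ht, hx, h⟩ := h
      have hr : OnSuccessfulPath B r := by
        obtain ⟨⟨i, hi, h₁⟩, -⟩ := onSuccessfulPath_iff.1 x.2
        obtain ⟨-, f, hf, h₂⟩ := onSuccessfulPath_iff.1 y.2
        exact onSuccessfulPath_iff.2 ⟨⟨i, hi, ((show p = x.1 from hx) ▸ h₁ : Reach B i p).trans (reach_of_mem ht)⟩,
          f, hf, Reach.trans ⟨π, h⟩ h₂⟩
      have hm : (x, l, (⟨r, hr⟩ : {q : τ // OnSuccessfulPath B q})) ∈ transitions (trimmed B) := by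
        obtain ⟨x, hx'⟩ := x
        obtain rfl : p = x := hx
        exact ht
      exact (reach_of_mem hm).trans (ih (x := ⟨r, hr⟩) h)

/-- A cycle without letters has empty label. The letter transition found here is the point at which
twin cycles are cut and rotated. -/
theorem EpsCycleFree.exists_last_letter (hA : EpsCycleFree A) {p : σ}
    {π : List (σ × Option α × σ)} (h : IsPath A p π p) (hne : π ≠ []) :
    ∃ π₀ r a r' ρ, π = π₀ ++ (r, some a, r') :: ρ := by
  by_contra hc
  refine hne (hA _ _ h ?_)
  clear h hne
  induction π with
  | nil => rfl
  | cons t π ih =>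
    rcases t with ⟨r, _ | a, r'⟩
    · simp only [label_cons, Option.toList_none, List.nil_append]
      refine ih ?_
      rintro ⟨π₀, s, a, s', ρ, rfl⟩
      exact hc ⟨(r, none, r') :: π₀, s, a, s', ρ, rfl⟩
    · exact absurd ⟨[], r, a, r', π, rfl⟩ hc

theorem hasTwinCycles_iff_scc (hT : IsTrim A) (hA : EpsCycleFree A) :
    HasTwinCycles A ↔ ∃ x y : {s // OnSuccessfulPath (inter A A) s},
      SameSCC (trimmed (inter A A)) x y ∧ x.1.1 = x.1.2.1 ∧ y.1.1 ≠ y.1.2.1 := by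
  constructor
  · rintro ⟨p, π₁, π₂, h₁, h₂, hl, hne⟩
    have hne₁ : π₁ ≠ [] := by
      rintro rfl
      exact hne (hA _ _ h₂ hl.symm).symm
    obtain ⟨α₀, s, a, r, β, rfl⟩ := hA.exists_last_letter h₁ hne₁
    obtain ⟨s', hα, ⟨ht, rfl, hβ⟩⟩ := isPath_append.1 h₁
    dsimp only at hα hβ
    -- Both cycles are conjugated in the same way: from `r` along `β` to `p`, around `π`, then along
    -- `α₀` to `s`. The letter transition from `s` to `r`, appended to both, resets whatever filter
    -- state `f` was reached.
    have hw : ∀ π, IsPath A p π p → IsPath A r (β ++ π ++ α₀) s := fun π h =>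
      (hβ.append h).append hα
    obtain ⟨f, hf⟩ := exists_pairWalk _ .free le_rfl (hw _ h₁) (hw _ h₂) (by simp only [label_append, hl])
      (by simp) (by simp)
    have hc := hf.trans (.letter ht ht (.nil _))
    obtain ⟨y, hy, hy₁, hy₂⟩ := hc.exists_off_diagonal hA
      (fun h => hne (List.append_cancel_left (List.append_cancel_right (List.append_cancel_right h))))
      rfl
    obtain ⟨⟨i, hi, ρ, hρ⟩, e, he, τ, hτ⟩ := onSuccessfulPath_iff.1 (hT r)
    have hr : OnSuccessfulPath (inter A A) (r, r, .free) := onSuccessfulPath_iff.2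
      ⟨⟨(i, i, .free), ⟨hi, hi, rfl⟩, hρ.pairWalk_self.reach⟩,
        (e, e, .free), ⟨he, he⟩, hτ.pairWalk_self.reach⟩
    have hy' : OnSuccessfulPath (inter A A) y := by
      obtain ⟨⟨i, hi, hi'⟩, e, he, he'⟩ := onSuccessfulPath_iff.1 hr
      exact onSuccessfulPath_iff.2 ⟨⟨i, hi, hi'.trans hy₁⟩, e, he, hy₂.trans he'⟩
    exact ⟨⟨_, hr⟩, ⟨y, hy'⟩, ⟨reach_trimmed_iff.2 hy₁, reach_trimmed_iff.2 hy₂⟩, rfl, hy⟩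
  · rintro ⟨⟨⟨p, p', f⟩, hx⟩, ⟨y, hy⟩, ⟨h₁, h₂⟩, hxd, hyd⟩
    obtain rfl : p = p' := hxd
    obtain ⟨π₁, π₂, hπ⟩ := (reach_trimmed_iff.1 h₁).exists_pairWalk
    obtain ⟨ρ₁, ρ₂, hρ⟩ := (reach_trimmed_iff.1 h₂).exists_pairWalk
    obtain ⟨c₁, c₂, hl⟩ := (hπ.trans hρ).project
    -- If the two projected cycles were equal, the walk could not pass through the off-diagonal
    -- state `y`.
    exact ⟨p, _, _, c₁, c₂, hl, fun he => hyd (hπ.diagonal hρ he rfl)⟩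

end Intersection

/-! ### Twin cycles as reachability of a diagonal pair from a divergence. -/

section PairGraph

variable {α σ : Type*} {A : εNFA α σ}

/-! ### The pair graph inspected by the algorithm -/

/-- A transition inside a strongly connected component. -/
def IsInternal (A : εNFA α σ) (t : σ × Option α × σ) : Prop :=
  t ∈ transitions A ∧ Reach A t.2.2 t.1

/-- Pairs of states reached by two paths of internal transitions from a common state that start
with distinct transitions. In a pair marked `false` the second path is still empty, the first
path consists of ε-transitions, and the second path has to continue with a letter. In a pair
marked `true` both paths have the same label. -/
inductive Diverged (A : εNFA α σ) : Bool → σ → σ → Prop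
  | fork {t₁ t₂} (h₁ : IsInternal A t₁) (h₂ : IsInternal A t₂) (hs : t₁.1 = t₂.1)
      (hl : t₁.2.1 = t₂.2.1) (ht : t₁.2.2 ≠ t₂.2.2) : Diverged A true t₁.2.2 t₂.2.2
  | lead {t₁ t₂} (h₁ : IsInternal A t₁) (h₂ : IsInternal A t₂) (hs : t₁.1 = t₂.1)
      (hl₁ : t₁.2.1 = none) (hl₂ : t₂.2.1 ≠ none) : Diverged A false t₁.2.2 t₂.1
  | letter {b t₁ t₂} (h : Diverged A b t₁.1 t₂.1) (h₁ : IsInternal A t₁) (h₂ : IsInternal A t₂)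
      (hl : t₁.2.1 = t₂.2.1) (hl₁ : t₁.2.1 ≠ none) : Diverged A true t₁.2.2 t₂.2.2
  | first {b t₁ q} (h : Diverged A b t₁.1 q) (h₁ : IsInternal A t₁) (hl₁ : t₁.2.1 = none) :
      Diverged A b t₁.2.2 q
  | second {p t₂} (h : Diverged A true p t₂.1) (h₂ : IsInternal A t₂) (hl₂ : t₂.2.1 = none) :
      Diverged A true p t₂.2.2

/-- The return path begins with the required transition; if it is empty, `t` is a loop and serves
itself. Thus both members of a diverged pair are sources of internal transitions, which the
numbering of pairs and the generation of edges rely on. -/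
theorem IsInternal.exists_next {t : σ × Option α × σ} (h : IsInternal A t) :
    ∃ u, IsInternal A u ∧ u.1 = t.2.2 := by
  obtain ⟨ht, π, hπ⟩ := h
  rcases π with _ | ⟨u, π⟩
  · exact ⟨t, ⟨ht, [], hπ⟩, hπ.symm⟩
  · obtain ⟨hu, he, hπ⟩ := hπ
    exact ⟨u, ⟨hu, Reach.trans ⟨π, hπ⟩ ((reach_of_mem ht).trans (he ▸ Reach.refl _))⟩, he⟩

theorem Diverged.exists_next {b : Bool} {p q : σ} (h : Diverged A b p q) :
    (∃ t, IsInternal A t ∧ t.1 = p) ∧ ∃ t, IsInternal A t ∧ t.1 = q := by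
  induction h with
  | fork h₁ h₂ => exact ⟨h₁.exists_next, h₂.exists_next⟩
  | lead h₁ h₂ => exact ⟨h₁.exists_next, _, h₂, rfl⟩
  | letter _ h₁ h₂ => exact ⟨h₁.exists_next, h₂.exists_next⟩
  | first _ h₁ _ ih => exact ⟨h₁.exists_next, ih.2⟩
  | second _ h₂ _ ih => exact ⟨ih.1, h₂.exists_next⟩

/-- The first transitions, once distinct, are never touched again. While the mark is `false` the
first path has begun with ε, and the second path then begins with a letter, so its first transition
differs. -/
theorem Diverged.exists_paths {b : Bool} {p q : σ} (h : Diverged A b p q) :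
    ∃ s t₁ π₁, IsPath A s (t₁ :: π₁) p ∧ Reach A p s ∧
      if b then ∃ t₂ π₂, IsPath A s (t₂ :: π₂) q ∧ label (t₁ :: π₁) = label (t₂ :: π₂) ∧ t₁ ≠ t₂
      else s = q ∧ t₁.2.1 = none ∧ label (t₁ :: π₁) = [] := by
  induction h with
  | @fork t₁ t₂ h₁ h₂ hs hl ht =>
    refine ⟨t₁.1, t₁, [], isPath_singleton h₁.1, h₁.2, ?_⟩
    rw [if_pos rfl]
    exact ⟨t₂, [], hs ▸ isPath_singleton h₂.1, by simp [label_cons, hl],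
      fun h => ht (by rw [h])⟩
  | @lead t₁ t₂ h₁ h₂ hs hl₁ hl₂ =>
    exact ⟨t₁.1, t₁, [], isPath_singleton h₁.1, h₁.2, hs, hl₁, by simp [label_cons, hl₁]⟩
  | @letter b u₁ u₂ h h₁ h₂ hl hl₁ ih =>
    obtain ⟨s, t₁, π₁, hp, hr, ih⟩ := ih
    refine ⟨s, t₁, π₁ ++ [u₁], hp.append (isPath_singleton h₁.1), h₁.2.trans hr, ?_⟩
    rw [if_pos rfl]
    cases b
    · obtain ⟨rfl, he, hlab⟩ := ih
      refine ⟨u₂, [], isPath_singleton h₂.1, ?_, ?_⟩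
      · rw [← List.cons_append, label_append, hlab]
        simp [label_cons, hl]
      · rintro rfl
        exact hl₁ (hl.trans he)
    · obtain ⟨t₂, π₂, hq, hlab, hne⟩ := ih
      refine ⟨t₂, π₂ ++ [u₂], hq.append (isPath_singleton h₂.1), ?_, hne⟩
      rw [← List.cons_append, ← List.cons_append, label_append, label_append, hlab]
      simp [label_cons, hl]
  | @first b u₁ q h h₁ hl₁ ih =>
    obtain ⟨s, t₁, π₁, hp, hr, ih⟩ := ih
    have e : label (t₁ :: (π₁ ++ [u₁])) = label (t₁ :: π₁) := by
      rw [← List.cons_append, label_append]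
      simp [label_cons, hl₁]
    exact ⟨s, t₁, π₁ ++ [u₁], hp.append (isPath_singleton h₁.1), h₁.2.trans hr, by rwa [e]⟩
  | @second p u₂ h h₂ hl₂ ih =>
    obtain ⟨s, t₁, π₁, hp, hr, t₂, π₂, hq, hlab, hne⟩ := ih
    refine ⟨s, t₁, π₁, hp, hr, t₂, π₂ ++ [u₂], hq.append (isPath_singleton h₂.1), ?_, hne⟩
    rw [← List.cons_append, label_append, hlab]
    simp [label_cons, hl₂]

theorem Diverged.hasTwinCycles {p : σ} (h : Diverged A true p p) : HasTwinCycles A := by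
  obtain ⟨s, t₁, π₁, hp, ⟨τ, hτ⟩, t₂, π₂, hq, hl, hne⟩ := h.exists_paths
  exact ⟨s, _, _, hp.append hτ, hq.append hτ, by simp only [label_append, hl],
    fun h => hne (List.cons.inj h).1⟩

theorem IsPath.internal_head {p r : σ} {t : σ × Option α × σ} {π : List (σ × Option α × σ)}
    (h : IsPath A p (t :: π) r) (hr : Reach A r p) : IsInternal A t :=
  ⟨h.1, h.2.1 ▸ Reach.trans ⟨π, h.2.2⟩ hr⟩

/-- Since `r` reaches `p` and `q`, all transitions of both paths are internal. They are consumed as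
moves of the pair: ε-transitions singly, letters together. With mark `false` the second path starts
with a letter, so it never needs an ε-move before the mark becomes `true`. -/
theorem Diverged.extend (N : ℕ) : ∀ {b : Bool} {p q r : σ} {π₁ π₂ : List (σ × Option α × σ)},
    π₁.length + π₂.length ≤ N → Diverged A b p q → IsPath A p π₁ r → IsPath A q π₂ r →
    Reach A r p → Reach A r q → label π₁ = label π₂ →
    (b = false → ∃ t ρ, π₂ = t :: ρ ∧ t.2.1 ≠ none) → Diverged A true r r := by
  induction N with
  | zero =>
    intro b p q r π₁ π₂ hN h h₁ h₂ _ _ _ hb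
    obtain rfl : π₁ = [] := List.length_eq_zero_iff.1 (by omega)
    obtain rfl : π₂ = [] := List.length_eq_zero_iff.1 (by omega)
    obtain rfl : p = r := h₁
    obtain rfl : q = p := h₂
    cases b
    · simpa using hb rfl
    · exact h
  | succ N ih =>
    intro b p q r π₁ π₂ hN h h₁ h₂ hr₁ hr₂ hl hb
    have hfirst : ∀ t ρ, π₁ = t :: ρ → t.2.1 = none → Diverged A true r r := by
      rintro t ρ rfl ht
      obtain ⟨m, rfl, h₁'⟩ := id h₁
      exact ih (by simp at hN; omega) (h.first (h₁.internal_head hr₁) ht) h₁' h₂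
        (hr₁.trans (reach_of_mem m)) hr₂ (by simpa [label_cons, ht] using hl) hb
    have hsecond : ∀ t ρ, π₂ = t :: ρ → t.2.1 = none → Diverged A true r r := by
      rintro t ρ rfl ht
      obtain ⟨m, rfl, h₂'⟩ := id h₂
      cases b
      · obtain ⟨_, _, ⟨rfl, rfl⟩, h'⟩ := hb rfl
        exact absurd ht h'
      · exact ih (by simp at hN; omega) (h.second (h₂.internal_head hr₂) ht) h₁ h₂'
          hr₁ (hr₂.trans (reach_of_mem m)) (by simpa [label_cons, ht] using hl) (by simp)
    rcases π₁ with _ | ⟨t₁, π₁⟩ <;> rcases π₂ with _ | ⟨t₂, π₂⟩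
    · obtain rfl : p = r := h₁
      obtain rfl : q = p := h₂
      cases b
      · simpa using hb rfl
      · exact h
    · refine hsecond _ _ rfl ?_
      rcases t₂ with ⟨_, _ | _, _⟩ <;> simp [label_cons] at hl ⊢
    · refine hfirst _ _ rfl ?_
      rcases t₁ with ⟨_, _ | _, _⟩ <;> simp [label_cons] at hl ⊢
    · by_cases e₁ : t₁.2.1 = none
      · exact hfirst _ _ rfl e₁
      by_cases e₂ : t₂.2.1 = none
      · exact hsecond _ _ rfl e₂
      have i₁ := h₁.internal_head hr₁
      have i₂ := h₂.internal_head hr₂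
      obtain ⟨m₁, rfl, h₁⟩ := h₁
      obtain ⟨m₂, rfl, h₂⟩ := h₂
      obtain ⟨a, ha⟩ := Option.ne_none_iff_exists'.1 e₁
      obtain ⟨b, hb⟩ := Option.ne_none_iff_exists'.1 e₂
      simp only [label_cons, ha, hb, Option.toList_some, List.cons_append, List.nil_append,
        List.cons.injEq] at hl
      exact ih (by simp at hN; omega) (h.letter i₁ i₂ (by rw [ha, hb, hl.1]) e₁) h₁ h₂
        (hr₁.trans (reach_of_mem m₁)) (hr₂.trans (reach_of_mem m₂)) hl.2 (by simp)

/-- Common initial transitions are stripped until the paths differ. Then either the two labels agree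
and the targets differ, or exactly one label is ε; two different letters would contradict the
equality of the path labels. -/
theorem exists_diverged_of_paths (hA : EpsCycleFree A) {p r : σ}
    {π₁ π₂ : List (σ × Option α × σ)} (h₁ : IsPath A p π₁ r) (h₂ : IsPath A p π₂ r)
    (hr : Reach A r p) (hl : label π₁ = label π₂) (hne : π₁ ≠ π₂) : Diverged A true r r := by
  induction π₁ generalizing p π₂ with
  | nil =>
    obtain rfl : p = r := h₁
    exact absurd (hA _ _ h₂ hl.symm).symm hne
  | cons t₁ π₁ ih =>
    rcases π₂ with _ | ⟨t₂, π₂⟩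
    · obtain rfl : p = r := h₂
      exact absurd (hA _ _ h₁ hl) hne
    have i₁ := h₁.internal_head hr
    have i₂ := h₂.internal_head hr
    have hp₁ := h₁
    have hp₂ := h₂
    obtain ⟨m₁, hs₁, h₁⟩ := h₁
    obtain ⟨m₂, hs₂, h₂⟩ := h₂
    have hr₁ : Reach A r t₁.2.2 := hr.trans (hs₁ ▸ reach_of_mem m₁)
    have hr₂ : Reach A r t₂.2.2 := hr.trans (hs₂ ▸ reach_of_mem m₂)
    have hs : t₁.1 = t₂.1 := hs₁.trans hs₂.symm
    by_cases hll : t₁.2.1 = t₂.2.1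
    · have hl' : label π₁ = label π₂ := by simpa [label_cons, hll] using hl
      by_cases ht : t₁.2.2 = t₂.2.2
      · have e : t₁ = t₂ := Prod.ext hs (Prod.ext hll ht)
        subst e
        exact ih h₁ h₂ hr₁ hl' (by simpa using hne)
      · exact (Diverged.fork i₁ i₂ hs hll ht).extend _ le_rfl h₁ h₂ hr₁ hr₂ hl' (by simp)
    · by_cases e₁ : t₁.2.1 = none
      · have e₂ : t₂.2.1 ≠ none := fun h => hll (e₁.trans h.symm)
        exact (Diverged.lead i₁ i₂ hs e₁ e₂).extend _ le_rfl h₁ (hs₂ ▸ hp₂) hr₁ (hs₂ ▸ hr)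
          (by simpa [label_cons, e₁] using hl) fun _ => ⟨_, _, rfl, e₂⟩
      · by_cases e₂ : t₂.2.1 = none
        -- `lead` always lets the first path begin with ε, so the two paths are exchanged.
        · exact (Diverged.lead i₂ i₁ hs.symm e₂ e₁).extend _ le_rfl h₂ (hs₁ ▸ hp₁) hr₂ (hs₁ ▸ hr)
            (by simpa [label_cons, e₂] using hl.symm) fun _ => ⟨_, _, rfl, e₁⟩
        · obtain ⟨a, ha⟩ := Option.ne_none_iff_exists'.1 e₁
          obtain ⟨b, hb⟩ := Option.ne_none_iff_exists'.1 e₂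
          simp only [label_cons, ha, hb, Option.toList_some, List.cons_append, List.nil_append,
            List.cons.injEq] at hl
          exact absurd (by rw [ha, hb, hl.1]) hll

theorem hasTwinCycles_iff_exists_diverged (hA : EpsCycleFree A) :
    HasTwinCycles A ↔ ∃ p, Diverged A true p p :=
  ⟨fun ⟨p, _, _, h₁, h₂, hl, hne⟩ =>
    ⟨p, exists_diverged_of_paths hA h₁ h₂ (Reach.refl p) hl hne⟩, fun ⟨_, h⟩ => h.hasTwinCycles⟩

end PairGraph

/-! ### A weakest-precondition calculus for RAM programs. -/

section VirtualMachine

/-! ### Straight-line programs with arrays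

The registers `3, 4, …` of the RAM serve as registers `0, 1, …` of a machine with eight unbounded
arrays, interleaved in the memory from the address in register `1` on. Registers `0` and `2` are
scratch registers. -/

/-- Registers and arrays. -/
structure ArrayState where
  reg : ℕ → ℕ
  arr : ℕ → ℕ → ℕ

/-- The state `s` represents `σ`, with the input `inp` below address `B`. -/
def Represents (B : ℕ) (inp : ℕ → ℕ) (σ : ArrayState) (s : RAMState) : Prop :=
  s.reg 1 = B ∧ (∀ r, s.reg (r + 3) = σ.reg r) ∧
    (∀ j < 8, ∀ i, s.mem (B + 8 * i + j) = σ.arr j i) ∧ ∀ i < B, s.mem i = inp i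

/-- Loops are excluded, so every command has a constant cost bound; loops are added at the level of
RAM programs. -/
inductive Cmd
  | skip
  | set (x c : ℕ)
  | add (x y z : ℕ)
  | addc (x y c : ℕ)
  | subc (x y c : ℕ)
  | inp (x y : ℕ)
  | get (j x y : ℕ)
  | put (j y x : ℕ)
  | seq (P Q : Cmd)
  | ifEq (x y : ℕ) (P Q : Cmd)
  | ifEqc (x c : ℕ) (P Q : Cmd)

/-- Sequence of instructions followed by a program. -/
def Program.after (l : List Instr) (P : Program) : Program :=
  l.foldr (fun i Q => .seq (.instr i) Q) P

/-- Leaves the address of entry `y` of array `j` in register `0`. -/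
def addressCode (j y : ℕ) : List Instr :=
  [.add 0 (y + 3) (y + 3), .add 0 0 0, .add 0 0 0, .add 0 1 0, .const 2 j, .add 0 0 2]

def Cmd.compile : Cmd → Program
  | .skip => .skip
  | .set x c => .instr (.const (x + 3) c)
  | .add x y z => .instr (.add (x + 3) (y + 3) (z + 3))
  | .addc x y c => .after [.const 0 c] (.instr (.add (x + 3) (y + 3) 0))
  | .subc x y c => .after [.const 0 c] (.instr (.sub (x + 3) (y + 3) 0))
  | .inp x y => .instr (.load (x + 3) (y + 3))
  | .get j x y => .after (addressCode j y) (.instr (.load (x + 3) 0))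
  | .put j y x => .after (addressCode j y) (.instr (.store 0 (x + 3)))
  | .seq P Q => .seq P.compile Q.compile
  | .ifEq x y P Q => .ite (.eq (x + 3) (y + 3)) P.compile Q.compile
  | .ifEqc x c P Q => .after [.const 0 c] (.ite (.eq (x + 3) 0) P.compile Q.compile)

/-- A bound for the number of steps. -/
def Cmd.cost : Cmd → ℕ
  | .seq P Q => P.cost + Q.cost
  | .ifEq _ _ P Q => P.cost + Q.cost + 1
  | .ifEqc _ _ P Q => P.cost + Q.cost + 2
  | _ => 7

/-- Assignment to a register. -/
def ArrayState.set (σ : ArrayState) (x v : ℕ) : ArrayState :=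
  { σ with reg := Function.update σ.reg x v }

/-- Assignment to entry `i` of array `j`. -/
def ArrayState.write (σ : ArrayState) (j i v : ℕ) : ArrayState :=
  { σ with arr := Function.update σ.arr j (Function.update (σ.arr j) i v) }

/-- Weakest preconditions: no overflow occurs, and the postcondition holds afterwards. -/
def Cmd.wp (W B : ℕ) (inp : ℕ → ℕ) : Cmd → (ArrayState → Prop) → ArrayState → Prop
  | .skip, Q, σ => Q σ
  | .set x c, Q, σ => c ≤ W ∧ Q (σ.set x c)
  | .add x y z, Q, σ => σ.reg y + σ.reg z ≤ W ∧ Q (σ.set x (σ.reg y + σ.reg z))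
  | .addc x y c, Q, σ => σ.reg y + c ≤ W ∧ Q (σ.set x (σ.reg y + c))
  | .subc x y c, Q, σ => c ≤ W ∧ Q (σ.set x (σ.reg y - c))
  | .inp x y, Q, σ => σ.reg y < B ∧ Q (σ.set x (inp (σ.reg y)))
  | .get j x y, Q, σ => j < 8 ∧ B + 8 * σ.reg y + 8 ≤ W ∧ Q (σ.set x (σ.arr j (σ.reg y)))
  | .put j y x, Q, σ => j < 8 ∧ B + 8 * σ.reg y + 8 ≤ W ∧ Q (σ.write j (σ.reg y) (σ.reg x))
  | .seq P R, Q, σ => P.wp W B inp (R.wp W B inp Q) σ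
  | .ifEq x y P R, Q, σ =>
    (σ.reg x = σ.reg y → P.wp W B inp Q σ) ∧ (σ.reg x ≠ σ.reg y → R.wp W B inp Q σ)
  | .ifEqc x c P R, Q, σ =>
    c ≤ W ∧ (σ.reg x = c → P.wp W B inp Q σ) ∧ (σ.reg x ≠ c → R.wp W B inp Q σ)

/-- Run on any state that represents `σ`, the program `P` halts after at most `T` steps in a
state that represents some state satisfying `Q`. -/
def Halts (W B : ℕ) (inp : ℕ → ℕ) (P : Program) (σ : ArrayState) (T : ℕ)
    (Q : ArrayState → Prop) : Prop :=
  ∀ s, Represents B inp σ s → ∃ t s' σ', Exec W P s t s' ∧ t ≤ T ∧ Represents B inp σ' s' ∧ Q σ'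

variable {W B : ℕ} {inp : ℕ → ℕ}

theorem Represents.set {σ : ArrayState} {s : RAMState} (h : Represents B inp σ s) (x v : ℕ) :
    Represents B inp (σ.set x v) (s.setReg (x + 3) v) := by
  obtain ⟨h₁, h₂, h₃, h₄⟩ := h
  refine ⟨?_, fun r => ?_, h₃, h₄⟩
  · simp [RAMState.setReg, h₁]
  · simp [RAMState.setReg, ArrayState.set, Function.update_apply, h₂]

theorem Represents.scratch {σ : ArrayState} {s : RAMState} (h : Represents B inp σ s) {x : ℕ}
    (hx : x = 0 ∨ x = 2) (v : ℕ) : Represents B inp σ (s.setReg x v) := by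
  obtain ⟨h₁, h₂, h₃, h₄⟩ := h
  refine ⟨?_, fun r => ?_, h₃, h₄⟩
  · rw [← h₁]
    exact Function.update_of_ne (by omega) _ _
  · rw [← h₂]
    exact Function.update_of_ne (by omega) _ _

theorem Represents.write {σ : ArrayState} {s : RAMState} (h : Represents B inp σ s) {j : ℕ}
    (hj : j < 8) (i v : ℕ) :
    Represents B inp (σ.write j i v)
      { s with mem := Function.update s.mem (B + 8 * i + j) v } := by
  obtain ⟨h₁, h₂, h₃, h₄⟩ := h
  refine ⟨h₁, h₂, fun j' hj' i' => ?_, fun i' hi' => ?_⟩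
  · simp only [ArrayState.write]
    by_cases e : j' = j
    · subst e
      by_cases e : i' = i
      · subst e; simp
      · rw [Function.update_of_ne (by omega), h₃ _ hj']
        simp [e]
    · rw [Function.update_of_ne (by omega), h₃ _ hj', Function.update_of_ne e]
  · rw [← h₄ _ hi']
    exact Function.update_of_ne (by omega) _ _

theorem exec_const_after {x c : ℕ} {l : List Instr} {P : Program} {s s' : RAMState} {t : ℕ}
    (hc : c ≤ W) (h : Exec W (.after l P) (s.setReg x c) t s') :
    Exec W (.after (.const x c :: l) P) s (1 + t) s' :=
  .seq (.instr (if_pos hc)) h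

theorem exec_const_then {x c : ℕ} {P : Program} {s s' : RAMState} {t : ℕ} (hc : c ≤ W)
    (h : Exec W P (s.setReg x c) t s') : Exec W (.after [.const x c] P) s (1 + t) s' :=
  exec_const_after hc h

theorem exec_add {x y z v : ℕ} {s : RAMState} (hv : s.reg y + s.reg z = v) (hW : v ≤ W) :
    Exec W (.instr (.add x y z)) s 1 (s.setReg x v) := by
  subst hv
  exact .instr (if_pos hW)

theorem exec_add_after {x y z v : ℕ} {l : List Instr} {P : Program} {s s' : RAMState} {t : ℕ}
    (hv : s.reg y + s.reg z = v) (hW : v ≤ W) (h : Exec W (.after l P) (s.setReg x v) t s') :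
    Exec W (.after (.add x y z :: l) P) s (1 + t) s' := by
  subst hv
  exact .seq (.instr (if_pos hW)) h

/-- Three doublings produce the factor 8. Only scratch registers change, so the represented state
remains the same. -/
theorem exec_addressCode {σ : ArrayState} {s : RAMState} (h : Represents B inp σ s) {j y : ℕ}
    (hj : j < 8) (hW : B + 8 * σ.reg y + 8 ≤ W) :
    ∃ s₁, Represents B inp σ s₁ ∧ s₁.reg 0 = B + 8 * σ.reg y + j ∧
      ∀ P s' t, Exec W P s₁ t s' → Exec W (.after (addressCode j y) P) s (6 + t) s' := by
  have h₁ := h.1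
  have h₂ := h.2.1 y
  have hs := (((((h.scratch (Or.inl rfl) (2 * σ.reg y)).scratch (Or.inl rfl)
    (4 * σ.reg y)).scratch (Or.inl rfl) (8 * σ.reg y)).scratch (Or.inl rfl)
    (B + 8 * σ.reg y)).scratch (Or.inr rfl) j).scratch (Or.inl rfl) (B + 8 * σ.reg y + j)
  refine ⟨_, hs, by simp [RAMState.setReg], fun P s' t he => ?_⟩
  have e : 6 + t = 1 + (1 + (1 + (1 + (1 + (1 + t))))) := by omega
  rw [e]
  refine exec_add_after ?_ (by omega) (exec_add_after ?_ (by omega) (exec_add_after ?_ (by omega)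
    (exec_add_after ?_ (by omega) (exec_const_after (by omega)
    (exec_add_after ?_ (by omega) he)))))
  all_goals simp [RAMState.setReg, h₁, h₂]
  all_goals omega

theorem Halts.of_wp {c : Cmd} {Q : ArrayState → Prop} {σ : ArrayState}
    (h : c.wp W B inp Q σ) : Halts W B inp c.compile σ c.cost Q := by
  induction c generalizing Q σ with
  | skip => exact fun s hs => ⟨1, s, σ, .skip s, by simp [Cmd.cost], hs, h⟩
  | set x c => exact fun s hs =>
      ⟨1, _, _, .instr (if_pos h.1), by simp [Cmd.cost], hs.set x c, h.2⟩
  | add x y z =>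
    intro s hs
    have h₁ := hs.2.1 y
    have h₂ := hs.2.1 z
    refine ⟨1, _, _, .instr (if_pos ?_), by simp [Cmd.cost], ?_, h.2⟩
    · rw [h₁, h₂]; exact h.1
    · rw [h₁, h₂]; exact hs.set _ _
  | addc x y c =>
    intro s hs
    have hs' := hs.scratch (Or.inl rfl) c
    have h₁ := hs'.2.1 y
    have h₂ : (s.setReg 0 c).reg 0 = c := by simp [RAMState.setReg]
    exact ⟨2, _, _, exec_const_then (by have := h.1; omega) (exec_add (by rw [h₁, h₂]) h.1),
      by simp [Cmd.cost], hs'.set _ _, h.2⟩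
  | subc x y c =>
    intro s hs
    have hs' := hs.scratch (Or.inl rfl) c
    have h₁ := hs'.2.1 y
    have h₂ : (s.setReg 0 c).reg 0 = c := by simp [RAMState.setReg]
    refine ⟨2, _, _, exec_const_then h.1 (.instr rfl), by simp [Cmd.cost], ?_, h.2⟩
    rw [h₁, h₂]; exact hs'.set _ _
  | inp x y =>
    intro s hs
    have h₁ := hs.2.1 y
    refine ⟨1, _, _, .instr rfl, by simp [Cmd.cost], ?_, h.2⟩
    rw [h₁, hs.2.2.2 _ h.1]; exact hs.set _ _
  | get j x y =>
    intro s hs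
    obtain ⟨s₁, hs₁, he, hx⟩ := exec_addressCode hs h.1 h.2.1
    refine ⟨7, _, _, hx _ _ 1 (.instr rfl), by simp [Cmd.cost], ?_, h.2.2⟩
    rw [he, hs₁.2.2.1 _ h.1]; exact hs₁.set _ _
  | put j y x =>
    intro s hs
    obtain ⟨s₁, hs₁, he, hx⟩ := exec_addressCode hs h.1 h.2.1
    refine ⟨7, _, _, hx _ _ 1 (.instr rfl), by simp [Cmd.cost], ?_, h.2.2⟩
    rw [he, hs₁.2.1 x]; exact hs₁.write h.1 _ _
  | seq P R ihP ihR =>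
    intro s hs
    obtain ⟨t₁, s₁, σ₁, e₁, l₁, r₁, q₁⟩ := ihP h s hs
    obtain ⟨t₂, s₂, σ₂, e₂, l₂, r₂, q₂⟩ := ihR q₁ s₁ r₁
    exact ⟨_, _, _, .seq e₁ e₂, by simp only [Cmd.cost]; omega, r₂, q₂⟩
  | ifEq x y P R ihP ihR =>
    intro s hs
    have h₁ := hs.2.1 x
    have h₂ := hs.2.1 y
    by_cases e : σ.reg x = σ.reg y
    · obtain ⟨t₁, s₁, σ₁, e₁, l₁, r₁, q₁⟩ := ihP (h.1 e) s hs
      exact ⟨_, _, _, .iteTrue (show s.reg _ = s.reg _ by rw [h₁, h₂, e]) e₁,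
        by simp only [Cmd.cost]; omega, r₁, q₁⟩
    · obtain ⟨t₁, s₁, σ₁, e₁, l₁, r₁, q₁⟩ := ihR (h.2 e) s hs
      exact ⟨_, _, _, .iteFalse (show ¬ s.reg _ = s.reg _ by rwa [h₁, h₂]) e₁,
        by simp only [Cmd.cost]; omega, r₁, q₁⟩
  | ifEqc x c P R ihP ihR =>
    intro s hs
    have hs' := hs.scratch (Or.inl rfl) c
    have h₁ := hs'.2.1 x
    have h₂ : (s.setReg 0 c).reg 0 = c := by simp [RAMState.setReg]
    by_cases e : σ.reg x = c
    · obtain ⟨t₁, s₁, σ₁, e₁, l₁, r₁, q₁⟩ := ihP (h.2.1 e) _ hs'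
      exact ⟨_, _, _, exec_const_then h.1
        (.iteTrue (show RAMState.reg _ _ = RAMState.reg _ _ by rw [h₁, h₂, e]) e₁),
        by simp only [Cmd.cost]; omega, r₁, q₁⟩
    · obtain ⟨t₁, s₁, σ₁, e₁, l₁, r₁, q₁⟩ := ihR (h.2.2 e) _ hs'
      exact ⟨_, _, _, exec_const_then h.1
        (.iteFalse (show ¬ RAMState.reg _ _ = RAMState.reg _ _ by rwa [h₁, h₂]) e₁),
        by simp only [Cmd.cost]; omega, r₁, q₁⟩

theorem Cmd.wp_mono {c : Cmd} {Q Q' : ArrayState → Prop} (hQ : ∀ σ, Q σ → Q' σ) {σ : ArrayState}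
    (h : c.wp W B inp Q σ) : c.wp W B inp Q' σ := by
  induction c generalizing Q Q' σ with
  | skip => exact hQ _ h
  | set | add | addc | subc | inp => exact ⟨h.1, hQ _ h.2⟩
  | get | put => exact ⟨h.1, h.2.1, hQ _ h.2.2⟩
  | seq P R ihP ihR => exact ihP (fun σ => ihR hQ) h
  | ifEq x y P R ihP ihR => exact ⟨fun e => ihP hQ (h.1 e), fun e => ihR hQ (h.2 e)⟩
  | ifEqc x c P R ihP ihR =>
    exact ⟨h.1, fun e => ihP hQ (h.2.1 e), fun e => ihR hQ (h.2.2 e)⟩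

theorem Cmd.wp_seq {P R : Cmd} {Q Q' : ArrayState → Prop} {σ : ArrayState}
    (h : P.wp W B inp Q' σ) (h' : ∀ σ', Q' σ' → R.wp W B inp Q σ') :
    (Cmd.seq P R).wp W B inp Q σ :=
  Cmd.wp_mono h' h

/-! ### Composition and loops -/

theorem Halts.seq {P R : Program} {σ : ArrayState} {T₁ T₂ : ℕ} {Q Q' : ArrayState → Prop}
    (h₁ : Halts W B inp P σ T₁ Q) (h₂ : ∀ σ', Q σ' → Halts W B inp R σ' T₂ Q') :
    Halts W B inp (.seq P R) σ (T₁ + T₂) Q' := by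
  intro s hs
  obtain ⟨t₁, s₁, σ₁, e₁, l₁, r₁, q₁⟩ := h₁ s hs
  obtain ⟨t₂, s₂, σ₂, e₂, l₂, r₂, q₂⟩ := h₂ _ q₁ s₁ r₁
  exact ⟨_, _, _, .seq e₁ e₂, by omega, r₂, q₂⟩

theorem Halts.mono {P : Program} {σ : ArrayState} {T T' : ℕ} {Q Q' : ArrayState → Prop}
    (h : Halts W B inp P σ T Q) (hT : T ≤ T') (hQ : ∀ σ', Q σ' → Q' σ') :
    Halts W B inp P σ T' Q' := by
  intro s hs
  obtain ⟨t₁, s₁, σ₁, e₁, l₁, r₁, q₁⟩ := h s hs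
  exact ⟨_, _, _, e₁, l₁.trans hT, r₁, hQ _ q₁⟩

/-- A loop whose body decreases the index of the invariant. -/
theorem Halts.while {P : Program} {x y T : ℕ} (Inv : ℕ → ArrayState → Prop)
    (h : ∀ k σ, Inv k σ → σ.reg x < σ.reg y →
      Halts W B inp P σ T fun σ' => ∃ k' < k, Inv k' σ') (k : ℕ) :
    ∀ σ, Inv k σ → Halts W B inp (.while (.lt (x + 3) (y + 3)) P) σ (k * (T + 1) + 1) fun σ' =>
      ¬ σ'.reg x < σ'.reg y ∧ ∃ k' ≤ k, Inv k' σ' := by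
  induction k using Nat.strong_induction_on with
  | _ k ih =>
  intro σ hσ s hs
  have h₁ := hs.2.1 x
  have h₂ := hs.2.1 y
  by_cases e : σ.reg x < σ.reg y
  · obtain ⟨t₁, s₁, σ₁, e₁, l₁, r₁, k', hk', q₁⟩ := h k σ hσ e s hs
    obtain ⟨t₂, s₂, σ₂, e₂, l₂, r₂, c₂, k'', hk'', q₂⟩ := ih k' hk' σ₁ q₁ s₁ r₁
    refine ⟨_, _, _, .whileTrue (show s.reg _ < s.reg _ by rwa [h₁, h₂]) e₁ e₂, ?_, r₂, c₂, k'',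
      by omega, q₂⟩
    have := Nat.mul_le_mul_right (T + 1) (show k' + 1 ≤ k from hk')
    rw [Nat.add_mul] at this
    omega
  · exact ⟨_, _, _, .whileFalse (show ¬ s.reg _ < s.reg _ by rwa [h₁, h₂]), by omega, hs, e, k,
      le_rfl, hσ⟩

/-- Runs `P` for the values `5, 8, 11, …` of register `x` below the value of register `y`. -/
def scan (x y : ℕ) (P : Program) : Program :=
  .seq (Cmd.set x 5).compile (.while (.lt (x + 3) (y + 3)) (.seq P (Cmd.addc x x 3).compile))

/-- The values `5 + 3 * i` are the addresses of the transitions: five header words, then three words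
each. The invariant has to tolerate assignments to the loop register, because initialisation and
increment are such assignments. -/
theorem Halts.scan {P : Program} {x y T m : ℕ} (Inv : ℕ → ArrayState → Prop)
    (hW : 3 * m + 5 ≤ W)
    (hset : ∀ i σ v, Inv i σ → Inv i (σ.set x v))
    (hy : ∀ i σ, Inv i σ → σ.reg y = 5 + 3 * m)
    (h : ∀ i < m, ∀ σ, Inv i σ → σ.reg x = 5 + 3 * i →
      Halts W B inp P σ T fun σ' => Inv (i + 1) σ' ∧ σ'.reg x = 5 + 3 * i)
    {σ : ArrayState} (hσ : Inv 0 σ) :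
    Halts W B inp (Ambiguity.scan x y P) σ (m * (T + 8) + 8) (Inv m) := by
  let J : ℕ → ArrayState → Prop := fun k σ =>
    ∃ i, i + k = m ∧ Inv i σ ∧ σ.reg x = 5 + 3 * i
  have hloop := Halts.while (W := W) (B := B) (inp := inp) (x := x) (y := y) (T := T + 7)
    (P := .seq P (Cmd.addc x x 3).compile) J (by
      rintro k σ ⟨i, hik, hi, hx⟩ hlt
      rw [hx, hy _ _ hi] at hlt
      refine Halts.seq (h i (by omega) σ hi hx) fun σ' hσ' => ?_
      refine Halts.of_wp (c := .addc x x 3) ⟨by rw [hσ'.2]; omega, k - 1, by omega, i + 1,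
        by omega, hset _ _ _ hσ'.1, ?_⟩
      simp [ArrayState.set, hσ'.2]
      omega) m
  refine (Halts.seq (T₁ := 7) (Q := J m) (Halts.of_wp (c := .set x 5)
    ⟨by omega, 0, by omega, hset _ _ _ hσ, ?_⟩) hloop).mono (by rw [Nat.add_assoc T]; omega) ?_
  · simp [ArrayState.set]
  · rintro σ' ⟨hlt, k', -, i, hik, hi, hx⟩
    rw [hx, hy _ _ hi] at hlt
    obtain rfl : i = m := by omega
    exact hi

end VirtualMachine

/-! ### Linked adjacency lists and depth-first search in linear time. -/

section GraphSearch

/-! ### Graphs as linked adjacency lists -/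

/-- The heads of the edges of `g` with tail `u`. -/
def adj (g : List (ℕ × ℕ)) (u : ℕ) : List ℕ := (g.filter fun e => e.1 = u).map Prod.snd

/-- The linked list starting at cell `e`, with cells below `c`, holds the given entries. -/
def Linked (nxt tgt : ℕ → ℕ) (c : ℕ) : ℕ → List ℕ → Prop
  | e, [] => e = 0
  | e, v :: l => e ≠ 0 ∧ e < c ∧ tgt e = v ∧ Linked nxt tgt c (nxt e) l

theorem Linked.frame {nxt tgt nxt' tgt' : ℕ → ℕ} {c c' e : ℕ} {l : List ℕ}
    (h : Linked nxt tgt c e l) (hc : c ≤ c') (hn : ∀ e < c, nxt' e = nxt e ∧ tgt' e = tgt e) :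
    Linked nxt' tgt' c' e l := by
  induction l generalizing e with
  | nil => exact h
  | cons v l ih =>
    obtain ⟨h₀, h₁, h₂, h₃⟩ := h
    exact ⟨h₀, by omega, (hn e h₁).2.trans h₂, ih ((hn e h₁).1 ▸ h₃)⟩

theorem adj_cons_self (u v : ℕ) (g : List (ℕ × ℕ)) : adj ((u, v) :: g) u = v :: adj g u := by
  simp [adj]

theorem adj_cons_of_ne {u w : ℕ} (v : ℕ) (g : List (ℕ × ℕ)) (h : u ≠ w) :
    adj ((u, v) :: g) w = adj g w := by
  simp [adj, h]

theorem adj_eq_nil {g : List (ℕ × ℕ)} {u : ℕ} (h : adj g u = []) (v : ℕ) : (u, v) ∉ g := by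
  intro hm
  simp only [adj, List.map_eq_nil_iff, List.filter_eq_nil_iff] at h
  exact h _ hm (by simp)

/-- Models advancing a list head. One occurrence is removed; the edge may still occur in `g'`, hence
the inclusive disjunction. -/
theorem exists_removeEdge {g : List (ℕ × ℕ)} {u v : ℕ} {l : List ℕ} (h : adj g u = v :: l) :
    ∃ g', g'.length + 1 = g.length ∧ adj g' u = l ∧ (∀ w, w ≠ u → adj g' w = adj g w) ∧
      ∀ e, e ∈ g ↔ e = (u, v) ∨ e ∈ g' := by
  induction g with
  | nil => simp [adj] at h
  | cons a g ih =>
    obtain ⟨x, y⟩ := a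
    by_cases e : x = u
    · subst e
      rw [adj_cons_self, List.cons.injEq] at h
      obtain ⟨rfl, rfl⟩ := h
      exact ⟨g, rfl, rfl, fun w hw => (adj_cons_of_ne _ _ hw.symm).symm, by simp⟩
    · rw [adj_cons_of_ne _ _ e] at h
      obtain ⟨g', h₁, h₂, h₃, h₄⟩ := ih h
      refine ⟨(x, y) :: g', by simp [h₁], by rwa [adj_cons_of_ne _ _ e], fun w hw => ?_, ?_⟩
      · by_cases ew : x = w
        · subst ew; rw [adj_cons_self, adj_cons_self, h₃ _ hw]
        · rw [adj_cons_of_ne _ _ ew, adj_cons_of_ne _ _ ew, h₃ _ hw]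
      · intro a
        simp only [List.mem_cons, h₄]
        tauto

/-- The first entries of the array `s`, in reverse order. -/
def StackIs (s : ℕ → ℕ) : List ℕ → Prop
  | [] => True
  | u :: l => s l.length = u ∧ StackIs s l

theorem StackIs.frame {s s' : ℕ → ℕ} {l : List ℕ} (h : StackIs s l)
    (hs : ∀ i < l.length, s' i = s i) : StackIs s' l := by
  induction l with
  | nil => trivial
  | cons u l ih =>
    exact ⟨(hs _ (by simp)).trans h.1, ih h.2 fun i hi => hs i (by simp; omega)⟩

variable {W B : ℕ} {inp : ℕ → ℕ}

theorem ArrayState.set_reg (σ : ArrayState) (x v r : ℕ) :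
    (σ.set x v).reg r = if r = x then v else σ.reg r := by
  simp [ArrayState.set, Function.update_apply]

theorem ArrayState.set_arr (σ : ArrayState) (x v : ℕ) : (σ.set x v).arr = σ.arr := rfl

theorem ArrayState.write_reg (σ : ArrayState) (j i v : ℕ) : (σ.write j i v).reg = σ.reg := rfl

theorem ArrayState.write_arr (σ : ArrayState) (j i v j' : ℕ) :
    (σ.write j i v).arr j' = if j' = j then Function.update (σ.arr j) i v else σ.arr j' := by
  by_cases h : j' = j
  · subst h; simp [ArrayState.write]
  · simp [ArrayState.write, h]

theorem ArrayState.set_set (σ : ArrayState) (x v w : ℕ) : (σ.set x v).set x w = σ.set x w := by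
  simp [ArrayState.set]

/-! The arrays are: `0` row offsets, `1` and `2` list heads, `3` and `4` marks, `5` and `6` entries
and links of list cells, `7` stack. Register `0` holds the next unused list cell and register `1`
the height of the stack; registers `2` to `9` are temporary, and register `14` holds `0`. -/

/-- The number of the pair `(p, q)` with mark `f`. -/
def node (row : ℕ → ℕ) (f p q : ℕ) : ℕ := 4 * (row p + q) + f

def mkNode (x f p q : ℕ) : Cmd :=
  .seq (.get 0 x p) (.seq (.add x x q) (.seq (.add x x x) (.seq (.add x x x) (.addc x x f))))

theorem mkNode_wp {x f p q : ℕ} {Q : ArrayState → Prop} {σ : ArrayState} (hq : q ≠ x)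
    (hp : B + 8 * σ.reg p + 8 ≤ W) (hn : node (σ.arr 0) f (σ.reg p) (σ.reg q) ≤ W)
    (hQ : Q (σ.set x (node (σ.arr 0) f (σ.reg p) (σ.reg q)))) :
    (mkNode x f p q).wp W B inp Q σ := by
  simp only [node] at hn hQ
  simp only [mkNode, Cmd.wp, ArrayState.set_set, ArrayState.set_reg, if_neg hq, if_true]
  refine ⟨by norm_num, hp, by omega, by omega, by omega, by omega, ?_⟩
  rwa [← two_mul, ← two_mul, ← mul_assoc]

/-- Adds the edge from register `2` to register `3`. -/
def addEdge (h : ℕ) : Cmd :=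
  .seq (.get h 4 2) (.seq (.put 6 0 4) (.seq (.put 5 0 3) (.seq (.put h 2 0) (.addc 0 0 1))))

/-- The lists of heads `h` represent the graph `g`; the registers from `10` on and the other
arrays are given by `ρ` and `α`. -/
structure GraphState (h : ℕ) (ρ : ℕ → ℕ) (α : ℕ → ℕ → ℕ) (c₀ : ℕ) (g : List (ℕ × ℕ))
    (σ : ArrayState) : Prop where
  reg : ∀ r, 10 ≤ r → σ.reg r = ρ r
  stack : σ.reg 1 = 0
  cell : σ.reg 0 = c₀ + g.length
  arr : ∀ j, j ≠ h → j ≠ 5 → j ≠ 6 → σ.arr j = α j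
  linked : ∀ u, Linked (σ.arr 6) (σ.arr 5) (σ.reg 0) (σ.arr h u) (adj g u)

variable {h v c₀ : ℕ} {ρ : ℕ → ℕ} {α : ℕ → ℕ → ℕ} {g : List (ℕ × ℕ)} {σ : ArrayState}

theorem GraphState.set_temp (hσ : GraphState h ρ α c₀ g σ) {x : ℕ} (hx : 2 ≤ x) (hx' : x < 10)
    (w : ℕ) : GraphState h ρ α c₀ g (σ.set x w) := by
  obtain ⟨h₁, h₂, h₃, h₄, h₅⟩ := hσ
  refine ⟨fun r hr => ?_, ?_, ?_, h₄, ?_⟩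
  · rw [ArrayState.set_reg, if_neg (by omega), h₁ r hr]
  · rw [ArrayState.set_reg, if_neg (by omega), h₂]
  · rw [ArrayState.set_reg, if_neg (by omega), h₃]
  · rw [ArrayState.set_reg, if_neg (by omega)]; exact h₅

theorem addEdge_wp (hh : h = 1 ∨ h = 2) (hc : 1 ≤ c₀) (hσ : GraphState h ρ α c₀ g σ)
    (h₂ : B + 8 * σ.reg 2 + 8 ≤ W) (h₀ : B + 8 * (c₀ + g.length) + 8 ≤ W) :
    (addEdge h).wp W B inp (GraphState h ρ α c₀ ((σ.reg 2, σ.reg 3) :: g)) σ := by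
  have hcell := hσ.cell
  have key : GraphState h ρ α c₀ ((σ.reg 2, σ.reg 3) :: g)
      (((((σ.set 4 (σ.arr h (σ.reg 2))).write 6 (σ.reg 0) (σ.arr h (σ.reg 2))).write 5 (σ.reg 0)
        (σ.reg 3)).write h (σ.reg 2) (σ.reg 0)).set 0 (σ.reg 0 + 1)) := by
    have h5 : (5 : ℕ) ≠ h := by omega
    have h6 : (6 : ℕ) ≠ h := by omega
    refine ⟨fun r hr => ?_, ?_, ?_, fun j hj h₅ h₆ => ?_, fun u => ?_⟩
    · simp only [ArrayState.set_reg, ArrayState.write_reg, if_neg (show r ≠ 0 by omega),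
        if_neg (show r ≠ 4 by omega)]
      exact hσ.reg r hr
    · simpa [ArrayState.set_reg, ArrayState.write_reg] using hσ.stack
    · simp [ArrayState.set_reg, hcell]; omega
    · simp only [ArrayState.set_arr, ArrayState.write_arr, if_neg hj, if_neg h₅, if_neg h₆]
      exact hσ.arr j hj h₅ h₆
    -- Only the unused cell at `σ.reg 0` is written, so all existing lists survive.
    · have hf : Linked (Function.update (σ.arr 6) (σ.reg 0) (σ.arr h (σ.reg 2)))
          (Function.update (σ.arr 5) (σ.reg 0) (σ.reg 3)) (σ.reg 0 + 1) (σ.arr h u) (adj g u) :=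
        (hσ.linked u).frame (by omega) fun e he => by
          rw [Function.update_of_ne (by omega), Function.update_of_ne (by omega)]
          exact ⟨rfl, rfl⟩
      simp only [ArrayState.set_arr, ArrayState.write_arr, if_neg h5, if_neg h6, if_true,
        ArrayState.set_reg, h5.symm, h6.symm, if_false, show (6 : ℕ) ≠ 5 by norm_num,
        show (5 : ℕ) ≠ 6 by norm_num]
      by_cases e : σ.reg 2 = u
      · subst e
        rw [adj_cons_self, Function.update_self]
        refine ⟨by omega, by omega, Function.update_self .., ?_⟩
        rwa [Function.update_self]
      · rwa [adj_cons_of_ne _ _ e, Function.update_of_ne (Ne.symm e)]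
  simp only [addEdge, Cmd.wp, ArrayState.set_reg, ArrayState.write_reg, if_true, Nat.reduceEqDiff, if_false,
    OfNat.zero_ne_ofNat]
  refine ⟨by omega, h₂, by norm_num, by omega, by norm_num, by omega, by omega, h₂, by omega, ?_⟩
  exact key

/-- Adds the edge from the pair in registers `p`, `q` to the pair in registers `p'`, `q'`. -/
def pairEdge (h f p q f' p' q' : ℕ) : Cmd :=
  .seq (mkNode 2 f p q) (.seq (mkNode 3 f' p' q') (addEdge h))

/-- Adds an edge from the root `3` to the pair in registers `p`, `q`. -/
def rootEdge (h f p q : ℕ) : Cmd :=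
  .seq (.set 2 3) (.seq (mkNode 3 f p q) (addEdge h))

theorem pairEdge_wp {f p q f' p' q' X : ℕ} (hh : h = 1 ∨ h = 2) (hc : 1 ≤ c₀)
    (hσ : GraphState h ρ α c₀ g σ) (hX : B + 8 * X + 8 ≤ W) (hg : c₀ + g.length ≤ X)
    (hp : 10 ≤ p) (hq : 10 ≤ q) (hp' : 10 ≤ p') (hq' : 10 ≤ q')
    (hpX : ρ p ≤ X) (hpX' : ρ p' ≤ X) (hn : node (α 0) f (ρ p) (ρ q) ≤ X)
    (hn' : node (α 0) f' (ρ p') (ρ q') ≤ X) :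
    (pairEdge h f p q f' p' q').wp W B inp
      (GraphState h ρ α c₀ ((node (α 0) f (ρ p) (ρ q), node (α 0) f' (ρ p') (ρ q')) :: g)) σ := by
  have hrow := hσ.arr 0 (by omega) (by norm_num) (by norm_num)
  have e := hσ.reg p hp
  have e₁ := hσ.reg q hq
  refine mkNode_wp (by omega) (by omega) (by rw [hrow, e, e₁]; omega) ?_
  rw [hrow, e, e₁]
  have hσ₁ := hσ.set_temp (x := 2) le_rfl (by norm_num) (node (α 0) f (ρ p) (ρ q))
  have e := hσ₁.reg p' hp'
  have e₁ := hσ₁.reg q' hq'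
  refine mkNode_wp (by omega) (by omega) (by rw [ArrayState.set_arr, hrow, e, e₁]; omega) ?_
  rw [ArrayState.set_arr, hrow, e, e₁]
  refine addEdge_wp hh hc (hσ₁.set_temp (by norm_num) (by norm_num) _) ?_ (by omega)
  simp [ArrayState.set_reg]
  omega

theorem rootEdge_wp {f p q X : ℕ} (hh : h = 1 ∨ h = 2) (hc : 1 ≤ c₀)
    (hσ : GraphState h ρ α c₀ g σ) (hX : B + 8 * X + 8 ≤ W) (hg : c₀ + g.length ≤ X)
    (hp : 10 ≤ p) (hq : 10 ≤ q) (hpX : ρ p ≤ X) (hn : node (α 0) f (ρ p) (ρ q) ≤ X)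
    (h3 : 3 ≤ X) :
    (rootEdge h f p q).wp W B inp
      (GraphState h ρ α c₀ ((3, node (α 0) f (ρ p) (ρ q)) :: g)) σ := by
  have hrow := hσ.arr 0 (by omega) (by norm_num) (by norm_num)
  refine ⟨by omega, ?_⟩
  have hσ₁ := hσ.set_temp (x := 2) le_rfl (by norm_num) 3
  have e := hσ₁.reg p hp
  have e₁ := hσ₁.reg q hq
  refine mkNode_wp (by omega) (by omega) (by rw [ArrayState.set_arr, hrow, e, e₁]; omega) ?_
  rw [ArrayState.set_arr, hrow, e, e₁]
  refine addEdge_wp hh hc (hσ₁.set_temp (by norm_num) (by norm_num) _) ?_ (by omega)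
  simp [ArrayState.set_reg]
  omega

/-! ### Depth-first search -/

/-- Marks the node in register `3` and pushes it on the stack, unless it is marked. -/
def push (v : ℕ) : Cmd :=
  .seq (.get v 4 3) (.ifEqc 4 0
    (.seq (.set 4 1) (.seq (.put v 3 4) (.seq (.put 7 1 3) (.addc 1 1 1)))) .skip)

/-- Removes an edge that leaves the top of the stack and pushes its head, or pops the top. -/
def searchStep (h v : ℕ) : Cmd :=
  .seq (.subc 2 1 1) (.seq (.get 7 2 2) (.seq (.get h 4 2) (.ifEqc 4 0 (.subc 1 1 1)
    (.seq (.get 6 5 4) (.seq (.put h 2 5) (.seq (.get 5 3 4) (push v)))))))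

def search (h v : ℕ) : Program :=
  .seq (Cmd.seq (.set 3 3) (push v)).compile
    (.while (.lt (14 + 3) (1 + 3)) (searchStep h v).compile)

/-- State of the search of the graph `G`: the edges in `g` have not been used, and `st` is the
stack. -/
structure SearchState (h v : ℕ) (ρ : ℕ → ℕ) (α : ℕ → ℕ → ℕ) (c : ℕ) (G g : List (ℕ × ℕ))
    (st : List ℕ) (σ : ArrayState) : Prop where
  reg : ∀ r, 10 ≤ r → σ.reg r = ρ r
  height : σ.reg 1 = st.length
  cell : σ.reg 0 = c
  arr : ∀ j, j ≠ h → j ≠ v → j ≠ 7 → σ.arr j = α j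
  linked : ∀ u, Linked (σ.arr 6) (σ.arr 5) c (σ.arr h u) (adj g u)
  stack : StackIs (σ.arr 7) st
  used : ∀ e ∈ G, e ∈ g ∨ σ.arr v e.2 ≠ 0
  sub : ∀ e ∈ g, e ∈ G
  closed : ∀ u, σ.arr v u ≠ 0 → u ∈ st ∨ adj g u = []
  sound : ∀ u, σ.arr v u ≠ 0 → Relation.ReflTransGen (fun a b => (a, b) ∈ G) 3 u
  marked : ∀ u ∈ st, σ.arr v u ≠ 0

variable {G : List (ℕ × ℕ)} {st : List ℕ} {c X : ℕ}

/-- Effect of `push` on a state that violates the invariant only in that the edge to the node in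
register `3` counts as used. -/
theorem push_wp (hhv : h = 1 ∧ v = 3 ∨ h = 2 ∧ v = 4) (hX : B + 8 * X + 8 ≤ W)
    (reg : ∀ r, 10 ≤ r → σ.reg r = ρ r) (height : σ.reg 1 = st.length) (cell : σ.reg 0 = c)
    (arr : ∀ j, j ≠ h → j ≠ v → j ≠ 7 → σ.arr j = α j)
    (linked : ∀ u, Linked (σ.arr 6) (σ.arr 5) c (σ.arr h u) (adj g u))
    (stack : StackIs (σ.arr 7) st)
    (used : ∀ e ∈ G, e.2 = σ.reg 3 ∨ e ∈ g ∨ σ.arr v e.2 ≠ 0) (sub : ∀ e ∈ g, e ∈ G)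
    (closed : ∀ u, σ.arr v u ≠ 0 → u ∈ st ∨ adj g u = [])
    (sound : ∀ u, σ.arr v u ≠ 0 → Relation.ReflTransGen (fun a b => (a, b) ∈ G) 3 u)
    (marked : ∀ u ∈ st, σ.arr v u ≠ 0) (hst : st.length + 1 ≤ X) (hu : σ.reg 3 ≤ X)
    (hr : Relation.ReflTransGen (fun a b => (a, b) ∈ G) 3 (σ.reg 3)) :
    (push v).wp W B inp (fun σ' => σ'.arr v (σ.reg 3) ≠ 0 ∧
      (∀ u, σ.arr v u ≠ 0 → σ'.arr v u ≠ 0) ∧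
      ∃ st', st'.length ≤ st.length + 1 ∧ SearchState h v ρ α c G g st' σ') σ := by
  have hv : v ≠ h ∧ v ≠ 5 ∧ v ≠ 6 ∧ v ≠ 7 ∧ v < 8 := by omega
  have hh : h ≠ 5 ∧ h ≠ 6 ∧ h ≠ 7 ∧ h < 8 := by omega
  simp only [push, Cmd.wp, ArrayState.set_reg, ArrayState.write_reg, ArrayState.set_arr, if_true,
    Nat.reduceEqDiff, if_false, OfNat.one_ne_ofNat]
  refine ⟨hv.2.2.2.2, by omega, by omega, fun h0 => ?_, fun h0 => ?_⟩
  · refine ⟨by omega, hv.2.2.2.2, by omega, by norm_num, by omega, by omega, ?_⟩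
    have hm : ∀ u, Function.update (σ.arr v) (σ.reg 3) 1 u ≠ 0 ↔ u = σ.reg 3 ∨ σ.arr v u ≠ 0 := by
      intro u
      by_cases e : u = σ.reg 3
      · subst e; simp
      · simp [e]
    simp only [ArrayState.set_arr, ArrayState.write_arr, if_true, if_neg hv.2.2.2.1]
    refine ⟨(hm _).2 (Or.inl rfl), fun u hu => (hm _).2 (Or.inr hu), σ.reg 3 :: st, le_rfl, ?_⟩
    constructor
    · intro r hr
      simp only [ArrayState.set_reg, ArrayState.write_reg, if_neg (show r ≠ 1 by omega),
        if_neg (show r ≠ 4 by omega)]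
      exact reg r hr
    · simp [ArrayState.set_reg, height]
    · simp [ArrayState.set_reg, ArrayState.write_reg, cell]
    · intro j h₁ h₂ h₃
      simp only [ArrayState.set_arr, ArrayState.write_arr, if_neg h₂, if_neg h₃]
      exact arr j h₁ h₂ h₃
    · simp only [ArrayState.set_arr, ArrayState.write_arr, hv.1.symm, hv.2.1.symm, hv.2.2.1.symm,
        hh.2.2.1, Nat.reduceEqDiff, if_false]
      exact linked
    · simp only [ArrayState.set_arr, ArrayState.write_arr, if_true, hv.2.2.2.1.symm, if_false,
        height]
      exact ⟨Function.update_self .., stack.frame fun i hi => Function.update_of_ne (by omega) _ _⟩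
    · simp only [ArrayState.set_arr, ArrayState.write_arr, if_true, if_neg hv.2.2.2.1, hm]
      intro e he
      rcases used e he with h | h | h <;> tauto
    · exact sub
    · simp only [ArrayState.set_arr, ArrayState.write_arr, if_true, if_neg hv.2.2.2.1, hm]
      intro u hu
      rcases hu with h | h
      · simp [h]
      · rcases closed u h with h | h
        · exact Or.inl (List.mem_cons_of_mem _ h)
        · exact Or.inr h
    · simp only [ArrayState.set_arr, ArrayState.write_arr, if_true, if_neg hv.2.2.2.1, hm]
      rintro u (rfl | h)
      · exact hr
      · exact sound u h
    · simp only [ArrayState.set_arr, ArrayState.write_arr, if_true, if_neg hv.2.2.2.1, hm]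
      intro u hu
      rcases List.mem_cons.1 hu with h | h
      · exact Or.inl h
      · exact Or.inr (marked u h)
  · refine ⟨h0, fun u hu => hu, st, by omega, ?_, ?_, ?_, arr, linked, stack, ?_, sub, closed, sound,
      marked⟩
    · intro r hr
      rw [ArrayState.set_reg, if_neg (by omega), reg r hr]
    · simp [ArrayState.set_reg, height]
    · simp [ArrayState.set_reg, cell]
    · intro e he
      rcases used e he with h | h | h
      · right; rw [h]; exact h0
      · exact Or.inl h
      · exact Or.inr h

/-- The potential is twice the number of unused edges plus the height of the stack: popping lowers
it by one, and using an edge lowers it by two and raises it by at most one. -/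
theorem searchStep_wp (hhv : h = 1 ∧ v = 3 ∨ h = 2 ∧ v = 4) (hX : B + 8 * X + 8 ≤ W)
    (hG : ∀ e ∈ G, e.1 ≤ X ∧ e.2 ≤ X) (hc : c ≤ X) (h3 : 3 ≤ X)
    (hσ : SearchState h v ρ α c G g st σ) (hst : st ≠ []) (hk : 2 * g.length + st.length ≤ X) :
    (searchStep h v).wp W B inp (fun σ' => (∀ u, σ.arr v u ≠ 0 → σ'.arr v u ≠ 0) ∧ ∃ g' st',
      2 * g'.length + st'.length < 2 * g.length + st.length ∧
        SearchState h v ρ α c G g' st' σ') σ := by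
  have hv : v ≠ h ∧ v ≠ 5 ∧ v ≠ 6 ∧ v ≠ 7 ∧ v < 8 := by omega
  have hh : h ≠ 5 ∧ h ≠ 6 ∧ h ≠ 7 ∧ h < 8 := by omega
  rcases st with _ | ⟨u, st⟩
  · exact absurd rfl hst
  have hu : σ.arr 7 (σ.reg 1 - 1) = u := by
    rw [hσ.height]; exact hσ.stack.1
  have hur := hσ.sound u (hσ.marked u (by simp))
  have huX : u ≤ X := by
    rcases hur.cases_tail with h | ⟨b, -, h⟩
    · omega
    · exact (hG _ h).2
  have hlen := hσ.height
  simp only [List.length_cons] at hlen hk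
  simp only [searchStep, Cmd.wp, ArrayState.set_reg, ArrayState.set_arr, if_true,
    Nat.reduceEqDiff, if_false, OfNat.one_ne_ofNat, hu]
  refine ⟨by omega, by norm_num, by omega, hh.2.2.2, by omega, by omega, fun h0 => ?_,
    fun h0 => ?_⟩
  · have hnil : adj g u = [] := by
      have := hσ.linked u
      rcases e : adj g u with _ | ⟨w, l⟩
      · rfl
      · rw [e] at this; exact absurd h0 this.1
    refine ⟨by omega, fun _ h => h, g, st, by simp, ?_, ?_, ?_, hσ.arr, hσ.linked, hσ.stack.2, hσ.used,
      hσ.sub, ?_, hσ.sound, fun w hw => hσ.marked w (List.mem_cons_of_mem _ hw)⟩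
    · intro r hr
      simp only [ArrayState.set_reg, if_neg (show r ≠ 1 by omega), if_neg (show r ≠ 2 by omega),
        if_neg (show r ≠ 4 by omega)]
      exact hσ.reg r hr
    · simp [ArrayState.set_reg, hlen]
    · simp [ArrayState.set_reg, hσ.cell]
    · intro w hw
      rcases hσ.closed w hw with h | h
      · rcases List.mem_cons.1 h with rfl | h
        · exact Or.inr hnil
        · exact Or.inl h
      · exact Or.inr h
  · obtain ⟨w, l, hwl⟩ : ∃ w l, adj g u = w :: l := by
      rcases e : adj g u with _ | ⟨w, l⟩
      · have := hσ.linked u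
        rw [e] at this; exact absurd this h0
      · exact ⟨w, l, rfl⟩
    obtain ⟨g', hg', hadj, hadj', hmem⟩ := exists_removeEdge hwl
    have hL := hσ.linked u
    rw [hwl] at hL
    obtain ⟨-, hL₁, hL₂, hL₃⟩ := hL
    have huw : (u, w) ∈ G := hσ.sub _ ((hmem _).2 (Or.inl rfl))
    simp only [ArrayState.write_reg, ArrayState.set_reg, ArrayState.set_arr, ArrayState.write_arr,
      if_true, Nat.reduceEqDiff, if_false, hh.1.symm, hL₂]
    refine ⟨by norm_num, by omega, hh.2.2.2, by omega, by norm_num, by omega, ?_⟩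
    refine Cmd.wp_mono ?_ (push_wp (h := h) (X := X) (ρ := ρ) (α := α) (c := c) (G := G) (g := g')
      (st := u :: st) hhv hX ?_ ?_ ?_ ?_ ?_ ?_ ?_ ?_ ?_ ?_ ?_ ?_ ?_ ?_)
    · rintro σ' ⟨-, hm, st', hst', hs⟩
      refine ⟨fun x hx => hm x ?_, g', st', ?_, hs⟩
      · simpa only [ArrayState.set_arr, ArrayState.write_arr, if_neg hv.1] using hx
      · simp only [List.length_cons] at hst' ⊢; omega
    · intro r hr
      simp only [ArrayState.set_reg, ArrayState.write_reg, if_neg (show r ≠ 3 by omega),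
        if_neg (show r ≠ 5 by omega), if_neg (show r ≠ 2 by omega),
        if_neg (show r ≠ 4 by omega)]
      exact hσ.reg r hr
    · simp [ArrayState.set_reg, ArrayState.write_reg, hlen]
    · simp [ArrayState.set_reg, ArrayState.write_reg, hσ.cell]
    · intro j h₁ h₂ h₃
      simp only [ArrayState.set_arr, ArrayState.write_arr, if_neg h₁]
      exact hσ.arr j h₁ h₂ h₃
    · intro x
      simp only [ArrayState.set_arr, ArrayState.write_arr, hh.1.symm, hh.2.1.symm, if_false,
        if_true]
      by_cases e : x = u
      · subst e
        rw [Function.update_self, hadj]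
        exact hL₃
      · rw [Function.update_of_ne e, hadj' x e]
        exact hσ.linked x
    · simp only [ArrayState.set_arr, ArrayState.write_arr, hh.2.2.1.symm, if_false]
      exact hσ.stack
    · simp only [ArrayState.set_arr, ArrayState.write_arr, ArrayState.set_reg, if_true,
        if_neg hv.1]
      intro e he
      rcases hσ.used e he with h | h
      · rcases (hmem e).1 h with rfl | h
        · exact Or.inl rfl
        · exact Or.inr (Or.inl h)
      · exact Or.inr (Or.inr h)
    · exact fun e he => hσ.sub e ((hmem e).2 (Or.inr he))
    · simp only [ArrayState.set_arr, ArrayState.write_arr, if_neg hv.1]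
      intro x hx
      rcases hσ.closed x hx with h | h
      · exact Or.inl h
      · by_cases e : x = u
        · subst e; simp
        · rw [hadj' x e]; exact Or.inr h
    · simpa only [ArrayState.set_arr, ArrayState.write_arr, if_neg hv.1] using hσ.sound
    · simpa only [ArrayState.set_arr, ArrayState.write_arr, if_neg hv.1] using hσ.marked
    · simp only [List.length_cons]; omega
    · simp only [ArrayState.set_reg, if_true]; exact (hG _ huw).2
    · simp only [ArrayState.set_reg, if_true]; exact hur.tail huw

/-- The potential gives a number of steps linear in the edges. Once the stack is empty, no marked
node has an unused edge and every used edge has a marked head, so the marked set is closed under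
edges. -/
theorem search_halts (hhv : h = 1 ∧ v = 3 ∨ h = 2 ∧ v = 4) (hX : B + 8 * X + 8 ≤ W)
    (hG : ∀ e ∈ G, e.1 ≤ X ∧ e.2 ≤ X) (hc : c₀ + G.length ≤ X) (h3 : 3 ≤ X)
    (hk : 2 * G.length + 1 ≤ X) (hσ : GraphState h ρ α c₀ G σ) (h14 : ρ 14 = 0)
    (hv0 : ∀ u, α v u = 0) :
    Halts W B inp (search h v) σ
      ((2 * G.length + 1) * ((searchStep h v).cost + 1) + 1 + (Cmd.seq (.set 3 3) (push v)).cost)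
      fun σ' => (∀ r, 10 ≤ r → σ'.reg r = ρ r) ∧ σ'.reg 1 = 0 ∧ σ'.reg 0 = c₀ + G.length ∧
        (∀ j, j ≠ h → j ≠ v → j ≠ 5 → j ≠ 6 → j ≠ 7 → σ'.arr j = α j) ∧
        ∀ u, σ'.arr v u ≠ 0 ↔ Relation.ReflTransGen (fun a b => (a, b) ∈ G) 3 u := by
  have hσv : ∀ u, σ.arr v u = 0 := fun u => by
    rw [hσ.arr v (by omega) (by omega) (by omega), hv0]
  -- `SearchState` is compatible with nothing being marked, so the mark of the root `3` is carried
  -- along separately.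
  let Inv : ℕ → ArrayState → Prop := fun k σ' => σ'.arr v 3 ≠ 0 ∧ ∃ g st,
    2 * g.length + st.length = k ∧ k ≤ X ∧ SearchState h v ρ σ.arr (c₀ + G.length) G g st σ'
  have hinit : Halts W B inp (Cmd.seq (.set 3 3) (push v)).compile σ
      (Cmd.seq (.set 3 3) (push v)).cost fun σ' => ∃ k ≤ 2 * G.length + 1, Inv k σ' := by
    refine Halts.of_wp ⟨by omega, ?_⟩
    refine Cmd.wp_mono ?_ (push_wp (h := h) (X := X) (ρ := ρ) (α := σ.arr) (c := c₀ + G.length)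
      (G := G) (g := G) (st := []) hhv hX ?_ ?_ ?_ ?_ ?_ ?_ ?_ ?_ ?_ ?_ ?_ ?_ ?_ ?_)
    · rintro σ' ⟨h₁, -, st', hst', hs⟩
      simp only [List.length_nil] at hst'
      exact ⟨2 * G.length + st'.length, by omega, by simpa [ArrayState.set_reg] using h₁, G, st',
        rfl, by omega, hs⟩
    · intro r hr
      rw [ArrayState.set_reg, if_neg (by omega), hσ.reg r hr]
    · simp [ArrayState.set_reg, hσ.stack]
    · simp [ArrayState.set_reg, hσ.cell]
    · exact fun j _ _ _ => rfl
    · simpa only [ArrayState.set_arr, hσ.cell] using hσ.linked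
    · trivial
    · exact fun e he => Or.inr (Or.inl he)
    · exact fun e he => he
    · exact fun u hu => absurd (hσv u) hu
    · exact fun u hu => absurd (hσv u) hu
    · simp
    · simp; omega
    · simp [ArrayState.set_reg]; omega
    · simp only [ArrayState.set_reg, if_true]; exact .refl
  have hloop := Halts.while (W := W) (B := B) (inp := inp) (x := 14) (y := 1)
    (T := (searchStep h v).cost) (P := (searchStep h v).compile) Inv (by
      rintro k σ' ⟨hr, g, st, rfl, hkX, hs⟩ hlt
      refine Halts.of_wp (Cmd.wp_mono ?_ (searchStep_wp hhv hX hG hc h3 hs ?_ hkX))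
      · rintro σ'' ⟨hm, g', st', hlt', hs'⟩
        exact ⟨_, hlt', hm _ hr, g', st', rfl, by omega, hs'⟩
      · rintro rfl
        have := hs.height
        simp at this
        omega)
  refine (Halts.seq hinit (T₂ := (2 * G.length + 1) * ((searchStep h v).cost + 1) + 1)
    (Q' := fun σ' => σ'.reg 1 ≤ 0 ∧ ∃ k, Inv k σ') ?_).mono (by omega) ?_
  · rintro σ' ⟨k, hk', hI⟩
    refine (hloop k σ' hI).mono ?_ ?_
    · exact Nat.add_le_add_right (Nat.mul_le_mul_right _ hk') _
    · rintro σ'' ⟨hnl, k', -, hI'⟩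
      obtain ⟨_, g, st, -, -, hs⟩ := id hI'
      rw [hs.reg 14 (by norm_num), h14] at hnl
      exact ⟨by omega, k', hI'⟩
  · rintro σ' ⟨h1, k, hr, g, st, -, -, hs⟩
    have hnil : st = [] := by
      have := hs.height
      exact List.length_eq_zero_iff.1 (by omega)
    subst hnil
    refine ⟨hs.reg, by omega, hs.cell, fun j h₁ h₂ h₃ h₄ h₅ => ?_, fun u => ⟨hs.sound u, fun hu => ?_⟩⟩
    · rw [hs.arr j h₁ h₂ h₅, hσ.arr j h₁ h₃ h₄]
    · induction hu with
      | refl => exact hr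
      | @tail a b _ hab ih =>
        rcases hs.used _ hab with h | h
        · rcases hs.closed a ih with h' | h'
          · simp at h'
          · exact absurd h (adj_eq_nil h' b)
        · exact h

end GraphSearch

/-! ### The decision program and the effects of its loops. -/

section Algorithm

variable {W B : ℕ} {inp : ℕ → ℕ} {h c₀ n m X : ℕ} {ρ : ℕ → ℕ} {α : ℕ → ℕ → ℕ}

/-! ### Commands that add edges -/

/-- The command `c` adds the edges `L` to the graph. -/
def Adds (W B : ℕ) (inp : ℕ → ℕ) (X h c₀ : ℕ) (ρ : ℕ → ℕ) (α : ℕ → ℕ → ℕ) (c : Cmd)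
    (L : List (ℕ × ℕ)) : Prop :=
  ∀ g σ, GraphState h ρ α c₀ g σ → c₀ + g.length + L.length ≤ X →
    c.wp W B inp (GraphState h ρ α c₀ (L ++ g)) σ

theorem Adds.skip : Adds W B inp X h c₀ ρ α .skip [] := fun _ _ hσ _ => hσ

/-- Edges are consed to the front, so later commands appear first; this explains the order of the
lists in `reachEdges` and `divergeEdges`. -/
theorem Adds.seq {c c' : Cmd} {L L' : List (ℕ × ℕ)} (h₁ : Adds W B inp X h c₀ ρ α c L)
    (h₂ : Adds W B inp X h c₀ ρ α c' L') : Adds W B inp X h c₀ ρ α (.seq c c') (L' ++ L) := by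
  intro g σ hσ hl
  rw [List.length_append] at hl
  refine Cmd.wp_seq (h₁ g σ hσ (by omega)) fun σ' hσ' => ?_
  rw [List.append_assoc]
  exact h₂ _ σ' hσ' (by rw [List.length_append]; omega)

theorem Adds.ifEq {c c' : Cmd} {L L' : List (ℕ × ℕ)} {x y : ℕ} (hx : 10 ≤ x) (hy : 10 ≤ y)
    (h₁ : Adds W B inp X h c₀ ρ α c L) (h₂ : Adds W B inp X h c₀ ρ α c' L') :
    Adds W B inp X h c₀ ρ α (.ifEq x y c c') (if ρ x = ρ y then L else L') := by
  intro g σ hσ hl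
  have ex := hσ.reg x hx
  have ey := hσ.reg y hy
  refine ⟨fun e => ?_, fun e => ?_⟩ <;> rw [ex, ey] at e
  · rw [if_pos e] at hl ⊢; exact h₁ g σ hσ hl
  · rw [if_neg e] at hl ⊢; exact h₂ g σ hσ hl

theorem Adds.ifZero {c c' : Cmd} {L L' : List (ℕ × ℕ)} {x : ℕ} (hx : 10 ≤ x)
    (h₁ : Adds W B inp X h c₀ ρ α c L) (h₂ : Adds W B inp X h c₀ ρ α c' L') :
    Adds W B inp X h c₀ ρ α (.ifEqc x 0 c c') (if ρ x = 0 then L else L') := by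
  intro g σ hσ hl
  have ex := hσ.reg x hx
  refine ⟨Nat.zero_le _, fun e => ?_, fun e => ?_⟩ <;> rw [ex] at e
  · rw [if_pos e] at hl ⊢; exact h₁ g σ hσ hl
  · rw [if_neg e] at hl ⊢; exact h₂ g σ hσ hl

/-- Size conditions under which pairs of states below `n` have addresses. -/
structure Fits (W B X n : ℕ) (row : ℕ → ℕ) : Prop where
  space : B + 8 * X + 8 ≤ W
  row : ∀ p, 4 * (row p + n) + 8 ≤ X

theorem Fits.node_le {row : ℕ → ℕ} (hF : Fits W B X n row) {f q : ℕ} (p : ℕ) (hf : f < 4)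
    (hq : q < n) : node row f p q ≤ X := by
  have := hF.row p
  unfold node
  omega

theorem Adds.pairEdge {f p q f' p' q' : ℕ} (hF : Fits W B X n (α 0)) (hh : h = 1 ∨ h = 2)
    (hc : 1 ≤ c₀) (hf : f < 4) (hf' : f' < 4) (hp : 10 ≤ p) (hq : 10 ≤ q) (hp' : 10 ≤ p')
    (hq' : 10 ≤ q') (np : ρ p < n) (nq : ρ q < n) (np' : ρ p' < n) (nq' : ρ q' < n) :
    Adds W B inp X h c₀ ρ α (Ambiguity.pairEdge h f p q f' p' q')
      [(node (α 0) f (ρ p) (ρ q), node (α 0) f' (ρ p') (ρ q'))] := by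
  intro g σ hσ hl
  have := hF.row 0
  rw [List.length_singleton] at hl
  exact pairEdge_wp (g := g) hh hc hσ hF.space (by omega) hp hq hp' hq' (by omega) (by omega)
    (hF.node_le _ hf nq) (hF.node_le _ hf' nq')

theorem Adds.rootEdge {f p q : ℕ} (hF : Fits W B X n (α 0)) (hh : h = 1 ∨ h = 2)
    (hc : 1 ≤ c₀) (hf : f < 4) (hp : 10 ≤ p) (hq : 10 ≤ q) (np : ρ p < n) (nq : ρ q < n) :
    Adds W B inp X h c₀ ρ α (Ambiguity.rootEdge h f p q) [(3, node (α 0) f (ρ p) (ρ q))] := by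
  intro g σ hσ hl
  have := hF.row 0
  rw [List.length_singleton] at hl
  exact rootEdge_wp (g := g) hh hc hσ hF.space (by omega) hp hq (by omega) (hF.node_le _ hf nq) (by omega)

/-- Executes `c` if the first search has marked the pair in registers `p`, `q`. -/
def ifMarked (p q : ℕ) (c : Cmd) : Cmd :=
  .seq (mkNode 2 0 p q) (.seq (.get 3 5 2) (.ifEqc 5 0 .skip c))

theorem Adds.ifMarked {c : Cmd} {L : List (ℕ × ℕ)} {p q : ℕ} (hF : Fits W B X n (α 0))
    (hp : 10 ≤ p) (hq : 10 ≤ q) (np : ρ p < n) (nq : ρ q < n)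
    (hc : Adds W B inp X 2 c₀ ρ α c L) :
    Adds W B inp X 2 c₀ ρ α (Ambiguity.ifMarked p q c)
      (if α 3 (node (α 0) 0 (ρ p) (ρ q)) = 0 then [] else L) := by
  intro g σ hσ hl
  have hrow := hσ.arr 0 (by omega) (by norm_num) (by norm_num)
  have hvis := hσ.arr 3 (by omega) (by norm_num) (by norm_num)
  have ep := hσ.reg p hp
  have eq := hσ.reg q hq
  have hnode := hF.node_le (ρ p) (f := 0) (by norm_num) nq
  have hs := hF.space
  have := hF.row 0
  refine mkNode_wp (by omega) (by omega) (by rw [hrow, ep, eq]; omega) ?_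
  rw [hrow, ep, eq]
  have hσ' : ∀ u v, GraphState 2 ρ α c₀ g ((σ.set 2 u).set 5 v) := fun u v =>
    (hσ.set_temp (by norm_num) (by norm_num) u).set_temp (by norm_num) (by norm_num) v
  simp only [Cmd.wp, ArrayState.set_reg, ArrayState.set_arr, if_true, hvis]
  refine ⟨by norm_num, by omega, by omega, fun e => ?_, fun e => ?_⟩
  · rw [if_pos e]; exact hσ' _ _
  · rw [if_neg e] at hl ⊢; exact hc _ _ (hσ' _ _) hl

/-! ### The program -/

/-- Loads the transition at the address in register `p` into registers `r`, `r + 1`, `r + 2`. -/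
def loadTransition (r p : ℕ) : Cmd :=
  .seq (.inp r p) (.seq (.addc 2 p 1) (.seq (.inp (r + 1) 2) (.seq (.addc 2 p 2) (.inp (r + 2) 2))))

/-- Executes `c` for all pairs of transitions. -/
def forPairs (c : Cmd) : Program :=
  scan 10 12 (.seq (loadTransition 15 10).compile
    (scan 11 12 (Cmd.seq (loadTransition 18 11) c).compile))

/-- Row offsets. -/
def rowCode : Cmd := .seq (.inp 15 10) (.seq (.put 0 15 21) (.add 21 21 13))

/-- Edges of the backward reachability graph of the automaton. -/
def reachCode : Cmd := .seq (pairEdge 1 0 18 17 0 18 15) (rootEdge 1 0 18 18)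

/-- Edges of the graph of diverged pairs. -/
def divergeCode : Cmd :=
  ifMarked 15 17 (ifMarked 18 20
    (.seq (.ifEq 16 19
      (.seq (.ifEq 15 18 (.ifEq 17 20 .skip (rootEdge 2 2 17 20)) .skip)
        (.ifEqc 16 0 .skip (.seq (pairEdge 2 1 15 18 2 17 20) (pairEdge 2 2 15 18 2 17 20))))
      .skip)
    (.seq (.ifEqc 16 0
      (.seq (.seq (pairEdge 2 1 15 18 1 17 18) (pairEdge 2 2 15 18 2 17 18))
        (.ifEq 15 18 (.ifEqc 19 0 .skip (rootEdge 2 1 17 18)) .skip)) .skip)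
      (.ifEqc 19 0 (pairEdge 2 2 15 18 2 15 20) .skip))))

/-- Sets the result if a diagonal pair is marked. -/
def resultCode : Cmd :=
  .seq (.inp 15 10) (.seq (mkNode 2 2 15 15) (.seq (.get 4 3 2) (.ifEqc 3 0 .skip (.set 22 1))))

def mainCode : Program :=
  .seq (scan 10 12 rowCode.compile) (.seq (forPairs reachCode) (.seq (search 1 3)
    (.seq (forPairs divergeCode) (.seq (search 2 4) (scan 10 12 resultCode.compile)))))

/-- Edges added by `reachCode`. -/
def reachEdges (row : ℕ → ℕ) (t t' : ℕ × ℕ × ℕ) : List (ℕ × ℕ) :=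
  [(3, node row 0 t'.1 t'.1), (node row 0 t'.1 t.2.2, node row 0 t'.1 t.1)]

/-- Edges added by `divergeCode`. -/
def divergeEdges (row vis : ℕ → ℕ) (t t' : ℕ × ℕ × ℕ) : List (ℕ × ℕ) :=
  if vis (node row 0 t.1 t.2.2) = 0 then [] else
  if vis (node row 0 t'.1 t'.2.2) = 0 then [] else
    ((if t'.2.1 = 0 then [(node row 2 t.1 t'.1, node row 2 t.1 t'.2.2)] else []) ++
      (if t.2.1 = 0 then
        (if t.1 = t'.1 then if t'.2.1 = 0 then [] else [(3, node row 1 t.2.2 t'.1)] else []) ++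
          ([(node row 2 t.1 t'.1, node row 2 t.2.2 t'.1)] ++
            [(node row 1 t.1 t'.1, node row 1 t.2.2 t'.1)]) else [])) ++
    if t.2.1 = t'.2.1 then
      (if t.2.1 = 0 then [] else [(node row 2 t.1 t'.1, node row 2 t.2.2 t'.2.2)] ++
        [(node row 1 t.1 t'.1, node row 2 t.2.2 t'.2.2)]) ++
      if t.1 = t'.1 then if t.2.2 = t'.2.2 then [] else [(3, node row 2 t.2.2 t'.2.2)] else []
    else []

theorem length_divergeEdges_le (row vis : ℕ → ℕ) (t t' : ℕ × ℕ × ℕ) :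
    (divergeEdges row vis t t').length ≤ 8 := by
  unfold divergeEdges
  split_ifs <;> simp

/-- Registers `r`, `r + 1`, `r + 2` hold the transition `t`. -/
def Holds (ρ : ℕ → ℕ) (r : ℕ) (t : ℕ × ℕ × ℕ) : Prop :=
  ρ r = t.1 ∧ ρ (r + 1) = t.2.1 ∧ ρ (r + 2) = t.2.2

theorem reachCode_adds (hF : Fits W B X n (α 0)) (hc : 1 ≤ c₀) {t t' : ℕ × ℕ × ℕ}
    (ht : Holds ρ 15 t) (ht' : Holds ρ 18 t') (h₁ : t.1 < n) (h₂ : t.2.2 < n) (h₁' : t'.1 < n) :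
    Adds W B inp X 1 c₀ ρ α reachCode (reachEdges (α 0) t t') := by
  obtain ⟨rfl, rfl, rfl⟩ : t = (ρ 15, ρ 16, ρ 17) :=
    Prod.ext ht.1.symm (Prod.ext ht.2.1.symm ht.2.2.symm)
  obtain ⟨rfl, rfl, rfl⟩ : t' = (ρ 18, ρ 19, ρ 20) :=
    Prod.ext ht'.1.symm (Prod.ext ht'.2.1.symm ht'.2.2.symm)
  exact (Adds.pairEdge hF (by norm_num) hc (by norm_num) (by norm_num) (by norm_num)
    (by norm_num) (by norm_num) (by norm_num) h₁' h₂ h₁' h₁).seq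
    (Adds.rootEdge hF (by norm_num) hc (by norm_num) (by norm_num) (by norm_num) h₁' h₁')

theorem divergeCode_adds (hF : Fits W B X n (α 0)) (hc : 1 ≤ c₀) {t t' : ℕ × ℕ × ℕ}
    (ht : Holds ρ 15 t) (ht' : Holds ρ 18 t') (h₁ : t.1 < n) (h₂ : t.2.2 < n) (h₁' : t'.1 < n)
    (h₂' : t'.2.2 < n) :
    Adds W B inp X 2 c₀ ρ α divergeCode (divergeEdges (α 0) (α 3) t t') := by
  obtain ⟨rfl, rfl, rfl⟩ : t = (ρ 15, ρ 16, ρ 17) :=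
    Prod.ext ht.1.symm (Prod.ext ht.2.1.symm ht.2.2.symm)
  obtain ⟨rfl, rfl, rfl⟩ : t' = (ρ 18, ρ 19, ρ 20) :=
    Prod.ext ht'.1.symm (Prod.ext ht'.2.1.symm ht'.2.2.symm)
  have E : ∀ {f p q f' p' q' : ℕ}, f < 4 → f' < 4 → 10 ≤ p → 10 ≤ q → 10 ≤ p' → 10 ≤ q' →
      ρ p < n → ρ q < n → ρ p' < n → ρ q' < n → Adds W B inp X 2 c₀ ρ α
        (pairEdge 2 f p q f' p' q')
        [(node (α 0) f (ρ p) (ρ q), node (α 0) f' (ρ p') (ρ q'))] :=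
    fun hf hf' => Adds.pairEdge hF (Or.inr rfl) hc hf hf'
  have R : ∀ {f p q : ℕ}, f < 4 → 10 ≤ p → 10 ≤ q → ρ p < n → ρ q < n →
      Adds W B inp X 2 c₀ ρ α (rootEdge 2 f p q) [(3, node (α 0) f (ρ p) (ρ q))] :=
    fun hf => Adds.rootEdge hF (Or.inr rfl) hc hf
  refine Adds.ifMarked hF (by norm_num) (by norm_num) h₁ h₂
    (Adds.ifMarked hF (by norm_num) (by norm_num) h₁' h₂' (Adds.seq ?_ (Adds.seq ?_ ?_)))
  · refine Adds.ifEq (by norm_num) (by norm_num) (Adds.seq ?_ ?_) .skip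
    · refine Adds.ifEq (by norm_num) (by norm_num) ?_ .skip
      exact Adds.ifEq (by norm_num) (by norm_num) .skip
        (R (by norm_num) (by norm_num) (by norm_num) h₂ h₂')
    · refine Adds.ifZero (by norm_num) .skip (Adds.seq ?_ ?_)
      · exact E (by norm_num) (by norm_num) (by norm_num) (by norm_num) (by norm_num)
          (by norm_num) h₁ h₁' h₂ h₂'
      · exact E (by norm_num) (by norm_num) (by norm_num) (by norm_num) (by norm_num)
          (by norm_num) h₁ h₁' h₂ h₂'
  · refine Adds.ifZero (by norm_num) (Adds.seq (Adds.seq ?_ ?_) ?_) .skip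
    · exact E (by norm_num) (by norm_num) (by norm_num) (by norm_num) (by norm_num)
        (by norm_num) h₁ h₁' h₂ h₁'
    · exact E (by norm_num) (by norm_num) (by norm_num) (by norm_num) (by norm_num)
        (by norm_num) h₁ h₁' h₂ h₁'
    · refine Adds.ifEq (by norm_num) (by norm_num) ?_ .skip
      exact Adds.ifZero (by norm_num) .skip
        (R (by norm_num) (by norm_num) (by norm_num) h₂ h₁')
  · exact Adds.ifZero (by norm_num) (E (by norm_num) (by norm_num) (by norm_num) (by norm_num)
      (by norm_num) (by norm_num) h₁ h₁' h₁ h₂') .skip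

/-! ### Loops over transitions -/

/-- The input contains the transitions `tr 0, …, tr (m - 1)` from address `5` on. -/
structure InputIs (B : ℕ) (inp : ℕ → ℕ) (n m : ℕ) (tr : ℕ → ℕ × ℕ × ℕ) : Prop where
  length : 5 + 3 * m ≤ B
  source : ∀ i < m, inp (5 + 3 * i) = (tr i).1
  letter : ∀ i < m, inp (5 + 3 * i + 1) = (tr i).2.1
  target : ∀ i < m, inp (5 + 3 * i + 2) = (tr i).2.2
  source_lt : ∀ i < m, (tr i).1 < n
  target_lt : ∀ i < m, (tr i).2.2 < n

variable {tr : ℕ → ℕ × ℕ × ℕ} {g : List (ℕ × ℕ)} {σ : ArrayState}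

theorem GraphState.set_user (hσ : GraphState h ρ α c₀ g σ) {x : ℕ} (hx : 10 ≤ x) (w : ℕ) :
    GraphState h (Function.update ρ x w) α c₀ g (σ.set x w) := by
  obtain ⟨h₁, h₂, h₃, h₄, h₅⟩ := hσ
  refine ⟨fun r hr => ?_, ?_, ?_, h₄, ?_⟩
  · rw [ArrayState.set_reg, Function.update_apply, h₁ r hr]
  · rw [ArrayState.set_reg, if_neg (by omega), h₂]
  · rw [ArrayState.set_reg, if_neg (by omega), h₃]
  · rw [ArrayState.set_reg, if_neg (by omega)]; exact h₅

theorem loadTransition_wp (hI : InputIs B inp n m tr) (hW : B ≤ W) {i r p : ℕ} (hi : i < m)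
    (hσ : GraphState h ρ α c₀ g σ) (hr : 10 ≤ r) (hp : 10 ≤ p) (hpr : p < r)
    (hρ : ρ p = 5 + 3 * i) :
    (loadTransition r p).wp W B inp (fun σ' => ∃ ρ', GraphState h ρ' α c₀ g σ' ∧
      Holds ρ' r (tr i) ∧ ∀ x, x < r ∨ r + 3 ≤ x → ρ' x = ρ x) σ := by
  have hreg := (hσ.reg p hp).trans hρ
  have hl := hI.length
  simp only [loadTransition, Cmd.wp, ArrayState.set_reg, if_true, hreg,
    if_neg (show p ≠ r by omega), if_neg (show p ≠ 2 by omega), if_neg (show p ≠ r + 1 by omega),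
    hI.source i hi, hI.letter i hi, hI.target i hi]
  refine ⟨by omega, by omega, by omega, by omega, by omega, _, ((((hσ.set_user hr _).set_temp le_rfl
    (by norm_num) _).set_user (by omega) _).set_temp le_rfl (by norm_num) _).set_user (by omega) _,
    ⟨?_, ?_, ?_⟩, fun x hx => ?_⟩
  · simp
  · simp
  · simp
  · rw [Function.update_of_ne (by omega), Function.update_of_ne (by omega),
      Function.update_of_ne (by omega)]

/-- The nested scans overwrite the loop registers 10 and 11 and the transition registers 15 to 20,
hence the existential `ρ'`. Each pair adds at most eight edges, so the cells stay within `X`. -/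
theorem forPairs_halts (hI : InputIs B inp n m tr) (hW : B ≤ W) {c : Cmd}
    {es : ℕ × ℕ × ℕ → ℕ × ℕ × ℕ → List (ℕ × ℕ)} (hes : ∀ t t', (es t t').length ≤ 8)
    (hX : c₀ + 8 * (m * m) ≤ X) (hσ : GraphState h ρ α c₀ [] σ) (h12 : ρ 12 = 5 + 3 * m)
    (hc : ∀ ρ', ∀ i < m, ∀ j < m, Holds ρ' 15 (tr i) → Holds ρ' 18 (tr j) →
      Adds W B inp X h c₀ ρ' α c (es (tr i) (tr j))) :
    Halts W B inp (forPairs c) σ (m * (35 + (m * (35 + c.cost + 8) + 8) + 8) + 8) fun σ' =>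
      ∃ ρ' g, GraphState h ρ' α c₀ g σ' ∧ (∀ r, r = 12 ∨ r = 13 ∨ r = 14 ∨ 21 ≤ r → ρ' r = ρ r) ∧
        g.length ≤ 8 * (m * m) ∧ ∀ e, e ∈ g ↔ ∃ i < m, ∃ j < m, e ∈ es (tr i) (tr j) := by
  have hl := hI.length
  let Keep : (ℕ → ℕ) → Prop := fun ρ' => ∀ r, r = 12 ∨ r = 13 ∨ r = 14 ∨ 21 ≤ r → ρ' r = ρ r
  let Outer : ℕ → ArrayState → Prop := fun i σ => ∃ ρ' g, GraphState h ρ' α c₀ g σ ∧ Keep ρ' ∧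
    g.length ≤ 8 * (i * m) ∧ ∀ e, e ∈ g ↔ ∃ i' < i, ∃ j < m, e ∈ es (tr i') (tr j)
  let Inner : ℕ → ℕ → ArrayState → Prop := fun i j σ => ∃ ρ' g, GraphState h ρ' α c₀ g σ ∧
    Keep ρ' ∧ ρ' 10 = 5 + 3 * i ∧ Holds ρ' 15 (tr i) ∧ g.length ≤ 8 * (i * m + j) ∧
    ∀ e, e ∈ g ↔ (∃ i' < i, ∃ j < m, e ∈ es (tr i') (tr j)) ∨ ∃ j' < j, e ∈ es (tr i) (tr j')
  have keep_update : ∀ ρ' x w, Keep ρ' → x < 12 → Keep (Function.update ρ' x w) := by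
    intro ρ' x w hk hx r hr
    rw [Function.update_of_ne (by omega), hk r hr]
  have hinner : ∀ i < m, ∀ σ, Inner i 0 σ → Halts W B inp
      (scan 11 12 (Cmd.seq (loadTransition 18 11) c).compile) σ (m * (35 + c.cost + 8) + 8)
      (Inner i m) := by
    intro i hi σ hσ
    refine Halts.scan (Inner i) (by omega) ?_ ?_ ?_ hσ
    · rintro j σ w ⟨ρ', g, hg, hk, h10, h15, hlen, hmem⟩
      refine ⟨_, g, hg.set_user (by norm_num) w, keep_update _ _ _ hk (by norm_num), ?_, ?_, hlen,
        hmem⟩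
      · rw [Function.update_of_ne (by norm_num), h10]
      · simpa [Holds] using h15
    · rintro j σ ⟨ρ', g, hg, hk, -⟩
      rw [hg.reg 12 (by norm_num), hk 12 (by norm_num), h12]
    · rintro j hj σ ⟨ρ', g, hg, hk, h10, h15, hlen, hmem⟩ h11
      refine Halts.of_wp (c := .seq (loadTransition 18 11) c) (Cmd.wp_seq
        (loadTransition_wp hI hW hj hg (by norm_num) (by norm_num) (by norm_num)
          (by rw [← hg.reg 11 (by norm_num), h11])) ?_)
      rintro σ' ⟨ρ'', hg', h18, hk'⟩
      have h15' : Holds ρ'' 15 (tr i) := by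
        simpa [Holds, hk' 15, hk' 16, hk' 17] using h15
      have hle := hes (tr i) (tr j)
      have hmul : i * m + m ≤ m * m := by
        rw [← Nat.succ_mul]; exact Nat.mul_le_mul_right _ hi
      refine Cmd.wp_mono ?_ (hc ρ'' i hi j hj h15' h18 g σ' hg' (by omega))
      intro σ'' hg''
      refine ⟨⟨ρ'', _, hg'', ?_, ?_, h15', ?_, ?_⟩, ?_⟩
      · intro r hr
        rw [hk' r (by omega), hk r hr]
      · rw [hk' 10 (by norm_num), h10]
      · rw [List.length_append]; omega
      · intro e
        rw [List.mem_append, hmem]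
        constructor
        · rintro (h | h | ⟨j', hj', h⟩)
          · exact Or.inr ⟨j, by omega, h⟩
          · exact Or.inl h
          · exact Or.inr ⟨j', by omega, h⟩
        · rintro (h | ⟨j', hj', h⟩)
          · exact Or.inr (Or.inl h)
          · rcases Nat.lt_succ_iff_lt_or_eq.1 hj' with h' | rfl
            · exact Or.inr (Or.inr ⟨j', h', h⟩)
            · exact Or.inl h
      · rw [hg''.reg 11 (by norm_num), hk' 11 (by norm_num), ← hg.reg 11 (by norm_num), h11]
  refine (Halts.scan Outer (by omega) ?_ ?_ ?_ ?_).mono le_rfl ?_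
  · rintro i σ w ⟨ρ', g, hg, hk, hlen, hmem⟩
    exact ⟨_, g, hg.set_user (by norm_num) w, keep_update _ _ _ hk (by norm_num), hlen, hmem⟩
  · rintro i σ ⟨ρ', g, hg, hk, -⟩
    rw [hg.reg 12 (by norm_num), hk 12 (by norm_num), h12]
  · rintro i hi σ ⟨ρ', g, hg, hk, hlen, hmem⟩ h10
    refine Halts.seq (T₁ := 35) (Q := Inner i 0) (Halts.of_wp (c := loadTransition 15 10)
      (Cmd.wp_mono ?_ (loadTransition_wp hI hW hi hg (by norm_num) (by norm_num) (by norm_num)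
        (by rw [← hg.reg 10 (by norm_num), h10])))) ?_
    · rintro σ' ⟨ρ'', hg', h15, hk'⟩
      refine ⟨ρ'', g, hg', ?_, ?_, h15, by omega, by simpa using hmem⟩
      · intro r hr
        rw [hk' r (by omega), hk r hr]
      · rw [hk' 10 (by norm_num), ← hg.reg 10 (by norm_num), h10]
    · intro σ' hσ'
      refine (hinner i hi σ' hσ').mono le_rfl ?_
      rintro σ'' ⟨ρ'', g', hg', hk', h10', -, hlen', hmem'⟩
      refine ⟨⟨ρ'', g', hg', hk', by rw [Nat.succ_mul i m]; exact hlen', fun e => ?_⟩,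
        ?_⟩
      · rw [hmem']
        constructor
        · rintro (⟨i', hi', h⟩ | h)
          · exact ⟨i', by omega, h⟩
          · exact ⟨i, by omega, h⟩
        · rintro ⟨i', hi', h⟩
          rcases Nat.lt_succ_iff_lt_or_eq.1 hi' with h' | rfl
          · exact Or.inl ⟨i', h', h⟩
          · exact Or.inr h
      · rw [hg'.reg 10 (by norm_num), h10']
  · exact ⟨ρ, [], hσ, fun _ _ => rfl, by simp, by simp⟩
  · rintro σ' ⟨ρ', g, hg, hk, hlen, hmem⟩
    exact ⟨ρ', g, hg, hk, hlen, hmem⟩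

/-- The row offset of each source is a multiple of `n` that determines the source. -/
def IsRow (n m : ℕ) (tr : ℕ → ℕ × ℕ × ℕ) (row : ℕ → ℕ) : Prop :=
  ∀ i < m, ∃ i' < m, (tr i').1 = (tr i).1 ∧ row (tr i).1 = i' * n

/-- Register 21 accumulates `i * n` by addition. A source that occurs several times keeps the offset
of its last occurrence; any choice would do, as long as distinct sources get distinct offsets. -/
theorem rows_halts (hI : InputIs B inp n m tr) (hW : B + 8 * (m * n + n) + 8 ≤ W)
    (h0 : σ.reg 0 = 1) (h1 : σ.reg 1 = 0) (h12 : σ.reg 12 = 5 + 3 * m) (h13 : σ.reg 13 = n)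
    (h14 : σ.reg 14 = 0) (h21 : σ.reg 21 = 0) (h22 : σ.reg 22 = 0)
    (harr : ∀ j u, σ.arr j u = 0) :
    Halts W B inp (scan 10 12 rowCode.compile) σ (m * (21 + 8) + 8) fun σ' => σ'.reg 0 = 1 ∧
      σ'.reg 1 = 0 ∧ σ'.reg 12 = 5 + 3 * m ∧ σ'.reg 14 = 0 ∧ σ'.reg 22 = 0 ∧
      (∀ j, j ≠ 0 → ∀ u, σ'.arr j u = 0) ∧ (∀ p, σ'.arr 0 p ≤ m * n) ∧ IsRow n m tr (σ'.arr 0) := by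
  have hl := hI.length
  let Inv : ℕ → ArrayState → Prop := fun i σ' => (σ'.reg 0 = 1 ∧
      σ'.reg 1 = 0 ∧ σ'.reg 12 = 5 + 3 * m ∧ σ'.reg 13 = n ∧ σ'.reg 14 = 0 ∧ σ'.reg 21 = i * n ∧
      σ'.reg 22 = 0) ∧ (∀ j, j ≠ 0 → ∀ u, σ'.arr j u = 0) ∧ (∀ p, σ'.arr 0 p ≤ m * n) ∧
      ∀ i₁ < i, ∃ i' < i, (tr i').1 = (tr i₁).1 ∧ σ'.arr 0 (tr i₁).1 = i' * n
  refine (Halts.scan Inv (by omega) ?_ ?_ ?_ ?_).mono le_rfl ?_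
  · rintro i σ w ⟨hr, ha⟩
    refine ⟨?_, ha⟩
    simpa [ArrayState.set_reg] using hr
  · rintro i σ ⟨hr, -⟩
    exact hr.2.2.1
  · rintro i hi σ ⟨⟨r0, r1, r12, r13, r14, r21, r22⟩, ha, hb, hc⟩ hx
    have hmul : i * n + n ≤ m * n := by
      rw [← Nat.succ_mul]; exact Nat.mul_le_mul_right _ hi
    have hs := hI.source_lt i hi
    refine Halts.of_wp (c := rowCode) ?_
    simp only [rowCode, Cmd.wp, ArrayState.set_reg, ArrayState.write_reg, if_true, Nat.reduceEqDiff,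
      if_false, hx, hI.source i hi, r13, r21]
    refine ⟨by omega, by norm_num, by omega, by omega, ⟨?_, ?_, ?_, ?_⟩, ?_⟩
    · simp [ArrayState.set_reg, ArrayState.write_reg, r0, r1, r12, r13, r14, r22, Nat.succ_mul]
    · intro j hj u
      simp only [ArrayState.set_arr, ArrayState.write_arr, if_neg hj, ha j hj]
    · intro p
      simp only [ArrayState.set_arr, ArrayState.write_arr, if_true, Function.update_apply]
      split_ifs
      · omega
      · exact hb p
    · intro i₁ hi₁
      simp only [ArrayState.set_arr, ArrayState.write_arr, if_true, Function.update_apply]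
      by_cases e : (tr i₁).1 = (tr i).1
      · exact ⟨i, by omega, e.symm, by rw [if_pos e]⟩
      · have hne : i₁ ≠ i := fun h => e (by rw [h])
        obtain ⟨i', hi', h₁, h₂⟩ := hc i₁ (by omega)
        exact ⟨i', by omega, h₁, by rw [if_neg e, h₂]⟩
    · trivial
  · refine ⟨⟨h0, h1, h12, h13, h14, by simp [h21], h22⟩, fun j _ u => harr j u, ?_, by simp⟩
    simp [harr]
  · rintro σ' ⟨⟨r0, r1, r12, r13, r14, r21, r22⟩, ha, hb, hc⟩
    exact ⟨r0, r1, r12, r14, r22, ha, hb, hc⟩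

theorem result_halts (hI : InputIs B inp n m tr) (hF : Fits W B X n (σ.arr 0))
    (h12 : σ.reg 12 = 5 + 3 * m) (h22 : σ.reg 22 = 0) :
    Halts W B inp (scan 10 12 resultCode.compile) σ (m * (65 + 8) + 8) fun σ' =>
      ((∃ i < m, σ.arr 4 (node (σ.arr 0) 2 (tr i).1 (tr i).1) ≠ 0) → σ'.reg 22 = 1) ∧
      ((¬ ∃ i < m, σ.arr 4 (node (σ.arr 0) 2 (tr i).1 (tr i).1) ≠ 0) → σ'.reg 22 = 0) := by
  have hl := hI.length
  have hsp := hF.space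
  have hrow := hF.row 0
  set α := σ.arr with hα
  let Inv : ℕ → ArrayState → Prop := fun i σ' => σ'.arr = α ∧ σ'.reg 12 = 5 + 3 * m ∧
      ((∃ i' < i, α 4 (node (α 0) 2 (tr i').1 (tr i').1) ≠ 0) → σ'.reg 22 = 1) ∧
      ((¬ ∃ i' < i, α 4 (node (α 0) 2 (tr i').1 (tr i').1) ≠ 0) → σ'.reg 22 = 0)
  refine (Halts.scan Inv (by omega) ?_ ?_ ?_ ?_).mono le_rfl ?_
  · rintro i σ w ⟨ha, hr⟩
    refine ⟨ha, ?_⟩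
    simpa [ArrayState.set_reg] using hr
  · rintro i σ ⟨-, hr, -⟩
    exact hr
  · rintro i hi σ ⟨ha, r12, hp, hn⟩ hx
    have hs := hI.source_lt i hi
    have hnode := hF.node_le (tr i).1 (f := 2) (by norm_num) hs
    refine Halts.of_wp (c := resultCode) ⟨by omega, ?_⟩
    rw [hx, hI.source i hi]
    refine mkNode_wp (by norm_num) ?_ ?_ ?_
    · simp [ArrayState.set_reg]; omega
    · simp only [ArrayState.set_reg, ArrayState.set_arr, if_true, ha]; omega
    simp only [Cmd.wp, ArrayState.set_reg, ArrayState.set_arr, if_true, ha]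
    refine ⟨by norm_num, by omega, by omega, fun e => ?_, fun e => ?_⟩
    · have hiff : (∃ i' < i + 1, α 4 (node (α 0) 2 (tr i').1 (tr i').1) ≠ 0) ↔
          ∃ i' < i, α 4 (node (α 0) 2 (tr i').1 (tr i').1) ≠ 0 := by
        constructor
        · rintro ⟨i', hi', h⟩
          rcases Nat.lt_succ_iff_lt_or_eq.1 hi' with h' | rfl
          · exact ⟨i', h', h⟩
          · exact absurd e h
        · rintro ⟨i', hi', h⟩
          exact ⟨i', by omega, h⟩
      refine ⟨⟨ha, ?_, ?_, ?_⟩, ?_⟩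
      · simp [ArrayState.set_reg, r12]
      · rw [hiff]; simpa [ArrayState.set_reg] using hp
      · rw [hiff]; simpa [ArrayState.set_reg] using hn
      · exact hx
    · refine ⟨by omega, ⟨ha, ?_, fun _ => ?_, fun h => absurd ⟨i, by omega, e⟩ h⟩, ?_⟩
      · simp [ArrayState.set_reg, r12]
      · simp [ArrayState.set_reg]
      · exact hx
  · exact ⟨rfl, h12, by simp, fun _ => h22⟩
  · rintro σ' ⟨-, -, h⟩
    exact h

end Algorithm

/-! ### Running time and output in terms of two reachability problems. -/

section Correctness

variable {W B : ℕ} {inp : ℕ → ℕ} {n m X : ℕ} {tr : ℕ → ℕ × ℕ × ℕ} {σ : ArrayState}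

/-- The edges of the backward reachability graph. -/
def ReachEdge (m : ℕ) (tr : ℕ → ℕ × ℕ × ℕ) (row : ℕ → ℕ) (a b : ℕ) : Prop :=
  ∃ i < m, ∃ j < m, (a, b) ∈ reachEdges row (tr i) (tr j)

/-- The edges of the graph of diverged pairs. -/
def DivergeEdge (m : ℕ) (tr : ℕ → ℕ × ℕ × ℕ) (row vis : ℕ → ℕ) (a b : ℕ) : Prop :=
  ∃ i < m, ∃ j < m, (a, b) ∈ divergeEdges row vis (tr i) (tr j)

theorem Halts.mono_time {P : Program} {T T' : ℕ} {Q : ArrayState → Prop}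
    (h : Halts W B inp P σ T Q) (hT : T ≤ T') : Halts W B inp P σ T' Q :=
  h.mono hT fun _ h => h

theorem reachEdges_le {row : ℕ → ℕ} (hF : Fits W B X n row) {t t' : ℕ × ℕ × ℕ} (h₁ : t.1 < n)
    (h₂ : t.2.2 < n) (h₁' : t'.1 < n) : ∀ e ∈ reachEdges row t t', e.1 ≤ X ∧ e.2 ≤ X := by
  have h3 : 3 ≤ X := by have := hF.row 0; omega
  have N := fun (f : ℕ) (hf : f < 4) p q (hq : q < n) => hF.node_le p hf hq
  intro e he
  simp only [reachEdges, List.mem_cons, List.not_mem_nil, or_false] at he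
  rcases he with rfl | rfl
  · exact ⟨h3, N 0 (by norm_num) _ _ h₁'⟩
  · exact ⟨N 0 (by norm_num) _ _ h₂, N 0 (by norm_num) _ _ h₁⟩

/-- The five alternatives follow the constructors of `Diverged`, with mark 1 for `false` and 2 for
`true`. The two conditions on `vis` will say that both transitions are internal. -/
theorem mem_divergeEdges {row vis : ℕ → ℕ} {t t' : ℕ × ℕ × ℕ} {e : ℕ × ℕ} :
    e ∈ divergeEdges row vis t t' ↔ vis (node row 0 t.1 t.2.2) ≠ 0 ∧
      vis (node row 0 t'.1 t'.2.2) ≠ 0 ∧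
      ((t.2.1 = t'.2.1 ∧ t.1 = t'.1 ∧ t.2.2 ≠ t'.2.2 ∧ e = (3, node row 2 t.2.2 t'.2.2)) ∨
      (t.2.1 = 0 ∧ t.1 = t'.1 ∧ t'.2.1 ≠ 0 ∧ e = (3, node row 1 t.2.2 t'.1)) ∨
      (t.2.1 = t'.2.1 ∧ t.2.1 ≠ 0 ∧ (e = (node row 1 t.1 t'.1, node row 2 t.2.2 t'.2.2) ∨
        e = (node row 2 t.1 t'.1, node row 2 t.2.2 t'.2.2))) ∨
      (t.2.1 = 0 ∧ (e = (node row 1 t.1 t'.1, node row 1 t.2.2 t'.1) ∨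
        e = (node row 2 t.1 t'.1, node row 2 t.2.2 t'.1))) ∨
      (t'.2.1 = 0 ∧ e = (node row 2 t.1 t'.1, node row 2 t.1 t'.2.2))) := by
  simp only [divergeEdges, List.mem_ite_nil_left, List.mem_ite_nil_right, List.mem_append,
    List.mem_singleton, ne_eq]
  refine and_congr_right fun _ => and_congr_right fun _ => ?_
  constructor
  · rintro ((⟨h₁, h₂⟩ | ⟨h₁, ⟨h₂, h₃, h₄⟩ | h | h⟩) | ⟨h₁, ⟨h₂, h | h⟩ | ⟨h₂, h₃, h₄⟩⟩) <;>
      first | (simp [*]; done) | tauto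
  · rintro (⟨h₁, h₂, h₃, h₄⟩ | ⟨h₁, h₂, h₃, h₄⟩ | ⟨h₁, h₂, h | h⟩ | ⟨h₁, h | h⟩ | ⟨h₁, h₂⟩) <;>
      first | (simp [*]; done) | tauto

theorem divergeEdges_le {row vis : ℕ → ℕ} (hF : Fits W B X n row) {t t' : ℕ × ℕ × ℕ}
    (h₁' : t'.1 < n) (h₂' : t'.2.2 < n) :
    ∀ e ∈ divergeEdges row vis t t', e.1 ≤ X ∧ e.2 ≤ X := by
  have h3 : 3 ≤ X := by have := hF.row 0; omega
  have N₁ : ∀ p, node row 1 p t'.1 ≤ X := fun p => hF.node_le p (by norm_num) h₁'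
  have N₂ : ∀ p, node row 2 p t'.1 ≤ X := fun p => hF.node_le p (by norm_num) h₁'
  have M₂ : ∀ p, node row 2 p t'.2.2 ≤ X := fun p => hF.node_le p (by norm_num) h₂'
  intro e he
  obtain ⟨-, -, ⟨-, -, -, rfl⟩ | ⟨-, -, -, rfl⟩ | ⟨-, -, rfl | rfl⟩ | ⟨-, rfl | rfl⟩ | ⟨-, rfl⟩⟩ :=
    mem_divergeEdges.1 he
  · exact ⟨h3, M₂ _⟩
  · exact ⟨h3, N₁ _⟩
  · exact ⟨N₁ _, M₂ _⟩
  · exact ⟨N₂ _, M₂ _⟩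
  · exact ⟨N₁ _, N₁ _⟩
  · exact ⟨N₂ _, N₂ _⟩
  · exact ⟨N₂ _, M₂ _⟩

/-- The program computes the answer if it is characterised by the two searches. -/
theorem mainCode_halts (hI : InputIs B inp n m tr) (hW : B + 8 * X + 8 ≤ W)
    (hX : 4 * (m * n + n) + 16 * (m * m) + 16 ≤ X)
    (h0 : σ.reg 0 = 1) (h1 : σ.reg 1 = 0) (h12 : σ.reg 12 = 5 + 3 * m) (h13 : σ.reg 13 = n)
    (h14 : σ.reg 14 = 0) (h21 : σ.reg 21 = 0) (h22 : σ.reg 22 = 0)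
    (harr : ∀ j u, σ.arr j u = 0) (Ans : Prop)
    (hAns : ∀ row vis : ℕ → ℕ, IsRow n m tr row →
      (∀ u, vis u ≠ 0 ↔ Relation.ReflTransGen (ReachEdge m tr row) 3 u) →
      ((∃ i < m, Relation.ReflTransGen (DivergeEdge m tr row vis) 3
        (node row 2 (tr i).1 (tr i).1)) ↔ Ans)) :
    Halts W B inp mainCode σ (100000 * (m * m + 1)) fun σ' =>
      (Ans → σ'.reg 22 = 1) ∧ (¬ Ans → σ'.reg 22 = 0) := by
  have hmm : m ≤ m * m := Nat.le_mul_self m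
  have hBW : B ≤ W := by omega
  have hR := rows_halts (W := W) hI (by omega) h0 h1 h12 h13 h14 h21 h22 harr
  refine Halts.mono_time (hR.seq
    (T₂ := (m * (35 + (m * (35 + reachCode.cost + 8) + 8) + 8) + 8) +
      (((2 * (8 * (m * m)) + 1) * ((searchStep 1 3).cost + 1) + 1 +
        (Cmd.seq (.set 3 3) (push 3)).cost) +
      ((m * (35 + (m * (35 + divergeCode.cost + 8) + 8) + 8) + 8) +
      (((2 * (8 * (m * m)) + 1) * ((searchStep 2 4).cost + 1) + 1 +
        (Cmd.seq (.set 3 3) (push 4)).cost) + (m * (65 + 8) + 8))))) ?_) ?_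
  · rintro σ₁ ⟨r0, r1, r12, r14, r22, hz, hb, hrow⟩
    set row := σ₁.arr 0 with hrowdef
    have hF : Fits W B X n row := ⟨hW, fun p => by have := hb p; omega⟩
    -- Cells are numbered from 1, because 0 marks the end of a list.
    have hG₁ : GraphState 1 σ₁.reg σ₁.arr 1 [] σ₁ :=
      ⟨fun _ _ => rfl, r1, by simp [r0], fun _ _ _ _ => rfl, fun u => hz 1 (by norm_num) u⟩
    refine (forPairs_halts (c := reachCode) (es := reachEdges row) (X := X) hI hBW
      (fun _ _ => by simp [reachEdges]) (by omega) hG₁ r12 fun ρ' i hi j hj ht ht' =>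
      reachCode_adds hF le_rfl ht ht' (hI.source_lt i hi) (hI.target_lt i hi)
        (hI.source_lt j hj)).seq ?_
    rintro σ₂ ⟨ρ₂, g₁, hσ₂, hk₂, hlen₁, hmem₁⟩
    have hRE : ∀ a b, (a, b) ∈ g₁ ↔ ReachEdge m tr row a b := fun a b => hmem₁ (a, b)
    refine ((search_halts (h := 1) (v := 3) (X := X) (Or.inl ⟨rfl, rfl⟩) hW ?_ (by omega)
      (by omega) (by omega) hσ₂ (by rw [hk₂ 14 (by norm_num), r14])
      (hz 3 (by norm_num))).mono_time (by gcongr)).seq ?_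
    · intro e he
      obtain ⟨i, hi, j, hj, he⟩ := (hmem₁ e).1 he
      exact reachEdges_le hF (hI.source_lt i hi) (hI.target_lt i hi) (hI.source_lt j hj) e he
    rintro σ₃ ⟨hρ₃, h1₃, h0₃, harr₃, hvis₃⟩
    simp only [hRE] at hvis₃
    have hrow₃ : σ₃.arr 0 = row :=
      harr₃ 0 (by norm_num) (by norm_num) (by norm_num) (by norm_num) (by norm_num)
    have hz₃ : ∀ j, j = 2 ∨ j = 4 → ∀ u, σ₃.arr j u = 0 := by
      intro j hj u
      rw [harr₃ j (by omega) (by omega) (by omega) (by omega) (by omega), hz j (by omega)]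
    have hreg₃ : ∀ r, r = 12 ∨ r = 13 ∨ r = 14 ∨ 21 ≤ r → σ₃.reg r = σ₁.reg r := fun r hr => by
      rw [hρ₃ r (by omega), hk₂ r hr]
    -- The second graph uses fresh cells after those of the first, and its heads and marks live in
    -- arrays that are still zero.
    have hG₃ : GraphState 2 σ₃.reg σ₃.arr (1 + g₁.length) [] σ₃ :=
      ⟨fun _ _ => rfl, h1₃, by simp [h0₃], fun _ _ _ _ => rfl, fun u => hz₃ 2 (Or.inl rfl) u⟩
    refine (forPairs_halts (c := divergeCode) (es := divergeEdges row (σ₃.arr 3)) (X := X) hI hBW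
      (length_divergeEdges_le _ _) (by omega) hG₃ (by rw [hreg₃ 12 (by norm_num), r12])
      fun ρ' i hi j hj ht ht' => hrow₃ ▸ divergeCode_adds (hrow₃.symm ▸ hF) (by omega) ht ht'
        (hI.source_lt i hi) (hI.target_lt i hi) (hI.source_lt j hj) (hI.target_lt j hj)).seq ?_
    rintro σ₄ ⟨ρ₄, g₂, hσ₄, hk₄, hlen₂, hmem₂⟩
    have hDE : ∀ a b, (a, b) ∈ g₂ ↔ DivergeEdge m tr row (σ₃.arr 3) a b :=
      fun a b => hmem₂ (a, b)
    refine ((search_halts (h := 2) (v := 4) (X := X) (Or.inr ⟨rfl, rfl⟩) hW ?_ (by omega)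
      (by omega) (by omega) hσ₄
      (by rw [hk₄ 14 (by norm_num), hreg₃ 14 (by norm_num), r14])
      (hz₃ 4 (Or.inr rfl))).mono_time (by gcongr)).seq ?_
    · intro e he
      obtain ⟨i, hi, j, hj, he⟩ := (hmem₂ e).1 he
      exact divergeEdges_le hF (hI.source_lt j hj) (hI.target_lt j hj) e he
    rintro σ₅ ⟨hρ₅, h1₅, h0₅, harr₅, hvis₅⟩
    simp only [hDE] at hvis₅
    have hrow₅ : σ₅.arr 0 = row := by
      rw [harr₅ 0 (by norm_num) (by norm_num) (by norm_num) (by norm_num) (by norm_num), hrow₃]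
    have hreg₅ : ∀ r, r = 12 ∨ r = 13 ∨ r = 14 ∨ 21 ≤ r → σ₅.reg r = σ₁.reg r := fun r hr => by
      rw [hρ₅ r (by omega), hk₄ r hr, hreg₃ r hr]
    refine (result_halts hI (hrow₅.symm ▸ hF) (by rw [hreg₅ 12 (by norm_num), r12])
      (by rw [hreg₅ 22 (by norm_num), r22])).mono le_rfl ?_
    intro σ₆ hσ₆
    rw [hrow₅] at hσ₆
    simp only [hvis₅] at hσ₆
    rwa [hAns row (σ₃.arr 3) hrow hvis₃] at hσ₆
  · have e₁ : reachCode.cost ≤ 2000 := by decide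
    have e₂ : divergeCode.cost ≤ 2000 := by decide
    have e₃ : (searchStep 1 3).cost ≤ 200 := by decide
    have e₄ : (searchStep 2 4).cost ≤ 200 := by decide
    have e₅ : (Cmd.seq (.set 3 3) (push 3)).cost ≤ 200 := by decide
    have e₆ : (Cmd.seq (.set 3 3) (push 4)).cost ≤ 200 := by decide
    -- Linear terms are absorbed through `m ≤ m * m`.
    have c₁ : ∀ c, c ≤ 2000 → m * (35 + (m * (35 + c + 8) + 8) + 8) + 8 ≤
        3000 * (m * m) + 8 := by
      intro c hc
      have := Nat.mul_le_mul_left (m * m) (show 35 + c + 8 ≤ 2043 by omega)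
      have e : m * (35 + (m * (35 + c + 8) + 8) + 8) = m * m * (35 + c + 8) + 51 * m := by ring
      omega
    have c₂ : ∀ c, c ≤ 200 → (2 * (8 * (m * m)) + 1) * (c + 1) ≤ 4000 * (m * m) + 201 := by
      intro c hc
      have := Nat.mul_le_mul_left (2 * (8 * (m * m)) + 1) (show c + 1 ≤ 201 by omega)
      omega
    have := c₁ _ e₁
    have := c₁ _ e₂
    have := c₂ _ e₃
    have := c₂ _ e₄
    omega

end Correctness

/-! ### The two searches compute reachability in the automaton and the diverged pairs. -/

section Answer

open Relation (ReflTransGen)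

variable {k n : ℕ} {A : εNFA (Fin k) (Fin n)} {E : List (Fin n × Option (Fin k) × Fin n)}
  {row vis : ℕ → ℕ}

theorem labelCode_eq_zero {l : Option (Fin k)} : labelCode l = 0 ↔ l = none := by
  cases l <;> simp [labelCode]

theorem labelCode_injective : Function.Injective (labelCode (k := k)) := by
  rintro (_ | a) (_ | b) h <;> simp [labelCode] at h ⊢
  exact Fin.ext h

/-- The code of a transition. -/
def transitionCode (t : Fin n × Option (Fin k) × Fin n) : ℕ × ℕ × ℕ :=
  (t.1, labelCode t.2.1, t.2.2)

/-- The codes of the transitions in a list. -/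
def codes (E : List (Fin n × Option (Fin k) × Fin n)) (i : ℕ) : ℕ × ℕ × ℕ :=
  (E.map transitionCode).getD i (0, 0, 0)

theorem codes_eq {i : ℕ} (hi : i < E.length) : codes E i = transitionCode E[i] := by
  simp [codes, hi]

theorem exists_codes (hE : Enumerates E (transitions A)) {P : ℕ × ℕ × ℕ → Prop} :
    (∃ i < E.length, P (codes E i)) ↔ ∃ t ∈ transitions A, P (transitionCode t) := by
  constructor
  · rintro ⟨i, hi, h⟩
    rw [codes_eq hi] at h
    exact ⟨_, (hE.2 _).1 (List.getElem_mem hi), h⟩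
  · rintro ⟨t, ht, h⟩
    obtain ⟨i, hi, rfl⟩ := List.mem_iff_getElem.1 ((hE.2 t).2 ht)
    exact ⟨i, hi, by rwa [codes_eq hi]⟩

theorem reachEdge_iff (hE : Enumerates E (transitions A)) {a b : ℕ} :
    ReachEdge E.length (codes E) row a b ↔ ∃ t ∈ transitions A, ∃ t' ∈ transitions A,
      (a, b) ∈ reachEdges row (transitionCode t) (transitionCode t') := by
  unfold ReachEdge
  rw [exists_codes hE (P := fun c => ∃ j < E.length, (a, b) ∈ reachEdges row c (codes E j))]
  exact exists_congr fun t => and_congr_right fun _ =>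
    exists_codes hE (P := fun c => (a, b) ∈ reachEdges row (transitionCode t) c)

theorem divergeEdge_iff (hE : Enumerates E (transitions A)) {a b : ℕ} :
    DivergeEdge E.length (codes E) row vis a b ↔ ∃ t ∈ transitions A, ∃ t' ∈ transitions A,
      (a, b) ∈ divergeEdges row vis (transitionCode t) (transitionCode t') := by
  unfold DivergeEdge
  rw [exists_codes hE (P := fun c => ∃ j < E.length, (a, b) ∈ divergeEdges row vis c (codes E j))]
  exact exists_congr fun t => and_congr_right fun _ =>
    exists_codes hE (P := fun c => (a, b) ∈ divergeEdges row vis (transitionCode t) c)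

/-- The state `p` is the source of a transition. -/
def IsSource (A : εNFA (Fin k) (Fin n)) (p : Fin n) : Prop := ∃ t ∈ transitions A, t.1 = p

theorem IsRow.exists_eq (hE : Enumerates E (transitions A)) (hrow : IsRow n E.length (codes E) row)
    {p : Fin n} (hp : IsSource A p) : ∃ i, row p = i * n ∧ (codes E i).1 = p := by
  obtain ⟨t, ht, rfl⟩ := hp
  obtain ⟨i, hi, rfl⟩ := List.mem_iff_getElem.1 ((hE.2 t).2 ht)
  obtain ⟨i', -, h₁, h₂⟩ := hrow i hi
  rw [codes_eq hi] at h₁ h₂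
  exact ⟨i', h₂, h₁⟩

theorem IsRow.node_injective (hE : Enumerates E (transitions A))
    (hrow : IsRow n E.length (codes E) row) {f f' : ℕ} {p p' q q' : Fin n} (hf : f < 4)
    (hf' : f' < 4) (hp : IsSource A p) (hp' : IsSource A p')
    (h : node row f p q = node row f' p' q') : f = f' ∧ p = p' ∧ q = q' := by
  obtain ⟨i, hi, hi'⟩ := hrow.exists_eq hE hp
  obtain ⟨j, hj, hj'⟩ := hrow.exists_eq hE hp'
  unfold node at h
  have hff : f = f' := by omega
  have hs : row p + q = row p' + q' := by omega
  rw [hi, hj] at hs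
  have hn : 0 < n := q.pos
  -- Since `q` and `q'` are below `n`, division by `n` recovers the transition index, and the index
  -- recovers the source.
  have hij : i = j := by
    have := congrArg (· / n) hs
    simpa [Nat.mul_comm _ n, Nat.mul_add_div hn, Nat.div_eq_of_lt q.2, Nat.div_eq_of_lt q'.2]
      using this
  subst hij
  exact ⟨hff, Fin.ext (hi'.symm.trans hj'), Fin.ext (by omega)⟩

/-- The marks in use are 0, 1 and 2; residue 3 modulo 4 is left to the root. -/
theorem node_ne_three {f : ℕ} (hf : f < 3) (p q : ℕ) : node row f p q ≠ 3 := by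
  unfold node
  omega

/-- A search backwards from `p`, run for all sources `p` at once: the first coordinate never changes
along an edge. The second transition of each pair contributes only its source. -/
theorem reachEdge_spec (hE : Enumerates E (transitions A))
    (hrow : IsRow n E.length (codes E) row) {p q : Fin n} (hp : IsSource A p) :
    ReflTransGen (ReachEdge E.length (codes E) row) 3 (node row 0 p q) ↔ Reach A q p := by
  constructor
  · intro h
    have key : ∀ u, ReflTransGen (ReachEdge E.length (codes E) row) 3 u → u = 3 ∨
        ∃ p q : Fin n, IsSource A p ∧ u = node row 0 p q ∧ Reach A q p := by
      intro u hu
      induction hu with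
      | refl => exact Or.inl rfl
      | tail _ hab ih =>
        obtain ⟨t, ht, t', ht', hm⟩ := (reachEdge_iff hE).1 hab
        simp only [reachEdges, List.mem_cons, List.not_mem_nil, or_false, Prod.mk.injEq] at hm
        rcases hm with ⟨rfl, rfl⟩ | ⟨rfl, rfl⟩
        · exact Or.inr ⟨t'.1, t'.1, ⟨t', ht', rfl⟩, rfl, Reach.refl _⟩
        · rcases ih with h | ⟨p, q, hp, h, hr⟩
          · exact absurd h (node_ne_three (by norm_num) _ _)
          · obtain ⟨-, e₁, e₂⟩ := hrow.node_injective hE (by norm_num) (by norm_num) ⟨t', ht', rfl⟩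
              hp (q := t.2.2) h
            subst e₁ e₂
            exact Or.inr ⟨t'.1, t.1, ⟨t', ht', rfl⟩, rfl, (reach_of_mem ht).trans hr⟩
    rcases key _ h with h | ⟨p', q', hp', h, hr⟩
    · exact absurd h (node_ne_three (by norm_num) _ _)
    · obtain ⟨-, rfl, rfl⟩ := hrow.node_injective hE (by norm_num) (by norm_num) hp hp' h
      exact hr
  · rintro ⟨π, hπ⟩
    obtain ⟨t', ht', hs⟩ := hp
    induction π generalizing q with
    | nil =>
      obtain rfl : q = p := hπ
      subst hs
      exact .single ((reachEdge_iff hE).2 ⟨t', ht', t', ht', by simp [reachEdges, transitionCode]⟩)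
    | cons t π ih =>
      obtain ⟨ht, rfl, hπ⟩ := hπ
      subst hs
      exact (ih hπ).tail ((reachEdge_iff hE).2
        ⟨t, ht, t', ht', by simp [reachEdges, transitionCode]⟩)

theorem divergeEdge_spec (hE : Enumerates E (transitions A))
    (hrow : IsRow n E.length (codes E) row)
    (hvis : ∀ u, vis u ≠ 0 ↔ ReflTransGen (ReachEdge E.length (codes E) row) 3 u)
    {p q : Fin n} (hp : IsSource A p) :
    ReflTransGen (DivergeEdge E.length (codes E) row vis) 3 (node row 2 p q) ↔
      Diverged A true p q := by
  have hint : ∀ t ∈ transitions A, vis (node row 0 (transitionCode t).1 (transitionCode t).2.2) ≠ 0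
      ↔ IsInternal A t := fun t ht => by
    rw [hvis]
    exact (reachEdge_spec hE hrow ⟨t, ht, rfl⟩).trans (and_iff_right ht).symm
  have hsrc : ∀ {b p q}, Diverged A b p q → IsSource A p := fun h => by
    obtain ⟨⟨t, ht, hs⟩, -⟩ := h.exists_next
    exact ⟨t, ht.1, hs⟩
  let mk : Bool → ℕ := fun b => if b then 2 else 1
  have hmk : ∀ b, mk b < 3 := by decide
  have hmk' : Function.Injective mk := by decide
  constructor
  · intro h
    have key : ∀ u, ReflTransGen (DivergeEdge E.length (codes E) row vis) 3 u → u = 3 ∨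
        ∃ (b : Bool) (p q : Fin n), u = node row (mk b) p q ∧ Diverged A b p q := by
      intro u hu
      induction hu with
      | refl => exact Or.inl rfl
      | tail _ hab ih =>
        obtain ⟨t, ht, t', ht', hm⟩ := (divergeEdge_iff hE).1 hab
        obtain ⟨hi, hi', hm⟩ := mem_divergeEdges.1 hm
        replace hi := (hint t ht).1 hi
        replace hi' := (hint t' ht').1 hi'
        -- Injectivity of the numbering identifies the tail of the edge with the diverged pair
        -- supplied by the induction.
        have back : ∀ b p, IsSource A t.1 → p = node row (mk b) t.1 t'.1 →
            (p = 3 ∨ ∃ (b : Bool) (p' q : Fin n), p = node row (mk b) p' q ∧ Diverged A b p' q) →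
            Diverged A b t.1 t'.1 := by
          rintro b p hs rfl (h | ⟨b', p', q, h, hd⟩)
          · exact absurd h (node_ne_three (hmk b) _ _)
          · obtain ⟨e₁, rfl, rfl⟩ := hrow.node_injective hE (by have := hmk b; omega)
              (by have := hmk b'; omega) hs (hsrc hd) h
            rwa [hmk' e₁]
        replace back := fun b p => back b p ⟨t, ht, rfl⟩
        simp only [transitionCode, Prod.mk.injEq, labelCode_eq_zero,
          labelCode_injective.eq_iff, Fin.val_inj, ne_eq] at hm
        rcases hm with ⟨hl, hs, hne, rfl, rfl⟩ | ⟨hl, hs, hl', rfl, rfl⟩ |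
          ⟨hl, hl', ⟨ha, rfl⟩ | ⟨ha, rfl⟩⟩ | ⟨hl, ⟨ha, rfl⟩ | ⟨ha, rfl⟩⟩ | ⟨hl, ha, rfl⟩
        · exact Or.inr ⟨true, _, _, rfl, .fork hi hi' hs hl hne⟩
        · exact Or.inr ⟨false, _, _, rfl, .lead hi hi' hs hl hl'⟩
        · exact Or.inr ⟨true, _, _, rfl, .letter (back false _ ha ih) hi hi' hl hl'⟩
        · exact Or.inr ⟨true, _, _, rfl, .letter (back true _ ha ih) hi hi' hl hl'⟩
        · exact Or.inr ⟨false, _, _, rfl, .first (back false _ ha ih) hi hl⟩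
        · exact Or.inr ⟨true, _, _, rfl, .first (back true _ ha ih) hi hl⟩
        · exact Or.inr ⟨true, _, _, rfl, .second (back true _ ha ih) hi' hl⟩
    rcases key _ h with h | ⟨b, p', q', h, hd⟩
    · exact absurd h (node_ne_three (by norm_num) _ _)
    · obtain ⟨e, rfl, rfl⟩ := hrow.node_injective hE (by norm_num) (by have := hmk b; omega) hp
        (hsrc hd) h
      obtain rfl : true = b := hmk' e
      exact hd
  · have edge : ∀ {t t' : Fin n × Option (Fin k) × Fin n} {a b : ℕ}, IsInternal A t →
        IsInternal A t' → _ → DivergeEdge E.length (codes E) row vis a b :=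
      fun {t t' a b} hi hi' h => (divergeEdge_iff hE).2 ⟨t, hi.1, t', hi'.1,
        mem_divergeEdges.2 ⟨(hint t hi.1).2 hi, (hint t' hi'.1).2 hi', h⟩⟩
    have key : ∀ {b p q}, Diverged A b p q →
        ReflTransGen (DivergeEdge E.length (codes E) row vis) 3 (node row (mk b) p q) := by
      intro b p q h
      induction h with
      | @fork t t' hi hi' hs hl ht =>
        refine .single (edge hi hi' (Or.inl ⟨?_, ?_, ?_, rfl⟩)) <;>
          simp [transitionCode, hs, hl, Fin.val_inj, ht]
      | @lead t t' hi hi' hs hl hl' =>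
        refine .single (edge hi hi' (Or.inr (Or.inl ⟨?_, ?_, ?_, rfl⟩))) <;>
          simp [transitionCode, hs, hl, hl', labelCode_eq_zero]
      | @letter b t t' h hi hi' hl hl' ih =>
        refine ih.tail (edge hi hi' (Or.inr (Or.inr (Or.inl ⟨?_, ?_, ?_⟩))))
        · simp [transitionCode, hl]
        · simp [transitionCode, labelCode_eq_zero, hl']
        · cases b
          · exact Or.inl rfl
          · exact Or.inr rfl
      | @first b t q h hi hl ih =>
        -- Edges come from pairs of internal transitions, so the idle component also needs a
        -- transition leaving its state.
        obtain ⟨-, t', hi', rfl⟩ := h.exists_next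
        refine ih.tail (edge hi hi' (Or.inr (Or.inr (Or.inr (Or.inl ⟨?_, ?_⟩)))))
        · simp [transitionCode, labelCode_eq_zero, hl]
        · cases b
          · exact Or.inl rfl
          · exact Or.inr rfl
      | @second p t' h hi' hl ih =>
        obtain ⟨⟨t, hi, rfl⟩, -⟩ := h.exists_next
        refine ih.tail (edge hi hi' (Or.inr (Or.inr (Or.inr (Or.inr ⟨?_, rfl⟩)))))
        simp [transitionCode, labelCode_eq_zero, hl]
    exact fun h => key h

/-- Both members of a diverged pair are sources, so it is enough to inspect the diagonal at sources
of transitions. -/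
theorem answer_iff (hA : EpsCycleFree A) (hE : Enumerates E (transitions A))
    (hrow : IsRow n E.length (codes E) row)
    (hvis : ∀ u, vis u ≠ 0 ↔ ReflTransGen (ReachEdge E.length (codes E) row) 3 u) :
    (∃ i < E.length, ReflTransGen (DivergeEdge E.length (codes E) row vis) 3
      (node row 2 (codes E i).1 (codes E i).1)) ↔ HasTwinCycles A := by
  rw [exists_codes hE (P := fun c => ReflTransGen (DivergeEdge E.length (codes E) row vis) 3
    (node row 2 c.1 c.1)), hasTwinCycles_iff_exists_diverged hA]
  constructor
  · rintro ⟨t, ht, h⟩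
    exact ⟨t.1, (divergeEdge_spec hE hrow hvis ⟨t, ht, rfl⟩).1 h⟩
  · rintro ⟨p, h⟩
    obtain ⟨⟨t, ht, rfl⟩, -⟩ := h.exists_next
    exact ⟨t, ht.1, (divergeEdge_spec hE hrow hvis ⟨t, ht.1, rfl⟩).2 h⟩

end Answer

/-! ### Reading the input and assembling the decision procedure. -/

section Input

variable {k n : ℕ} {A : εNFA (Fin k) (Fin n)} {E : List (Fin n × Option (Fin k) × Fin n)}
  {I F : List (Fin n)} {W : ℕ}

theorem Enumerates.length_eq_ncard {β : Type*} {l : List β} {S : Set β} (h : Enumerates l S) :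
    l.length = S.ncard := by
  classical
  have : S = (l.toFinset : Set β) := by ext b; simp [h.2]
  rw [this, Set.ncard_coe_finset, List.toFinset_card_of_nodup h.1]

theorem getD_flatMap_transitions (E : List (Fin n × Option (Fin k) × Fin n)) (R : List ℕ) (i : ℕ)
    (hi : i < E.length) :
    let L := E.flatMap (fun t => [(t.1 : ℕ), labelCode t.2.1, (t.2.2 : ℕ)]) ++ R
    L.getD (3 * i) 0 = (codes E i).1 ∧ L.getD (3 * i + 1) 0 = (codes E i).2.1 ∧
      L.getD (3 * i + 2) 0 = (codes E i).2.2 := by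
  induction E generalizing i with
  | nil => simp at hi
  | cons t E ih =>
    cases i with
    | zero => simp [codes, transitionCode]
    | succ i =>
      have := ih i (by simpa using hi)
      simp only [List.flatMap_cons, List.cons_append, List.nil_append,
        show 3 * (i + 1) = 3 * i + 1 + 1 + 1 by ring, List.getD_cons_succ,
        show 3 * i + 1 + 1 + 1 + 1 = 3 * i + 1 + 1 + 1 + 1 by ring,
        show 3 * i + 1 + 1 + 1 + 2 = 3 * i + 2 + 1 + 1 + 1 by ring]
      simpa [codes] using this

theorem encode_eq : encode E I F = k :: n :: E.length :: I.length :: F.length ::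
    (E.flatMap (fun t => [(t.1 : ℕ), labelCode t.2.1, (t.2.2 : ℕ)]) ++
      (I.map (fun q => (q : ℕ)) ++ F.map (fun q => (q : ℕ)))) := by
  simp [encode]

theorem length_encode : (encode E I F).length = 5 + 3 * E.length + I.length + F.length := by
  have : (E.flatMap fun t => [(t.1 : ℕ), labelCode t.2.1, (t.2.2 : ℕ)]).length = 3 * E.length := by
    rw [List.length_flatMap]
    simp [mul_comm]
  simp only [encode_eq, List.length_cons, List.length_append, this]
  simp
  omega

theorem inputIs_encode : InputIs (5 + 3 * E.length + I.length + F.length)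
    (fun i => (encode E I F).getD i 0) n E.length (codes E) := by
  have key := getD_flatMap_transitions E (I.map (fun q => (q : ℕ)) ++ F.map (fun q => (q : ℕ)))
  refine ⟨by omega, fun i hi => ?_, fun i hi => ?_, fun i hi => ?_, fun i hi => ?_, fun i hi => ?_⟩
  · rw [encode_eq, show 5 + 3 * i = 3 * i + 1 + 1 + 1 + 1 + 1 by ring]
    simpa only [List.getD_cons_succ] using (key i hi).1
  · rw [encode_eq, show 5 + 3 * i + 1 = 3 * i + 1 + 1 + 1 + 1 + 1 + 1 by ring]
    simpa only [List.getD_cons_succ] using (key i hi).2.1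
  · rw [encode_eq, show 5 + 3 * i + 2 = 3 * i + 2 + 1 + 1 + 1 + 1 + 1 by ring]
    simpa only [List.getD_cons_succ] using (key i hi).2.2
  · rw [codes_eq hi]; exact Fin.is_lt _
  · rw [codes_eq hi]; exact Fin.is_lt _

/-- Reads the header of the input. -/
def prelude : List Instr :=
  [.const 0 1, .load 16 0, .const 0 2, .load 0 0, .add 1 0 0, .add 1 1 0, .const 2 5, .add 1 1 2,
    .copy 15 1, .const 0 3, .load 0 0, .add 1 1 0, .const 0 4, .load 0 0, .add 1 1 0, .const 3 1]

/-- The decision procedure for exponential ambiguity. -/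
def decisionProgram : Program :=
  .after prelude (.seq mainCode (.instr (.copy 0 25)))

theorem exec_load_after {x y v : ℕ} {l : List Instr} {P : Program} {s s' : RAMState} {t : ℕ}
    (hv : s.mem (s.reg y) = v) (h : Exec W (.after l P) (s.setReg x v) t s') :
    Exec W (.after (.load x y :: l) P) s (1 + t) s' := by
  subst hv
  exact .seq (.instr rfl) h

theorem exec_copy_after {x y v : ℕ} {l : List Instr} {P : Program} {s s' : RAMState} {t : ℕ}
    (hv : s.reg y = v) (h : Exec W (.after l P) (s.setReg x v) t s') :
    Exec W (.after (.copy x y :: l) P) s (1 + t) s' := by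
  subst hv
  exact .seq (.instr rfl) h

/-- The state of the arrays and registers after the header has been read. -/
def startState (m n : ℕ) : ArrayState where
  reg r := if r = 0 then 1 else if r = 12 then 5 + 3 * m else if r = 13 then n else 0
  arr _ _ := 0

theorem exec_prelude (hW : 5 + 3 * E.length + I.length + F.length ≤ W) :
    ∃ s, Represents (5 + 3 * E.length + I.length + F.length) (fun i => (encode E I F).getD i 0)
        (startState E.length n) s ∧
      ∀ P t s', Exec W P s t s' →
        Exec W (.after prelude P) (initialState (encode E I F)) (16 + t) s' := by
  set m := E.length with hm
  set s₀ := initialState (encode E I F) with hs₀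
  have hmem : ∀ i, s₀.mem i = (encode E I F).getD i 0 := fun _ => rfl
  have e₁ : s₀.mem 1 = n := by rw [hmem, encode_eq]; rfl
  have e₂ : s₀.mem 2 = m := by rw [hmem, encode_eq]; rfl
  have e₃ : s₀.mem 3 = I.length := by rw [hmem, encode_eq]; rfl
  have e₄ : s₀.mem 4 = F.length := by rw [hmem, encode_eq]; rfl
  have hreg : ∀ r, s₀.reg r = 0 := fun _ => rfl
  let s : RAMState := (((((((((((((((s₀.setReg 0 1).setReg 16 n).setReg 0 2).setReg 0 m).setReg 1
    (2 * m)).setReg 1 (3 * m)).setReg 2 5).setReg 1 (5 + 3 * m)).setReg 15 (5 + 3 * m)).setReg 0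
    3).setReg 0 I.length).setReg 1 (5 + 3 * m + I.length)).setReg 0 4).setReg 0 F.length).setReg 1
    (5 + 3 * m + I.length + F.length)).setReg 3 1
  refine ⟨s, ⟨?_, fun r => ?_, fun j _ i => ?_, fun i _ => rfl⟩, fun P t s' h => ?_⟩
  · simp [s, RAMState.setReg]
  · simp only [s, RAMState.setReg, startState, Function.update_apply, hreg]
    split_ifs <;> first | contradiction | omega
  -- The arrays begin just beyond the input, where the default value makes them zero at no cost.
  · change (encode E I F).getD _ 0 = 0
    rw [List.getD_eq_default]
    rw [length_encode]
    omega
  · rw [show 16 + t = 1 + (1 + (1 + (1 + (1 + (1 + (1 + (1 + (1 + (1 + (1 + (1 + (1 + (1 + (1 +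
      (1 + t))))))))))))))) by omega]
    refine exec_const_after (by omega) (exec_load_after ?_ (exec_const_after (by omega)
      (exec_load_after ?_ (exec_add_after ?_ (by omega) (exec_add_after ?_ (by omega)
      (exec_const_after (by omega) (exec_add_after ?_ (by omega) (exec_copy_after ?_
      (exec_const_after (by omega) (exec_load_after ?_ (exec_add_after ?_ (by omega)
      (exec_const_after (by omega) (exec_load_after ?_ (exec_add_after ?_ (by omega)
      (exec_const_after (by omega) h)))))))))))))))
    all_goals simp [RAMState.setReg, e₁, e₂, e₃, e₄]
    all_goals omega

theorem decisionProgram_correct (hT : IsTrim A) (hA : EpsCycleFree A)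
    (hE : Enumerates E (transitions A)) (hI : Enumerates I A.start)
    (hF : Enumerates F A.accept) :
    ∃ t s, Exec (200000 * (k + n + numTransitions A + 1) ^ 2) decisionProgram
        (initialState (encode E I F)) t s ∧ t ≤ 200000 * (numTransitions A ^ 2 + 1) ∧
      (ExponentiallyAmbiguous A → s.reg 0 = 1) ∧ (¬ ExponentiallyAmbiguous A → s.reg 0 = 0) := by
  have hm : numTransitions A = E.length := hE.length_eq_ncard.symm
  have hIl : I.length ≤ n := by simpa using hI.1.length_le_card
  have hFl : F.length ≤ n := by simpa using hF.1.length_le_card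
  rw [hm]
  have hInp := inputIs_encode (E := E) (I := I) (F := F)
  have hans := fun row vis => answer_iff (row := row) (vis := vis) hA hE
  have hpre := fun W => exec_prelude (E := E) (I := I) (F := F) (W := W)
  generalize E.length = m at *
  generalize hWdef : 200000 * (k + n + m + 1) ^ 2 = W
  obtain ⟨X, hXdef⟩ : ∃ X, 4 * (m * n + n) + 16 * (m * m) + 16 = X := ⟨_, rfl⟩
  -- `I` and `F` list states without repetition, so they have at most `n` entries, and the whole
  -- memory in use is quadratic in `n + m + 1`.
  have hW : (5 + 3 * m + I.length + F.length) + 8 * X + 8 ≤ W := by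
    have h₁ : (n + m + 1) ^ 2 ≤ (k + n + m + 1) ^ 2 := Nat.pow_le_pow_left (by omega) 2
    have h₂ : (n + m + 1) ^ 2 = n * n + m * m + 2 * (m * n) + 2 * n + 2 * m + 1 := by ring
    omega
  obtain ⟨s₀, hs₀, hpre⟩ := hpre W (by omega)
  obtain ⟨t, s, σ, hex, ht, hrep, hout⟩ := mainCode_halts (W := W) hInp hW hXdef.le
    (σ := startState m n) rfl rfl rfl rfl rfl rfl rfl (fun _ _ => rfl) (ExponentiallyAmbiguous A)
    (fun row vis hrow hvis => (hans row vis hrow hvis).trans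
      (exponentiallyAmbiguous_iff_hasTwinCycles hT hA).symm) s₀ hs₀
  -- Machine register 22 is RAM register 25, because the first three RAM registers are reserved.
  have hreg : s.reg 25 = σ.reg 22 := hrep.2.1 22
  have hfin : Exec W decisionProgram (initialState (encode E I F)) (16 + (t + 1))
      (s.setReg 0 (s.reg 25)) := by
    unfold decisionProgram
    exact hpre _ _ _ (.seq hex (.instr rfl))
  refine ⟨_, _, hfin, ?_, fun h => ?_, fun h => ?_⟩
  · rw [sq]; omega
  · simp [RAMState.setReg, hreg, hout.1 h]
  · simp [RAMState.setReg, hreg, hout.2 h]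

end Input

end Ambiguity

theorem mainTheorem2 :
    (∃ (P : Ambiguity.Program) (C : ℕ),
      ∀ (k n : ℕ) (A : εNFA (Fin k) (Fin n)), Ambiguity.IsTrim A → Ambiguity.EpsCycleFree A →
      ∀ (E : List (Fin n × Option (Fin k) × Fin n)) (I F : List (Fin n)),
        Ambiguity.Enumerates E (Ambiguity.transitions A) →
        Ambiguity.Enumerates I A.start → Ambiguity.Enumerates F A.accept →
        ∃ (t : ℕ) (s : Ambiguity.RAMState),
          Ambiguity.Exec (C * (k + n + Ambiguity.numTransitions A + 1) ^ 2) P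
            (Ambiguity.initialState (Ambiguity.encode E I F)) t s ∧
          t ≤ C * (Ambiguity.numTransitions A ^ 2 + 1) ∧
          (Ambiguity.ExponentiallyAmbiguous A → s.reg 0 = 1) ∧
          (¬ Ambiguity.ExponentiallyAmbiguous A → s.reg 0 = 0)) ∧
    (∀ (k n : ℕ) (A : εNFA (Fin k) (Fin n)), Ambiguity.IsTrim A → Ambiguity.EpsCycleFree A →
      (Ambiguity.ExponentiallyAmbiguous A ↔
        ∃ x y : {s // Ambiguity.OnSuccessfulPath (Ambiguity.inter A A) s},
          Ambiguity.SameSCC (Ambiguity.trimmed (Ambiguity.inter A A)) x y ∧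
          x.1.1 = x.1.2.1 ∧ y.1.1 ≠ y.1.2.1)) :=
  ⟨⟨Ambiguity.decisionProgram, 200000, fun _ _ _ hT hA _ _ _ hE hI hF =>
    Ambiguity.decisionProgram_correct hT hA hE hI hF⟩, fun _ _ _ hT hA =>
    (Ambiguity.exponentiallyAmbiguous_iff_hasTwinCycles hT hA).trans
      (Ambiguity.hasTwinCycles_iff_scc hT hA)⟩
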